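/- **Theorem 5.3 (integrals against the jump measure).** Let $T\in[0,\infty]$ (with $[0,T]$ read as $[0,\infty)$ if $T=\infty$) and let $L=(L_t)_{0\le t\le T}$ be a real-valued Lévy process on a filtered probability space $(\Omega,\mathcal F,(\mathcal F_t)_{0\le t\le T},P)$: $L$ is càdlàg and adapted, $L_0=0$ a.s., $L_t-L_s$ is independent of $\mathcal F_s$ for $s<t$, the law of $L_{t+s}-L_t$ does not depend on $t$, and $L$ is stochastically continuous. Put $\Delta L_t=L_t-L_{t-}$ (with $L_{0-}:=L_0$), let $$\mu^L(\omega;t,B)=\#\{0\le s\le t:\ \Delta L_s(\omega)\in B\},\qquad B\in\mathcal B(\mathbb R\setminus\{0\}),$$ be the random measure of jumps of $L$, and let $\nu(B)=E[\mu^L(1,B)]$ be the Lévy measure of $L$ (if $0<T<1$, $\nu(B)=\tfrac1T E[\mu^L(T,B)]$; if $T=0$, $\nu=0$). Let $A\in\mathcal B(\mathbb R\setminus\{0\})$ with $0\notin\overline A$, let $f:\mathbb R\to\mathbb R$ be Borel measurable, and write $$X_t=\int_0^t\!\int_A f(x)\,\mu^L(ds,dx)=\sum_{0\le s\le t} f(\Delta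 L_s)\,1_A(\Delta L_s),\qquad 0\le t\le T .$$ **A.** $(X_t)_{0\le t\le T}$ is a compound Poisson process: it is a Lévy process with respect to $(\mathcal F_t)$, and there are $\lambda\ge 0$ and a probability measure $F$ on $\mathbb R$ such that it has the same law as $\big(\sum_{k=1}^{N_t}J_k\big)_{0\le t\le T}$, where $N$ is a Poisson process with intensity $\lambda$ and $(J_k)_{k\ge1}$ is an i.i.d. sequence with law $F$, independent of $N$. For all $0\le t\le T$ and $u\in\mathbb R$ the function $x\mapsto e^{iuf(x)}-1$ is $\nu$-integrable on $A$ and $$E\big[e^{iuX_t}\big]=\exp\Big(t\int_A\big(e^{iuf(x)}-1\big)\,\nu(dx)\Big).$$ **B.** If $f\in L^1(A,\nu)$, then for all $0\le t\le T$ the variable $X_t$ is integrable and $E[X_t]=t\int_A f(x)\,\nu(dx)$. **C.** If $f\in L^2(A,\nu)$, then for all $0\le t\le T$ the variable $X_t$ is square integrable and $\operatorname{Var}(X_t)=t\int_A |f(x)|^2\,\nu(dx)$. -/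

import Mathlib

open MeasureTheory ProbabilityTheory Filter Topology
open scoped NNReal ENNReal

universe u

/-- The time set `[0,T]` for a horizon `T ∈ [0,∞]`; it is `[0,∞)` when `T = ∞`. -/
def TimeSet (T : ℝ≥0∞) : Set ℝ≥0 := {t | (t : ℝ≥0∞) ≤ T}

/-- The path `x`, considered on `[0,T]`, is right-continuous with left limits. -/
def IsCadlagOn (T : ℝ≥0∞) (x : ℝ≥0 → ℝ) : Prop :=
  (∀ t : ℝ≥0, (t : ℝ≥0∞) < T → ContinuousWithinAt x (Set.Ioi t) t) ∧
  (∀ t ∈ TimeSet T, ∃ l : ℝ, Tendsto x (𝓝[<] t) (𝓝 l))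

/-- Lévy processes on `[0,T]` with respect to a filtration. Only the values of the process and of
the filtration at times in `[0,T]` matter. -/
structure IsLevyProcess {Ω : Type u} {mΩ : MeasurableSpace Ω} (P : Measure Ω)
    (𝓕 : Filtration ℝ≥0 mΩ) (T : ℝ≥0∞) (L : ℝ≥0 → Ω → ℝ) : Prop where
  cadlag : ∀ ω, IsCadlagOn T (fun t => L t ω)
  adapted : ∀ t ∈ TimeSet T, Measurable[𝓕 t] (L t)
  zero : ∀ᵐ ω ∂P, L 0 ω = 0
  indep_increments : ∀ s t : ℝ≥0, s < t → t ∈ TimeSet T →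
    Indep (MeasurableSpace.comap (fun ω => L t ω - L s ω) inferInstance) (𝓕 s) P
  stationary_increments : ∀ s t r : ℝ≥0, t + s ∈ TimeSet T → r + s ∈ TimeSet T →
    P.map (fun ω => L (t + s) ω - L t ω) = P.map (fun ω => L (r + s) ω - L r ω)
  stochastically_continuous : ∀ t ∈ TimeSet T, ∀ ε : ℝ, 0 < ε →
    Tendsto (fun s => P {ω | ε < |L t ω - L s ω|}) (𝓝[TimeSet T] t) (𝓝 0)

/-- Poisson processes on `[0,T]` with intensity `r` with respect to a filtration. -/
structure IsPoissonProcess {Ω : Type u} {mΩ : MeasurableSpace Ω} (P : Measure Ω)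
    (𝓕 : Filtration ℝ≥0 mΩ) (T : ℝ≥0∞) (r : ℝ≥0) (N : ℝ≥0 → Ω → ℕ) : Prop where
  cadlag : ∀ ω, IsCadlagOn T (fun t => (N t ω : ℝ))
  adapted : ∀ t ∈ TimeSet T, Measurable[𝓕 t] (N t)
  zero : ∀ ω, N 0 ω = 0
  indep_increments : ∀ s t : ℝ≥0, s < t → t ∈ TimeSet T →
    Indep (MeasurableSpace.comap (fun ω => (N t ω : ℝ) - N s ω) inferInstance) (𝓕 s) P
  poisson_increments : ∀ s t : ℝ≥0, s < t → t ∈ TimeSet T →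
    P.map (fun ω => (N t ω : ℝ) - N s ω) =
      (poissonMeasure (r * (t - s))).map (Nat.cast : ℕ → ℝ)

/-- `X` is a compound Poisson process on `[0,T]` with intensity `r` and jump law `F`, with respect
to the filtration `𝓕`: it is a Lévy process for `𝓕`, and as a process on `[0,T]` it has the law of
`t ↦ ∑_{k=1}^{N_t} J_k`, with `N` a Poisson process of intensity `r` and `J` an i.i.d. sequence
with law `F` which is independent of `N`. The pair `(N, J)` may live on another probability space,
because on a finite horizon the space that carries `X` need not carry a whole sequence `J`. -/
structure IsCompoundPoissonProcess {Ω : Type u} {mΩ : MeasurableSpace Ω} (P : Measure Ω)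
    (𝓕 : Filtration ℝ≥0 mΩ) (T : ℝ≥0∞) (r : ℝ≥0) (F : Measure ℝ) (X : ℝ≥0 → Ω → ℝ) : Prop where
  isLevyProcess : IsLevyProcess P 𝓕 T X
  exists_representation : ∃ (Ω₁ : Type u) (mΩ₁ : MeasurableSpace Ω₁) (P₁ : Measure Ω₁)
    (𝓖 : Filtration ℝ≥0 mΩ₁) (N : ℝ≥0 → Ω₁ → ℕ) (J : ℕ → Ω₁ → ℝ),
    IsProbabilityMeasure P₁ ∧
    IsPoissonProcess P₁ 𝓖 T r N ∧
    (∀ k, Measurable (J k)) ∧ (∀ k, P₁.map (J k) = F) ∧ iIndepFun J P₁ ∧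
    IndepFun (fun ω (t : TimeSet T) => N t ω) (fun ω k => J k ω) P₁ ∧
    IdentDistrib (fun ω (t : TimeSet T) => X t ω)
      (fun ω (t : TimeSet T) => ∑ k ∈ Finset.range (N t ω), J k ω) P P₁

/-- The jump `ΔL_t(ω) = L_t(ω) - L_{t-}(ω)`; the convention `L_{0-} = L_0` is built into
`Function.leftLim`, so `ΔL_0 = 0`. -/
noncomputable def jump {Ω : Type u} (L : ℝ≥0 → Ω → ℝ) (t : ℝ≥0) (ω : Ω) : ℝ :=
  L t ω - Function.leftLim (fun s => L s ω) t

/-- The random measure of jumps `μ^L(ω; t, ·)`, a counting measure on `ℝ \ {0}`. It is regarded as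
a measure on `ℝ` which does not charge `0`. -/
noncomputable def jumpMeasure {Ω : Type u} (L : ℝ≥0 → Ω → ℝ) (t : ℝ≥0) (ω : Ω) : Measure ℝ :=
  (Measure.sum fun s : Set.Iic t => Measure.dirac (jump L s ω)).restrict {0}ᶜ

theorem jump_zero {Ω : Type u} (L : ℝ≥0 → Ω → ℝ) (ω : Ω) : jump L 0 ω = 0 := by
  have h : 𝓝[<] (0 : ℝ≥0) = ⊥ := by simp
  rw [jump, leftLim_eq_of_eq_bot _ h, sub_self]

/-- `μ^L(ω; t, B)` is the number of `s ≤ t` with `ΔL_s(ω) ∈ B`, for `B ⊆ ℝ \ {0}`. -/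
theorem jumpMeasure_apply {Ω : Type u} (L : ℝ≥0 → Ω → ℝ) (t : ℝ≥0) (ω : Ω) {B : Set ℝ}
    (hB : MeasurableSet B) (h0 : (0 : ℝ) ∉ B) :
    jumpMeasure L t ω B = ({s : ℝ≥0 | s ≤ t ∧ jump L s ω ∈ B}.encard : ℝ≥0∞) := by
  have h : B ∩ {0}ᶜ = B := by
    rw [Set.inter_eq_left]
    intro x hx hx0
    exact h0 (by simpa [Set.mem_singleton_iff.1 hx0] using hx)
  rw [jumpMeasure, Measure.restrict_apply hB, h, Measure.sum_apply _ hB]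
  simp only [Measure.dirac_apply' _ hB]
  have h2 : (fun s : Set.Iic t => B.indicator (1 : ℝ → ℝ≥0∞) (jump L s ω)) =
      Set.indicator ((fun s : Set.Iic t => jump L s ω) ⁻¹' B) (fun _ => (1 : ℝ≥0∞)) :=
    funext fun _ => (Set.indicator_comp_right (fun s : Set.Iic t => jump L s ω)
      (g := (1 : ℝ → ℝ≥0∞))).symm
  rw [h2, ← tsum_subtype, ENNReal.tsum_set_const, mul_one]
  congr 1
  rw [← (Subtype.val_injective (p := fun s => s ∈ Set.Iic t)).encard_image]
  congr 1
  ext s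
  simp [and_comm]

/-- The integral `∫_0^t ∫_A f(x) μ^L(ds,dx) = ∑_{s ≤ t} f(ΔL_s) 1_A(ΔL_s)`. For a càdlàg path and a
set `A` bounded away from zero, only finitely many summands are nonzero. -/
noncomputable def jumpIntegral {Ω : Type u} (L : ℝ≥0 → Ω → ℝ) (A : Set ℝ) (f : ℝ → ℝ)
    (t : ℝ≥0) (ω : Ω) : ℝ :=
  ∑ᶠ s ∈ Set.Iic t, A.indicator f (jump L s ω)

/-- The Lévy measure `ν(B) = E[μ^L(1, B)]`. If the horizon `T` is smaller than `1`, then `L_1` is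
not available, and `ν` is the expected number of jumps per unit of time in `[0,T]`. -/
noncomputable def levyMeasure {Ω : Type u} {mΩ : MeasurableSpace Ω} (P : Measure Ω) (T : ℝ≥0∞)
    (L : ℝ≥0 → Ω → ℝ) : Measure ℝ :=
  (min 1 T)⁻¹ • P.bind (jumpMeasure L (min 1 T).toNNReal)

theorem levyMeasure_of_one_le {Ω : Type u} {mΩ : MeasurableSpace Ω} (P : Measure Ω) {T : ℝ≥0∞}
    (hT : 1 ≤ T) (L : ℝ≥0 → Ω → ℝ) : levyMeasure P T L = P.bind (jumpMeasure L 1) := by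
  simp [levyMeasure, min_eq_left hT]

/-- For the measurable random measures that occur here, `ν(B) = E[μ^L(1, B)]`. -/
theorem levyMeasure_apply {Ω : Type u} {mΩ : MeasurableSpace Ω} (P : Measure Ω) {T : ℝ≥0∞}
    (hT : 1 ≤ T) (L : ℝ≥0 → Ω → ℝ) (hL : AEMeasurable (jumpMeasure L 1) P) {B : Set ℝ}
    (hB : MeasurableSet B) : levyMeasure P T L B = ∫⁻ ω, jumpMeasure L 1 ω B ∂P := by
  rw [levyMeasure_of_one_le P hT, Measure.bind_apply hB hL]

/-! Let `g` be continuous and vanish near `0`. A càdlàg path oscillates little away from finitely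
many times, so the sum of `g` over the jumps in `(s, s + h]` is the limit of the sums of `g` over
the increments along finer and finer grids (`tendsto_grid_sum`). Grid increments are stationary and
independent of each other and of `𝓕 s`. Hence, for `B` in `𝓕 s`, the integral over `B` of the
exponential of `i` times the grid sum is `P B` times `(1 + z n / n) ^ n`, where `z n` is the mean of
the grid sum of `exp (i g) - 1`. If `z n` converges to the mean `z` of the corresponding jump sum,
the limit is `P B * exp z`.

Convergence of these means requires uniform integrability. For a cutoff `k` the means `n *
E[k(increment)]` are bounded: `E[exp (-grid sum of k)]` is an `n`-th power whose limit is positive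
(`exists_mul_integral_le`). This bounds `E[exp (grid sum of k)]`, hence the second moments of all
grid sums that the cutoff dominates (`tendsto_integral_gridSum`).

The same limits show that the mean of a jump sum is additive in time. Being nonnegative for `g ≥ 0`,
it is then linear in time, so away from `0` the expected jump measure at time `t` is `t • ν`
(`restrict_bind_jumpMeasure`). This rewrites `z` as `h` times an integral against `ν`, and the
formula passes to measurable `g` by almost everywhere limits (`hasJumpCharFun`).

With `g = v f` on `A` and `0` elsewhere, the formula gives the characteristic function of `X` and
the independence and stationarity of its increments. With `f = 1` it shows that the number of jumps
in `A` is a Poisson process of intensity `ν(A)`. If `F` is the normalized image of `ν` on `A` under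
`f`, the exponent is `ν(A)` times the characteristic function of `F` minus `1`. The increments of
`X` therefore have the same joint characteristic functions as those of an i.i.d. sum with law `F`,
stopped at an independent copy of the jump count (`identDistrib_jumpIntegral`). The mean is read off
from `t • ν`, the variance from this random sum. -/

/-! ### Oscillation and jumps of càdlàg paths -/

/-- The sum of `g` over the jumps up to time `t` of the path `x`. -/
noncomputable def jumpSum {E : Type*} [AddCommMonoid E] (x : ℝ≥0 → ℝ) (g : ℝ → E) (t : ℝ≥0) : E :=
  ∑ᶠ r ∈ Set.Iic t, g (x r - Function.leftLim x r)

theorem timeSet_mono {T : ℝ≥0∞} {s t : ℝ≥0} (hst : s ≤ t) (ht : t ∈ TimeSet T) : s ∈ TimeSet T :=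
  show (s : ℝ≥0∞) ≤ T from le_trans (by exact_mod_cast hst) ht

/-- The left limit controls the path strictly before `r` and right-continuity controls it from `r`
on, so `r` is counted with the right side. At `r = t` no later time is admitted, so right-continuity
at the horizon is not needed. -/
theorem IsCadlagOn.exists_ball {T : ℝ≥0∞} {x : ℝ≥0 → ℝ} (hx : IsCadlagOn T x) {t : ℝ≥0}
    (ht : t ∈ TimeSet T) {ε : ℝ} (hε : 0 < ε) {r : ℝ≥0} (hr : r ≤ t) :
    ∃ δ > 0, ∀ a ∈ Metric.ball r δ, ∀ b ∈ Metric.ball r δ, a ≤ t → b ≤ t → (a < r ↔ b < r) →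
      |x b - x a| < ε := by
  obtain ⟨l, hl⟩ := hx.2 r (timeSet_mono hr ht)
  have h1 : ∀ᶠ a in 𝓝 r, a < r → |x a - l| < ε / 2 := by
    have := hl (Metric.ball_mem_nhds l (half_pos hε))
    have := eventually_nhdsWithin_iff.1 this
    filter_upwards [this] with a ha h
    simpa [Real.dist_eq] using ha h
  have h2 : ∀ᶠ a in 𝓝 r, r < a → a ≤ t → |x a - x r| < ε / 2 := by
    rcases hr.lt_or_eq with h | h
    · have hrT : (r : ℝ≥0∞) < T := lt_of_lt_of_le (by exact_mod_cast h) ht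
      have := hx.1 r hrT (Metric.ball_mem_nhds _ (half_pos hε))
      have := eventually_nhdsWithin_iff.1 this
      filter_upwards [this] with a ha h _
      simpa [Real.dist_eq] using ha h
    · exact Eventually.of_forall fun a ha ha' => absurd (ha.trans_le ha') (by simp [h])
  obtain ⟨δ, hδ, h⟩ := Metric.eventually_nhds_iff_ball.1 (h1.and h2)
  refine ⟨δ, hδ, fun a ha b hb hat hbt hab => ?_⟩
  by_cases har : a < r
  · have e1 := (h a ha).1 har
    have e2 := (h b hb).1 (hab.1 har)
    rw [abs_lt] at *
    constructor <;> linarith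
  · have key : ∀ c ∈ Metric.ball r δ, c ≤ t → ¬ c < r → |x c - x r| < ε / 2 := by
      intro c hc hct hcr
      rcases (not_lt.1 hcr).lt_or_eq with h' | h'
      · exact (h c hc).2 h' hct
      · subst h'; simpa using hε
    have e1 := key a ha hat har
    have e2 := key b hb hbt (fun h => har (hab.2 h))
    rw [abs_lt] at *
    constructor <;> linarith

/-- Compactness of `[0, t]`: `S` consists of the centres of finitely many balls from `exists_ball`,
and `δ` is a Lebesgue number of the cover. The condition on `S` says that `(a, b]` contains no point
of `S`, so `a` and `b` lie on the same side of the centre. -/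
theorem IsCadlagOn.exists_finset {T : ℝ≥0∞} {x : ℝ≥0 → ℝ} (hx : IsCadlagOn T x) {t : ℝ≥0}
    (ht : t ∈ TimeSet T) {ε : ℝ} (hε : 0 < ε) :
    ∃ S : Finset ℝ≥0, ∃ δ > 0, ∀ a b, a ≤ b → b ≤ t → dist b a < δ →
      (∀ r ∈ S, a < r → b < r) → |x b - x a| < ε := by
  choose! d hd h using fun r (hr : r ≤ t) => hx.exists_ball ht hε hr
  have hK : IsCompact (Set.Iic t) := by
    rw [← Set.Icc_bot]; exact isCompact_Icc
  obtain ⟨S, hS, hcov⟩ := hK.elim_nhds_subcover (fun r => Metric.ball r (d r))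
    (fun r hr => Metric.ball_mem_nhds r (hd r hr))
  obtain ⟨δ, hδ, hL⟩ := lebesgue_number_lemma_of_metric (c := fun r : S => Metric.ball r.1 (d r)) hK
    (fun _ => Metric.isOpen_ball) (by simpa [Set.iUnion_subtype] using hcov)
  refine ⟨S, δ, hδ, fun a b hab hbt hdist hab' => ?_⟩
  obtain ⟨⟨r, hrS⟩, hr⟩ := hL a (hab.trans hbt)
  exact h r (hS r hrS) a (hr (Metric.mem_ball_self hδ)) b (hr hdist) (hab.trans hbt) hbt
    ⟨hab' r hrS, fun h => hab.trans_lt h⟩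

theorem IsCadlagOn.tendsto_leftLim {T : ℝ≥0∞} {x : ℝ≥0 → ℝ} (hx : IsCadlagOn T x) {t : ℝ≥0}
    (ht : t ∈ TimeSet T) : Tendsto x (𝓝[<] t) (𝓝 (Function.leftLim x t)) :=
  tendsto_leftLim_of_tendsto (hx.2 t ht)

/-- Let `a` increase to `r` in the oscillation bound: since `r` is not in `S`, the interval `(a, r]`
eventually misses `S`. -/
theorem abs_jump_le_of_oscillation {T : ℝ≥0∞} {x : ℝ≥0 → ℝ} (hx : IsCadlagOn T x) {t : ℝ≥0}
    (ht : t ∈ TimeSet T) {ε : ℝ} (hε : 0 < ε) {S : Finset ℝ≥0} {δ : ℝ} (hδ : 0 < δ)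
    (h : ∀ a b, a ≤ b → b ≤ t → dist b a < δ → (∀ r ∈ S, a < r → b < r) → |x b - x a| < ε)
    {r : ℝ≥0} (hrt : r ≤ t) (hr : r ∉ S) : |x r - Function.leftLim x r| ≤ ε := by
  rcases eq_or_ne r 0 with rfl | hr0
  · have h : 𝓝[<] (0 : ℝ≥0) = ⊥ := by simp
    rw [leftLim_eq_of_eq_bot _ h]
    simpa using hε.le
  have : (𝓝[<] r).NeBot := nhdsLT_neBot_of_exists_lt ⟨0, pos_iff_ne_zero.2 hr0⟩
  have h1 := ((tendsto_const_nhds (x := x r)).sub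
    (hx.tendsto_leftLim (timeSet_mono hrt ht))).abs
  refine le_of_tendsto h1 ?_
  have h2 : ∀ᶠ a in 𝓝[<] r, dist r a < δ := by
    refine nhdsWithin_le_nhds ?_
    filter_upwards [Metric.ball_mem_nhds r hδ] with a ha
    rwa [dist_comm]
  have h3 : ∀ᶠ a in 𝓝[<] r, ∀ q ∈ S, a < q → r < q := by
    refine (Filter.eventually_all_finset S).2 fun q hq => ?_
    rcases lt_trichotomy r q with hq' | rfl | hq'
    · exact Eventually.of_forall fun _ _ => hq'
    · exact absurd hq hr
    · filter_upwards [nhdsWithin_le_nhds (Ioi_mem_nhds hq')] with a ha h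
      exact absurd h (not_lt.2 (le_of_lt ha))
  filter_upwards [h2, h3, self_mem_nhdsWithin] with a ha1 ha2 ha3
  exact (h a r (le_of_lt ha3) hrt ha1 ha2).le

theorem IsCadlagOn.finite_jumps {T : ℝ≥0∞} {x : ℝ≥0 → ℝ} (hx : IsCadlagOn T x) {t : ℝ≥0}
    (ht : t ∈ TimeSet T) {ε : ℝ} (hε : 0 < ε) :
    {r | r ≤ t ∧ ε < |x r - Function.leftLim x r|}.Finite := by
  obtain ⟨S, δ, hδ, h⟩ := hx.exists_finset ht hε
  refine S.finite_toSet.subset fun r hr => ?_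
  by_contra hrS
  exact absurd (abs_jump_le_of_oscillation hx ht hε hδ h hr.1 hrS) (not_le.2 hr.2)

/-- A `finsum` with infinite support is `0` by convention. A finite set that carries all the nonzero
terms rules this out and can be shared by several integrands. -/
theorem jumpSum_eq_sum {E : Type*} [AddCommMonoid E] {x : ℝ≥0 → ℝ} {g : ℝ → E} {t : ℝ≥0}
    (S : Finset ℝ≥0) (hS : ∀ r ≤ t, g (x r - Function.leftLim x r) ≠ 0 → r ∈ S) :
    jumpSum x g t = ∑ r ∈ S with r ≤ t, g (x r - Function.leftLim x r) := by
  rw [jumpSum]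
  refine finsum_mem_eq_sum_of_inter_support_eq _ ?_
  ext r
  simp only [Set.mem_inter_iff, Set.mem_Iic, Function.mem_support, Finset.coe_filter,
    Set.mem_ofPred_eq]
  exact ⟨fun h => ⟨⟨hS r h.1 h.2, h.1⟩, h.2⟩, fun h => ⟨h.1.2, h.2⟩⟩

/-! ### Grid sums converge to jump sums -/

/-- The point number `k` of the division of `[s, s + h]` into `n` equal pieces. -/
noncomputable def gridPoint (s h : ℝ≥0) (n k : ℕ) : ℝ≥0 := s + k * (h / n)

theorem gridPoint_mono (s h : ℝ≥0) (n : ℕ) : Monotone (gridPoint s h n) := by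
  intro j k hjk
  unfold gridPoint
  gcongr

theorem gridPoint_zero (s h : ℝ≥0) (n : ℕ) : gridPoint s h n 0 = s := by simp [gridPoint]

theorem gridPoint_self (s h : ℝ≥0) {n : ℕ} (hn : n ≠ 0) : gridPoint s h n n = s + h := by
  have : (n : ℝ≥0) ≠ 0 := by exact_mod_cast hn
  simp [gridPoint, mul_div_cancel₀ _ this]

theorem gridPoint_succ (s h : ℝ≥0) (n k : ℕ) :
    gridPoint s h n (k + 1) = gridPoint s h n k + h / n := by
  simp only [gridPoint]; push_cast; ring

theorem gridPoint_le (s h : ℝ≥0) {n k : ℕ} (hk : k ≤ n) : gridPoint s h n k ≤ s + h := by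
  rcases eq_or_ne n 0 with rfl | hn
  · simp [gridPoint]
  · rw [← gridPoint_self s h hn]; exact gridPoint_mono s h n hk

theorem exists_gridPoint (s h : ℝ≥0) {n : ℕ} (hn : n ≠ 0) {r : ℝ≥0} (hsr : s < r)
    (hr : r ≤ s + h) : ∃ k < n, gridPoint s h n k < r ∧ r ≤ gridPoint s h n (k + 1) := by
  classical
  have hex : ∃ k, r ≤ gridPoint s h n k := ⟨n, by rwa [gridPoint_self s h hn]⟩
  have h0 : Nat.find hex ≠ 0 := by
    intro h0
    have := Nat.find_spec hex
    rw [h0, gridPoint_zero] at this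
    exact absurd hsr (not_lt.2 this)
  obtain ⟨k, hk⟩ := Nat.exists_eq_succ_of_ne_zero h0
  refine ⟨k, ?_, ?_, ?_⟩
  · have : Nat.find hex ≤ n := Nat.find_min' hex (by rw [gridPoint_self s h hn]; exact hr)
    omega
  · exact not_le.1 (Nat.find_min hex (by omega))
  · have := Nat.find_spec hex
    rwa [hk] at this

theorem dist_gridPoint_succ (s h : ℝ≥0) (n k : ℕ) :
    dist (gridPoint s h n (k + 1)) (gridPoint s h n k) = h / n := by
  rw [gridPoint_succ, NNReal.dist_eq]
  push_cast
  rw [add_sub_cancel_left, abs_of_nonneg (by positivity)]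

/-- On a fine grid, a cell without a point of `S` has an increment below `ε` and contributes `0`,
while any other cell contains just one such point `r`. Its left endpoint tends to `r` from strictly
below and its right endpoint tends to `r` from at or above, so the increment tends to the jump at
`r`. -/
theorem tendsto_grid_sum {E : Type*} [AddCommGroup E] [TopologicalSpace E] [IsTopologicalAddGroup E]
    {T : ℝ≥0∞} {x : ℝ≥0 → ℝ} (hx : IsCadlagOn T x) {s h : ℝ≥0}
    (ht : s + h ∈ TimeSet T) {g : ℝ → E} (hg : Continuous g) {ε : ℝ} (hε : 0 < ε)
    (hg0 : ∀ y, |y| ≤ ε → g y = 0) :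
    Tendsto (fun n : ℕ => ∑ k ∈ Finset.range n,
      g (x (gridPoint s h n (k + 1)) - x (gridPoint s h n k))) atTop
      (𝓝 (jumpSum x g (s + h) - jumpSum x g s)) := by
  classical
  obtain ⟨S, δ, hδ, hS⟩ := hx.exists_finset ht hε
  have hsupp : ∀ r ≤ s + h, g (x r - Function.leftLim x r) ≠ 0 → r ∈ S := by
    intro r hr h0
    by_contra hrS
    exact h0 (hg0 _ (abs_jump_le_of_oscillation hx ht hε hδ hS hr hrS))
  rw [jumpSum_eq_sum S hsupp, jumpSum_eq_sum S fun r hr => hsupp r (hr.trans le_self_add)]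
  set S' := S.filter fun r => s < r ∧ r ≤ s + h with hS'
  have hsplit : (∑ r ∈ S with r ≤ s + h, g (x r - Function.leftLim x r)) -
      (∑ r ∈ S with r ≤ s, g (x r - Function.leftLim x r)) =
      ∑ r ∈ S', g (x r - Function.leftLim x r) := by
    rw [sub_eq_iff_eq_add, hS', ← Finset.sum_union]
    · congr 1
      ext r
      simp only [Finset.mem_filter, Finset.mem_union]
      have : r ≤ s → r ≤ s + h := fun h => h.trans le_self_add
      have := lt_or_ge s r
      tauto
    · refine Finset.disjoint_filter.2 fun r _ h1 h2 => absurd h1.1 (not_lt.2 h2)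
  rw [hsplit]
  have hmesh : Tendsto (fun n : ℕ => (h : ℝ) / n) atTop (𝓝 0) :=
    tendsto_const_div_atTop_nhds_zero_nat _
  -- `κ n r` is the index of the cell, open on the left and closed on the right, that contains `r`.
  choose! κ hκn hκ1 hκ2 using fun (n : ℕ) (hn : n ≠ 0) (r : ℝ≥0) (hr : s < r ∧ r ≤ s + h) =>
    exists_gridPoint s h hn hr.1 hr.2
  -- Distinct points of `S'` lie in distinct cells once the mesh is smaller than their distance.
  have hinj : ∀ᶠ n : ℕ in atTop, Set.InjOn (κ n) S' := by
    have : ∀ᶠ n : ℕ in atTop, ∀ r ∈ S', ∀ q ∈ S', r ≠ q → (h : ℝ) / n < dist r q := by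
      refine (Filter.eventually_all_finset S').2 fun r _ =>
        (Filter.eventually_all_finset S').2 fun q _ => ?_
      by_cases hrq : r = q
      · simp [hrq]
      · filter_upwards [hmesh.eventually (gt_mem_nhds (dist_pos.2 hrq))] with n hn _ using hn
    filter_upwards [this, eventually_ne_atTop 0] with n hn hn0 r hr q hq hrq
    by_contra hne
    have hr' := (Finset.mem_filter.1 hr).2
    have hq' := (Finset.mem_filter.1 hq).2
    have e := hn r hr q hq hne
    have a1 := hκ1 n hn0 r hr'
    have a2 := hκ2 n hn0 r hr'
    have b1 := hκ1 n hn0 q hq'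
    have b2 := hκ2 n hn0 q hq'
    rw [← hrq] at b1 b2
    rw [gridPoint_succ] at a2 b2
    have hc : ((h / n : ℝ≥0) : ℝ) = (h : ℝ) / n := by push_cast; rfl
    rw [NNReal.dist_eq, ← hc] at e
    rw [← NNReal.coe_lt_coe] at a1 b1
    rw [← NNReal.coe_le_coe, NNReal.coe_add] at a2 b2
    rcases le_total (r : ℝ) q with h' | h'
    · rw [abs_of_nonpos (by linarith)] at e; linarith
    · rw [abs_of_nonneg (by linarith)] at e; linarith
  have hsum : ∀ᶠ n : ℕ in atTop, ∑ r ∈ S', g (x (gridPoint s h n (κ n r + 1)) -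
      x (gridPoint s h n (κ n r))) = ∑ k ∈ Finset.range n,
      g (x (gridPoint s h n (k + 1)) - x (gridPoint s h n k)) := by
    filter_upwards [hinj, eventually_ne_atTop 0, hmesh.eventually (gt_mem_nhds hδ)]
      with n hn hn0 hnδ
    rw [← Finset.sum_image (f := fun k => g (x (gridPoint s h n (k + 1)) - x (gridPoint s h n k))) hn]
    refine Finset.sum_subset ?_ ?_
    · intro k hk
      obtain ⟨r, hr, rfl⟩ := Finset.mem_image.1 hk
      exact Finset.mem_range.2 (hκn n hn0 r (Finset.mem_filter.1 hr).2)
    · intro k hk hk'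
      refine hg0 _ (le_of_lt (hS _ _ (gridPoint_mono s h n k.le_succ)
        (gridPoint_le s h (Finset.mem_range.1 hk)) (by rwa [dist_gridPoint_succ]) ?_))
      intro r hr hkr
      by_contra hrk
      refine hk' (Finset.mem_image.2 ⟨r, ?_, ?_⟩)
      · refine Finset.mem_filter.2 ⟨hr, ?_, (not_lt.1 hrk).trans
          (gridPoint_le s h (Finset.mem_range.1 hk))⟩
        exact lt_of_le_of_lt (by simp [gridPoint]) hkr
      · have hr' : s < r ∧ r ≤ s + h := ⟨lt_of_le_of_lt (by simp [gridPoint]) hkr,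
          (not_lt.1 hrk).trans (gridPoint_le s h (Finset.mem_range.1 hk))⟩
        have c1 : κ n r < k + 1 :=
          (gridPoint_mono s h n).reflect_lt ((hκ1 n hn0 r hr').trans_le (not_lt.1 hrk))
        have c2 : k < κ n r + 1 :=
          (gridPoint_mono s h n).reflect_lt (hkr.trans_le (hκ2 n hn0 r hr'))
        omega
  refine Tendsto.congr' hsum (tendsto_finsetSum _ fun r hr => (hg.tendsto _).comp ?_)
  have hr' := (Finset.mem_filter.1 hr).2
  have hd : ∀ᶠ n : ℕ in atTop, dist (gridPoint s h n (κ n r)) r ≤ h / n ∧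
      dist (gridPoint s h n (κ n r + 1)) r ≤ h / n := by
    filter_upwards [eventually_ne_atTop 0] with n hn0
    have a1 := hκ1 n hn0 r hr'
    have a2 := hκ2 n hn0 r hr'
    have e := dist_gridPoint_succ s h n (κ n r)
    rw [NNReal.dist_eq] at e ⊢
    rw [NNReal.dist_eq]
    rw [← NNReal.coe_lt_coe] at a1
    rw [← NNReal.coe_le_coe] at a2
    rw [abs_of_nonneg (by linarith)] at e
    rw [abs_of_nonpos (by linarith), abs_of_nonneg (by linarith)]
    constructor <;> linarith
  have ha : Tendsto (fun n => gridPoint s h n (κ n r)) atTop (𝓝 r) :=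
    tendsto_iff_dist_tendsto_zero.2 (squeeze_zero' (Eventually.of_forall fun _ => dist_nonneg)
      (hd.mono fun _ h => h.1) hmesh)
  have hb : Tendsto (fun n => gridPoint s h n (κ n r + 1)) atTop (𝓝 r) :=
    tendsto_iff_dist_tendsto_zero.2 (squeeze_zero' (Eventually.of_forall fun _ => dist_nonneg)
      (hd.mono fun _ h => h.2) hmesh)
  have hrT := timeSet_mono hr'.2 ht
  refine Tendsto.sub ?_ ?_
  -- Right-continuity is available only before `T`. If `r = T`, the right endpoint of the cell is
  -- `r` itself, because no grid point exceeds `s + h ≤ T`.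
  · rcases eq_or_lt_of_le (show (r : ℝ≥0∞) ≤ T from hrT) with h' | h'
    · refine Tendsto.congr' ?_ tendsto_const_nhds
      filter_upwards [eventually_ne_atTop 0] with n hn0
      have e1 := hκ2 n hn0 r hr'
      have e2 : gridPoint s h n (κ n r + 1) ≤ r := by
        have : s + h ≤ r := by
          have : ((s + h : ℝ≥0) : ℝ≥0∞) ≤ r := by rw [h']; exact ht
          exact_mod_cast this
        exact (gridPoint_le s h (hκn n hn0 r hr')).trans this
      rw [le_antisymm e2 e1]
    · have hc : ContinuousWithinAt x (Set.Ici r) r :=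
        continuousWithinAt_Ioi_iff_Ici.1 (hx.1 r h')
      refine hc.tendsto.comp (tendsto_nhdsWithin_iff.2 ⟨hb, ?_⟩)
      filter_upwards [eventually_ne_atTop 0] with n hn0 using hκ2 n hn0 r hr'
  · refine (hx.tendsto_leftLim hrT).comp (tendsto_nhdsWithin_iff.2 ⟨ha, ?_⟩)
    filter_upwards [eventually_ne_atTop 0] with n hn0 using hκ1 n hn0 r hr'

/-! ### Factorization over independent increments -/

theorem setIntegral_mul_of_indep {Ω : Type*} {m mΩ : MeasurableSpace Ω} {𝕜 : Type*} [RCLike 𝕜]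
    {P : Measure Ω} [IsProbabilityMeasure P] (hm : m ≤ mΩ) {W : Ω → 𝕜} (hW : Measurable[m] W)
    {D : Ω → ℝ} (hDm : Measurable D) (hD : Indep (MeasurableSpace.comap D inferInstance) m P)
    {G : ℝ → 𝕜} (hG : Measurable G) {B : Set Ω} (hB : MeasurableSet[m] B) :
    ∫ ω in B, W ω * G (D ω) ∂P = (∫ ω in B, W ω ∂P) * ∫ ω, G (D ω) ∂P := by
  rw [← integral_indicator (hm B hB), ← integral_indicator (hm B hB)]
  have hWB : Measurable[m] (B.indicator W) := hW.indicator hB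
  have hind : IndepFun (B.indicator W) (fun ω => G (D ω)) P := by
    refine indep_of_indep_of_le_left (indep_of_indep_of_le_right hD.symm ?_) ?_
    · rintro _ ⟨C, hC, rfl⟩
      exact ⟨G ⁻¹' C, hG hC, rfl⟩
    · exact hWB.comap_le
  rw [← hind.integral_fun_mul_eq_mul_integral (hWB.mono hm le_rfl).aestronglyMeasurable
    (hG.comp hDm).aestronglyMeasurable]
  congr 1
  ext ω
  by_cases h : ω ∈ B <;> simp [h]

/-- The expectation of a product of functions of successive increments of a process with
independent increments factorizes. -/
theorem setIntegral_prod_increments {Ω : Type*} {mΩ : MeasurableSpace Ω} {𝕜 : Type*} [RCLike 𝕜]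
    {P : Measure Ω} [IsProbabilityMeasure P] {𝓕 : Filtration ℝ≥0 mΩ} {T : ℝ≥0∞} {Z : ℝ≥0 → Ω → ℝ}
    (hZ : ∀ t ∈ TimeSet T, Measurable[𝓕 t] (Z t))
    (hI : ∀ s t : ℝ≥0, s < t → t ∈ TimeSet T →
      Indep (MeasurableSpace.comap (fun ω => Z t ω - Z s ω) inferInstance) (𝓕 s) P)
    {t : ℕ → ℝ≥0} (ht : Monotone t) {n : ℕ} (hn : t n ∈ TimeSet T) {G : ℕ → ℝ → 𝕜}
    (hG : ∀ k, Measurable (G k)) {B : Set Ω} (hB : MeasurableSet[𝓕 (t 0)] B) :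
    ∫ ω in B, ∏ k ∈ Finset.range n, G k (Z (t (k + 1)) ω - Z (t k) ω) ∂P =
      (P.real B : 𝕜) * ∏ k ∈ Finset.range n, ∫ ω, G k (Z (t (k + 1)) ω - Z (t k) ω) ∂P := by
  induction n with
  | zero => simp [RCLike.real_smul_eq_coe_mul]
  | succ n ih =>
    have hn' : t n ∈ TimeSet T := timeSet_mono (ht n.le_succ) hn
    have hZm : ∀ k ≤ n + 1, Measurable (Z (t k)) := fun k hk =>
      (hZ _ (timeSet_mono (ht hk) hn)).mono (𝓕.le _) le_rfl
    simp only [Finset.prod_range_succ]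
    rw [setIntegral_mul_of_indep (m := 𝓕 (t n)) (𝓕.le _), ih hn', mul_assoc]
    · refine Finset.measurable_fun_prod _ fun k hk => ?_
      have hk' := Finset.mem_range.1 hk
      have e1 : Measurable[𝓕 (t n)] (Z (t (k + 1))) :=
        (hZ _ (timeSet_mono (ht hk') hn')).mono (𝓕.mono (ht hk')) le_rfl
      have e2 : Measurable[𝓕 (t n)] (Z (t k)) :=
        (hZ _ (timeSet_mono (ht hk'.le) hn')).mono (𝓕.mono (ht hk'.le)) le_rfl
      exact (hG k).comp (e1.sub e2)
    · exact (hZm _ le_rfl).sub (hZm _ n.le_succ)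
    -- Coinciding times give the increment `0`, which generates the trivial σ-algebra.
    · rcases (ht n.le_succ).eq_or_lt with h | h
      · rw [← h]
        simp only [sub_self]
        rw [MeasurableSpace.comap_const]
        exact indep_bot_left _
      · exact hI _ _ h hn
    · exact hG n
    · exact 𝓕.mono (ht (Nat.zero_le n)) _ hB

namespace IsLevyProcess

variable {Ω : Type*} {mΩ : MeasurableSpace Ω} {P : Measure Ω}
    {𝓕 : Filtration ℝ≥0 mΩ} {T : ℝ≥0∞} {L : ℝ≥0 → Ω → ℝ}

theorem measurable (hL : IsLevyProcess P 𝓕 T L) {t : ℝ≥0} (ht : t ∈ TimeSet T) :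
    Measurable (L t) := (hL.adapted t ht).mono (𝓕.le _) le_rfl

theorem integral_increment {𝕜 : Type*} [RCLike 𝕜] (hL : IsLevyProcess P 𝓕 T L) {s h : ℝ≥0}
    (ht : s + h ∈ TimeSet T) {G : ℝ → 𝕜} (hG : Measurable G) :
    ∫ ω, G (L (s + h) ω - L s ω) ∂P = ∫ ω, G (L h ω - L 0 ω) ∂P := by
  have hh : h ∈ TimeSet T := timeSet_mono le_add_self ht
  have e := hL.stationary_increments h s 0 ht (by simpa using hh)
  rw [zero_add] at e
  have m1 : Measurable fun ω => L (s + h) ω - L s ω :=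
    (hL.measurable ht).sub (hL.measurable (timeSet_mono le_self_add ht))
  have m2 : Measurable fun ω => L h ω - L 0 ω :=
    (hL.measurable hh).sub (hL.measurable (timeSet_mono bot_le ht))
  rw [← integral_map m1.aemeasurable hG.aestronglyMeasurable, e,
    integral_map m2.aemeasurable hG.aestronglyMeasurable]

theorem setIntegral_prod_grid {𝕜 : Type*} [RCLike 𝕜] [IsProbabilityMeasure P] (hL : IsLevyProcess P 𝓕 T L) {s h : ℝ≥0}
    (ht : s + h ∈ TimeSet T) {G : ℝ → 𝕜} (hG : Measurable G) {B : Set Ω}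
    (hB : MeasurableSet[𝓕 s] B) {n : ℕ} (hn : n ≠ 0) :
    ∫ ω in B, ∏ k ∈ Finset.range n,
      G (L (gridPoint s h n (k + 1)) ω - L (gridPoint s h n k) ω) ∂P =
      (P.real B : 𝕜) * (∫ ω, G (L (h / n) ω - L 0 ω) ∂P) ^ n := by
  rw [setIntegral_prod_increments (G := fun _ => G) hL.adapted hL.indep_increments
    (gridPoint_mono s h n) (by rwa [gridPoint_self s h hn]) (fun _ => hG)
    (by rwa [gridPoint_zero])]
  congr 1
  rw [Finset.prod_congr rfl (g := fun _ => ∫ ω, G (L (h / n) ω - L 0 ω) ∂P), Finset.prod_const,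
    Finset.card_range]
  intro k hk
  rw [gridPoint_succ]
  exact hL.integral_increment (timeSet_mono (by
    rw [← gridPoint_succ]; exact gridPoint_le s h (Finset.mem_range.1 hk)) ht) hG

end IsLevyProcess

/-! ### Uniform integrability and limits of expectations of grid sums -/

/-- A bound in `L²` gives uniform integrability, since by Cauchy–Schwarz the `L¹` norm on a set `s`
is at most a constant times `(P s) ^ (1 / 2)`. Vitali's theorem then applies. -/
theorem tendsto_integral_of_integral_sq_le {Ω : Type*} {mΩ : MeasurableSpace Ω} {𝕜 : Type*}
    [RCLike 𝕜] {P : Measure Ω} [IsFiniteMeasure P] {f : ℕ → Ω → 𝕜} {g : Ω → 𝕜}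
    (hf : ∀ n, AEStronglyMeasurable (f n) P) (hi : ∀ n, Integrable (fun ω => ‖f n ω‖ ^ 2) P) {C : ℝ}
    (hC : ∀ n, ∫ ω, ‖f n ω‖ ^ 2 ∂P ≤ C)
    (hfg : ∀ᵐ ω ∂P, Tendsto (fun n => f n ω) atTop (𝓝 (g ω))) :
    (∀ n, Integrable (f n) P) ∧ Integrable g P ∧
      Tendsto (fun n => ∫ ω, f n ω ∂P) atTop (𝓝 (∫ ω, g ω ∂P)) := by
  have hmem : ∀ n, MemLp (f n) 2 P := fun n => (memLp_two_iff_integrable_sq_norm (hf n)).2 (hi n)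
  have hC0 : 0 ≤ C := le_trans (integral_nonneg fun _ => by positivity) (hC 0)
  set K : ℝ := C ^ (2 : ℝ)⁻¹ with hK
  have hK0 : 0 ≤ K := Real.rpow_nonneg hC0 _
  have hle : ∀ n, eLpNorm (f n) 2 P ≤ ENNReal.ofReal K := by
    intro n
    rw [(hmem n).eLpNorm_eq_integral_rpow_norm (by simp) (by simp)]
    refine ENNReal.ofReal_le_ofReal ?_
    simp only [ENNReal.toReal_ofNat, Real.rpow_ofNat]
    exact Real.rpow_le_rpow (integral_nonneg fun _ => by positivity) (hC n) (by norm_num)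
  have hset : ∀ n s, MeasurableSet s →
      eLpNorm (s.indicator (f n)) 1 P ≤ ENNReal.ofReal K * (P s) ^ (1 / 2 : ℝ) := by
    intro n s hs
    rw [eLpNorm_indicator_eq_eLpNorm_restrict hs]
    refine (eLpNorm_le_eLpNorm_mul_rpow_measure_univ (q := 2) (by norm_num) (hf n).restrict).trans ?_
    rw [Measure.restrict_apply_univ]
    refine mul_le_mul' ((eLpNorm_mono_measure _ Measure.restrict_le_self).trans (hle n)) ?_
    norm_num
  have hUI : UniformIntegrable f 1 P := by
    refine ⟨hf, ?_, (ENNReal.ofReal K * (P Set.univ) ^ (1 / 2 : ℝ)).toNNReal, fun n => ?_⟩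
    · intro ε hε
      -- The square undoes the exponent `1 / 2`; `K + 1` replaces `K`, which may be `0`.
      refine ⟨(ε / (K + 1)) ^ 2, by positivity, fun n s hs hsm => (hset n s hs).trans ?_⟩
      calc ENNReal.ofReal K * (P s) ^ (1 / 2 : ℝ)
          ≤ ENNReal.ofReal K * (ENNReal.ofReal ((ε / (K + 1)) ^ 2)) ^ (1 / 2 : ℝ) := by gcongr
        _ = ENNReal.ofReal (K * (ε / (K + 1))) := by
            rw [ENNReal.ofReal_rpow_of_nonneg (by positivity) (by norm_num), ← Real.sqrt_eq_rpow,
              Real.sqrt_sq (by positivity), ENNReal.ofReal_mul hK0]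
        _ ≤ ENNReal.ofReal ε := by
            refine ENNReal.ofReal_le_ofReal ?_
            rw [mul_div_assoc', div_le_iff₀ (by positivity)]
            nlinarith
    · rw [ENNReal.coe_toNNReal]
      · simpa using hset n Set.univ MeasurableSet.univ
      · exact ENNReal.mul_ne_top ENNReal.ofReal_ne_top
          (ENNReal.rpow_ne_top_of_nonneg (by norm_num) (measure_ne_top _ _))
  have hg := hUI.integrable_of_ae_tendsto hfg
  have hfi : ∀ n, Integrable (f n) P := fun n => (hmem n).integrable (by norm_num)
  exact ⟨hfi, hg, tendsto_integral_of_L1' g hg.1 (Eventually.of_forall hfi)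
    (tendsto_Lp_finite_of_tendsto_ae le_rfl (by simp) hf (memLp_one_iff_integrable.2 hg) hUI.2.1 hfg)⟩

/-- A continuous function which vanishes on `[-ε/2, ε/2]` and is `1` outside `(-ε, ε)`. -/
noncomputable def cutoff (ε y : ℝ) : ℝ := min 1 (max 0 (2 * |y| / ε - 1))

theorem continuous_cutoff (ε : ℝ) : Continuous (cutoff ε) := by unfold cutoff; fun_prop

theorem cutoff_nonneg (ε y : ℝ) : 0 ≤ cutoff ε y := by simp [cutoff]

theorem cutoff_le_one (ε y : ℝ) : cutoff ε y ≤ 1 := min_le_left _ _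

theorem cutoff_eq_zero {ε y : ℝ} (hε : 0 < ε) (hy : |y| ≤ ε / 2) : cutoff ε y = 0 := by
  have : 2 * |y| / ε - 1 ≤ 0 := by rw [sub_nonpos, div_le_one hε]; linarith
  simp [cutoff, max_eq_left this]

theorem cutoff_eq_one {ε y : ℝ} (hε : 0 < ε) (hy : ε ≤ |y|) : cutoff ε y = 1 := by
  have : 1 ≤ 2 * |y| / ε - 1 := by rw [le_sub_iff_add_le, le_div_iff₀ hε]; linarith
  simp [cutoff, this]

namespace IsLevyProcess

variable {Ω : Type*} {mΩ : MeasurableSpace Ω} {P : Measure Ω}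
    {𝓕 : Filtration ℝ≥0 mΩ} {T : ℝ≥0∞} {L : ℝ≥0 → Ω → ℝ}

/-- The sum of `G` over the increments of `L` along the division of `[s, s + h]` into `n` equal
pieces. -/
noncomputable def _root_.gridSum {E : Type*} [AddCommMonoid E] (L : ℝ≥0 → Ω → ℝ) (G : ℝ → E)
    (s h : ℝ≥0) (n : ℕ) (ω : Ω) : E :=
  ∑ k ∈ Finset.range n, G (L (gridPoint s h n (k + 1)) ω - L (gridPoint s h n k) ω)

theorem tendsto_gridSum {E : Type*} [AddCommGroup E] [TopologicalSpace E] [IsTopologicalAddGroup E]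
    (hL : IsLevyProcess P 𝓕 T L) {s h : ℝ≥0} (ht : s + h ∈ TimeSet T) {g : ℝ → E}
    (hg : Continuous g) {ε : ℝ} (hε : 0 < ε) (hg0 : ∀ y, |y| ≤ ε → g y = 0) (ω : Ω) :
    Tendsto (fun n => gridSum L g s h n ω) atTop
      (𝓝 (jumpSum (fun t => L t ω) g (s + h) - jumpSum (fun t => L t ω) g s)) :=
  tendsto_grid_sum (hL.cadlag ω) ht hg hε hg0

theorem adapted_gridPoint (hL : IsLevyProcess P 𝓕 T L) {s h : ℝ≥0} (ht : s + h ∈ TimeSet T)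
    {n k : ℕ} (hk : k ≤ n) : Measurable[𝓕 (s + h)] (L (gridPoint s h n k)) :=
  (hL.adapted _ (timeSet_mono (gridPoint_le s h hk) ht)).mono (𝓕.mono (gridPoint_le s h hk)) le_rfl

theorem measurable_gridSum {E : Type*} [AddCommMonoid E] [MeasurableSpace E] [MeasurableAdd₂ E]
    (hL : IsLevyProcess P 𝓕 T L) {s h : ℝ≥0} (ht : s + h ∈ TimeSet T) {g : ℝ → E}
    (hg : Measurable g) (n : ℕ) : Measurable[𝓕 (s + h)] (gridSum L g s h n) := by
  refine Finset.measurable_fun_sum _ fun k hk => hg.comp ?_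
  have hk := Finset.mem_range.1 hk
  exact (hL.adapted_gridPoint ht hk).sub (hL.adapted_gridPoint ht hk.le)

theorem measurable_small_increment (hL : IsLevyProcess P 𝓕 T L) {h : ℝ≥0} (ht : h ∈ TimeSet T)
    (n : ℕ) : Measurable fun ω => L (h / n) ω - L 0 ω := by
  have h1 : h / n ≤ h := by
    rcases eq_or_ne n 0 with rfl | hn
    · simp
    · exact div_le_self bot_le (by exact_mod_cast Nat.one_le_iff_ne_zero.2 hn)
  exact (hL.measurable (timeSet_mono h1 ht)).sub (hL.measurable (timeSet_mono bot_le ht))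

variable [IsProbabilityMeasure P]

theorem integral_exp_gridSum (hL : IsLevyProcess P 𝓕 T L) {s h : ℝ≥0} (ht : s + h ∈ TimeSet T)
    {k : ℝ → ℝ} (hk : Measurable k) {n : ℕ} (hn : n ≠ 0) :
    ∫ ω, Real.exp (gridSum L k s h n ω) ∂P =
      (∫ ω, Real.exp (k (L (h / n) ω - L 0 ω)) ∂P) ^ n := by
  have := hL.setIntegral_prod_grid (𝕜 := ℝ) ht (G := fun y => Real.exp (k y))
    (Real.measurable_exp.comp hk) MeasurableSet.univ hn
  simpa [gridSum, Real.exp_sum] using this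

theorem integral_gridSum {𝕜 : Type*} [RCLike 𝕜] (hL : IsLevyProcess P 𝓕 T L) {s h : ℝ≥0}
    (ht : s + h ∈ TimeSet T) {G : ℝ → 𝕜} (hG : Measurable G) {C : ℝ} (hC : ∀ y, ‖G y‖ ≤ C) (n : ℕ) :
    ∫ ω, gridSum L G s h n ω ∂P = n * ∫ ω, G (L (h / n) ω - L 0 ω) ∂P := by
  simp only [gridSum]
  rw [integral_finsetSum]
  · rw [Finset.sum_congr rfl (g := fun _ => ∫ ω, G (L (h / n) ω - L 0 ω) ∂P)]
    · simp
    intro k hk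
    rw [gridPoint_succ]
    exact hL.integral_increment (timeSet_mono (by
      rw [← gridPoint_succ]; exact gridPoint_le s h (Finset.mem_range.1 hk)) ht) hG
  · intro k hk
    have hk := Finset.mem_range.1 hk
    refine Integrable.of_bound (C := C) ?_ (Eventually.of_forall fun ω => hC _)
    exact (hG.comp (((hL.adapted_gridPoint ht hk).sub (hL.adapted_gridPoint ht hk.le)).mono
      (𝓕.le _) le_rfl)).aestronglyMeasurable

/-- By independence `E[exp (-grid sum of k)]` is the `n`-th power of `E[exp (-k(increment))]`, which
is at most `exp (-E[k(increment)] / 2)`. The grid sums converge pathwise to a finite jump sum, so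
these powers have a positive limit and `n * E[k(increment)]` cannot be unbounded. -/
theorem exists_mul_integral_le (hL : IsLevyProcess P 𝓕 T L) {h : ℝ≥0} (ht : h ∈ TimeSet T)
    {k : ℝ → ℝ} (hk : Continuous k) (hk0 : ∀ y, 0 ≤ k y) (hk1 : ∀ y, k y ≤ 1) {ε : ℝ} (hε : 0 < ε)
    (hkε : ∀ y, |y| ≤ ε → k y = 0) :
    ∃ C, ∀ n : ℕ, n * ∫ ω, k (L (h / n) ω - L 0 ω) ∂P ≤ C := by
  have ht' : 0 + h ∈ TimeSet T := by rwa [zero_add]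
  set D : Ω → ℝ := fun ω => jumpSum (fun t => L t ω) (fun y => -k y) (0 + h) -
    jumpSum (fun t => L t ω) (fun y => -k y) 0 with hD
  have hlim : ∀ ω, Tendsto (fun n => Real.exp (gridSum L (fun y => -k y) 0 h n ω)) atTop
      (𝓝 (Real.exp (D ω))) := fun ω =>
    (Real.continuous_exp.tendsto _).comp
      (hL.tendsto_gridSum ht' hk.neg hε (fun y hy => by simp [hkε y hy]) ω)
  have hmeas : ∀ n, Measurable fun ω => Real.exp (gridSum L (fun y => -k y) 0 h n ω) := fun n =>
    Real.measurable_exp.comp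
      ((hL.measurable_gridSum ht' hk.measurable.neg n).mono (𝓕.le _) le_rfl)
  have hbound : ∀ n ω, ‖Real.exp (gridSum L (fun y => -k y) 0 h n ω)‖ ≤ 1 := by
    intro n ω
    rw [Real.norm_eq_abs, abs_of_pos (Real.exp_pos _), Real.exp_le_one_iff]
    exact Finset.sum_nonpos fun _ _ => neg_nonpos.2 (hk0 _)
  have hconv : Tendsto (fun n => ∫ ω, Real.exp (gridSum L (fun y => -k y) 0 h n ω) ∂P) atTop
      (𝓝 (∫ ω, Real.exp (D ω) ∂P)) :=
    tendsto_integral_of_dominated_convergence (fun _ => 1)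
      (fun n => (hmeas n).aestronglyMeasurable) (integrable_const _)
      (fun n => Eventually.of_forall (hbound n)) (Eventually.of_forall hlim)
  have hDi : Integrable (fun ω => Real.exp (D ω)) P := by
    refine Integrable.of_bound (C := 1)
      (aestronglyMeasurable_of_tendsto_ae atTop (fun n => (hmeas n).aestronglyMeasurable)
        (Eventually.of_forall hlim)) (Eventually.of_forall fun ω => ?_)
    exact le_of_tendsto (hlim ω).norm (Eventually.of_forall fun n => hbound n ω)
  -- Positivity of the limit is what keeps the logarithms of the sequence bounded below.
  have hpos : 0 < ∫ ω, Real.exp (D ω) ∂P := integral_exp_pos hDi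
  have hlog := (Real.continuousAt_log hpos.ne').tendsto.comp hconv
  obtain ⟨C, hC⟩ := hlog.bddBelow_range
  refine ⟨max 0 (2 * -C), fun n => ?_⟩
  rcases eq_or_ne n 0 with rfl | hn
  · simp
  refine le_max_of_le_right ?_
  have hCn : C ≤ Real.log (∫ ω, Real.exp (gridSum L (fun y => -k y) 0 h n ω) ∂P) := hC ⟨n, rfl⟩
  rw [hL.integral_exp_gridSum (k := fun y => -k y) ht' hk.measurable.neg hn, Real.log_pow] at hCn
  have hm := hL.measurable_small_increment ht n
  have hki : Integrable (fun ω => k (L (h / n) ω - L 0 ω)) P :=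
    Integrable.of_bound (C := 1) (hk.measurable.comp hm).aestronglyMeasurable
      (Eventually.of_forall fun ω => by
        rw [Real.norm_eq_abs, abs_of_nonneg (hk0 _)]; exact hk1 _)
  have hei : Integrable (fun ω => Real.exp (-k (L (h / n) ω - L 0 ω))) P :=
    Integrable.of_bound (C := 1)
      (Real.measurable_exp.comp (hk.measurable.neg.comp hm)).aestronglyMeasurable
      (Eventually.of_forall fun ω => by
        rw [Real.norm_eq_abs, abs_of_pos (Real.exp_pos _), Real.exp_le_one_iff]
        exact neg_nonpos.2 (hk0 _))
  -- On `[0, 1]` one has `exp (-k) ≤ 1 / (1 + k) ≤ 1 - k / 2`.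
  have hle : ∫ ω, Real.exp (-k (L (h / n) ω - L 0 ω)) ∂P ≤
      1 - (∫ ω, k (L (h / n) ω - L 0 ω) ∂P) / 2 := by
    have : ∫ ω, (1 - k (L (h / n) ω - L 0 ω) / 2) ∂P =
        1 - (∫ ω, k (L (h / n) ω - L 0 ω) ∂P) / 2 := by
      rw [integral_sub (integrable_const _) (hki.div_const _), integral_div]; simp
    rw [← this]
    refine integral_mono hei ((integrable_const _).sub (hki.div_const _)) fun ω => ?_
    have a0 := hk0 (L (h / n) ω - L 0 ω)
    have a1 := hk1 (L (h / n) ω - L 0 ω)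
    have := Real.abs_exp_sub_one_sub_id_le (x := -k (L (h / n) ω - L 0 ω))
      (by rw [abs_neg, abs_of_nonneg a0]; exact a1)
    have h2 := Real.add_one_le_exp (k (L (h / n) ω - L 0 ω))
    show Real.exp (-k (L (h / n) ω - L 0 ω)) ≤ 1 - k (L (h / n) ω - L 0 ω) / 2
    rw [Real.exp_neg, inv_le_comm₀ (Real.exp_pos _) (by linarith)]
    refine le_trans ?_ h2
    rw [inv_le_comm₀ (by linarith) (by linarith), inv_le_iff_one_le_mul₀ (by linarith)]
    nlinarith
  have hlt : Real.log (∫ ω, Real.exp (-k (L (h / n) ω - L 0 ω)) ∂P) ≤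
      -((∫ ω, k (L (h / n) ω - L 0 ω) ∂P) / 2) := by
    have := Real.log_le_sub_one_of_pos (integral_exp_pos hei)
    linarith
  have := mul_le_mul_of_nonneg_left hlt (Nat.cast_nonneg (α := ℝ) n)
  linarith

/-- Pathwise convergence is `tendsto_gridSum`; what is missing is an `L²` bound. Grid sums of `G`
are at most `C` times those of the cutoff, whose exponential moments are bounded. By stationarity
the approximating means do not involve `s`, hence neither does the limit. -/
theorem tendsto_integral_gridSum {𝕜 : Type*} [RCLike 𝕜] (hL : IsLevyProcess P 𝓕 T L) {s h : ℝ≥0}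
    (ht : s + h ∈ TimeSet T) {G : ℝ → 𝕜} (hG : Continuous G) {C : ℝ} (hC : ∀ y, ‖G y‖ ≤ C)
    {ε : ℝ} (hε : 0 < ε) (hGε : ∀ y, |y| ≤ ε → G y = 0) :
    Integrable (fun ω => jumpSum (fun t => L t ω) G (s + h) - jumpSum (fun t => L t ω) G s) P ∧
    Tendsto (fun n : ℕ => n * ∫ ω, G (L (h / n) ω - L 0 ω) ∂P) atTop
      (𝓝 (∫ ω, (jumpSum (fun t => L t ω) G (s + h) - jumpSum (fun t => L t ω) G s) ∂P)) := by
  have hh : h ∈ TimeSet T := timeSet_mono le_add_self ht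
  have hc := continuous_cutoff ε
  obtain ⟨K, hK⟩ := hL.exists_mul_integral_le hh hc (cutoff_nonneg ε) (cutoff_le_one ε)
    (half_pos hε) (fun y hy => cutoff_eq_zero hε hy)
  have hC0 : 0 ≤ C := (norm_nonneg _).trans (hC 0)
  have hle : ∀ n ω, ‖gridSum L G s h n ω‖ ≤ C * gridSum L (cutoff ε) s h n ω := by
    intro n ω
    simp only [gridSum, Finset.mul_sum]
    refine (norm_sum_le _ _).trans (Finset.sum_le_sum fun k _ => ?_)
    rcases le_total |L (gridPoint s h n (k + 1)) ω - L (gridPoint s h n k) ω| ε with h' | h'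
    · rw [hGε _ h', norm_zero]
      exact mul_nonneg hC0 (cutoff_nonneg _ _)
    · rw [cutoff_eq_one hε h', mul_one]
      exact hC _
  have hGm : ∀ n, Measurable (gridSum L G s h n) := fun n =>
    (hL.measurable_gridSum ht hG.measurable n).mono (𝓕.le _) le_rfl
  have hcm : ∀ n, Measurable (gridSum L (cutoff ε) s h n) := fun n =>
    (hL.measurable_gridSum ht hc.measurable n).mono (𝓕.le _) le_rfl
  have hc0 : ∀ n ω, 0 ≤ gridSum L (cutoff ε) s h n ω := fun n ω =>
    Finset.sum_nonneg fun _ _ => cutoff_nonneg _ _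
  -- For `S ≥ 0`, the bound `1 + S + S ^ 2 / 2 ≤ exp S` gives `S ^ 2 ≤ 2 * exp S`.
  have hsq : ∀ n ω, ‖gridSum L G s h n ω‖ ^ 2 ≤
      C ^ 2 * (2 * Real.exp (gridSum L (cutoff ε) s h n ω)) := by
    intro n ω
    have h1 := pow_le_pow_left₀ (norm_nonneg _) (hle n ω) 2
    rw [mul_pow] at h1
    refine h1.trans (mul_le_mul_of_nonneg_left ?_ (sq_nonneg _))
    have := Real.quadratic_le_exp_of_nonneg (hc0 n ω)
    nlinarith [hc0 n ω]
  have hexp : ∀ n, Integrable (fun ω => Real.exp (gridSum L (cutoff ε) s h n ω)) P := by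
    intro n
    refine Integrable.of_bound (C := Real.exp n)
      (Real.measurable_exp.comp (hcm n)).aestronglyMeasurable (Eventually.of_forall fun ω => ?_)
    rw [Real.norm_eq_abs, abs_of_pos (Real.exp_pos _), Real.exp_le_exp]
    refine (Finset.sum_le_sum fun _ _ => cutoff_le_one _ _).trans ?_
    simp
  have hexp_le : ∀ n, ∫ ω, Real.exp (gridSum L (cutoff ε) s h n ω) ∂P ≤
      Real.exp (max 0 (2 * K)) := by
    intro n
    rcases eq_or_ne n 0 with rfl | hn
    · simp [gridSum]
    rw [hL.integral_exp_gridSum ht hc.measurable hn]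
    have hm := hL.measurable_small_increment hh n
    have hki : Integrable (fun ω => cutoff ε (L (h / n) ω - L 0 ω)) P :=
      Integrable.of_bound (C := 1) (hc.measurable.comp hm).aestronglyMeasurable
        (Eventually.of_forall fun ω => by
          rw [Real.norm_eq_abs, abs_of_nonneg (cutoff_nonneg _ _)]; exact cutoff_le_one _ _)
    have hei : Integrable (fun ω => Real.exp (cutoff ε (L (h / n) ω - L 0 ω))) P :=
      Integrable.of_bound (C := Real.exp 1)
        (Real.measurable_exp.comp (hc.measurable.comp hm)).aestronglyMeasurable
        (Eventually.of_forall fun ω => by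
          rw [Real.norm_eq_abs, abs_of_pos (Real.exp_pos _), Real.exp_le_exp]
          exact cutoff_le_one _ _)
    -- On `[0, 1]`, `exp k ≤ 1 + k + k ^ 2 ≤ 1 + 2 * k`. Taking `n`-th powers then gives at most
    -- `exp (2 * n * E[k])`, bounded by `exists_mul_integral_le`.
    have h1 : ∫ ω, Real.exp (cutoff ε (L (h / n) ω - L 0 ω)) ∂P ≤
        1 + 2 * ∫ ω, cutoff ε (L (h / n) ω - L 0 ω) ∂P := by
      have : ∫ ω, (1 + 2 * cutoff ε (L (h / n) ω - L 0 ω)) ∂P =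
          1 + 2 * ∫ ω, cutoff ε (L (h / n) ω - L 0 ω) ∂P := by
        rw [integral_add (integrable_const _) (hki.const_mul _), integral_const_mul]; simp
      rw [← this]
      refine integral_mono hei ((integrable_const _).add (hki.const_mul _)) fun ω => ?_
      have a0 := cutoff_nonneg ε (L (h / n) ω - L 0 ω)
      have a1 := cutoff_le_one ε (L (h / n) ω - L 0 ω)
      have := Real.abs_exp_sub_one_sub_id_le (x := cutoff ε (L (h / n) ω - L 0 ω))
        (by rw [abs_of_nonneg a0]; exact a1)
      have := (abs_le.1 this).2
      show Real.exp _ ≤ 1 + 2 * _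
      nlinarith
    calc (∫ ω, Real.exp (cutoff ε (L (h / n) ω - L 0 ω)) ∂P) ^ n
        ≤ (Real.exp (2 * ∫ ω, cutoff ε (L (h / n) ω - L 0 ω) ∂P)) ^ n := by
          refine pow_le_pow_left₀ (integral_exp_pos hei).le (h1.trans ?_) n
          rw [add_comm]; exact Real.add_one_le_exp _
      _ = Real.exp (2 * (n * ∫ ω, cutoff ε (L (h / n) ω - L 0 ω) ∂P)) := by
          rw [← Real.exp_nat_mul]; ring_nf
      _ ≤ _ := by
          refine Real.exp_le_exp.2 (le_max_of_le_right ?_)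
          linarith [hK n]
  have hi : ∀ n, Integrable (fun ω => ‖gridSum L G s h n ω‖ ^ 2) P := fun n =>
    (((hexp n).const_mul 2).const_mul (C ^ 2)).mono' ((hGm n).norm.pow_const 2).aestronglyMeasurable
      (Eventually.of_forall fun ω => by
        rw [Real.norm_eq_abs, abs_of_nonneg (sq_nonneg _)]; exact hsq n ω)
  have hmain := tendsto_integral_of_integral_sq_le (f := fun n => gridSum L G s h n) (P := P)
    (fun n => (hGm n).aestronglyMeasurable) hi (C := C ^ 2 * (2 * Real.exp (max 0 (2 * K))))
    (fun n => by
      refine (integral_mono (hi n) (((hexp n).const_mul 2).const_mul (C ^ 2)) (hsq n)).trans ?_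
      rw [integral_const_mul, integral_const_mul]
      exact mul_le_mul_of_nonneg_left (mul_le_mul_of_nonneg_left (hexp_le n) zero_le_two)
        (sq_nonneg _))
    (Eventually.of_forall (hL.tendsto_gridSum ht hG hε hGε))
  refine ⟨hmain.2.1, hmain.2.2.congr fun n => ?_⟩
  exact hL.integral_gridSum ht hG.measurable hC n

/-- The characteristic function of the sum of `g` over the jumps in `(s, s + h]`, conditional on
the past up to time `s`. -/
theorem setIntegral_exp_jumpSum_of_continuous (hL : IsLevyProcess P 𝓕 T L) {s h : ℝ≥0}
    (ht : s + h ∈ TimeSet T) {g : ℝ → ℝ} (hg : Continuous g)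
    {ε : ℝ} (hε : 0 < ε) (hgε : ∀ y, |y| ≤ ε → g y = 0) {B : Set Ω} (hB : MeasurableSet[𝓕 s] B) :
    ∫ ω in B, Complex.exp (Complex.I * ((jumpSum (fun t => L t ω) g (s + h) -
      jumpSum (fun t => L t ω) g s : ℝ) : ℂ)) ∂P =
      P.real B * Complex.exp (∫ ω, jumpSum (fun t => L t ω)
        (fun y => Complex.exp (Complex.I * g y) - 1) h ∂P) := by
  have hh : 0 + h ∈ TimeSet T := by rw [zero_add]; exact timeSet_mono le_add_self ht
  have hG : Continuous fun y => Complex.exp (Complex.I * g y) - 1 := by fun_prop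
  have hnorm : ∀ x : ℝ, ‖Complex.exp (Complex.I * x)‖ = 1 := fun x => by
    rw [mul_comm]; exact Complex.norm_exp_ofReal_mul_I x
  have h1 := (hL.tendsto_integral_gridSum (𝕜 := ℂ) hh hG (C := 2) (fun y => by
    refine (norm_sub_le _ _).trans ?_
    rw [hnorm, norm_one]; norm_num) hε (fun y hy => by simp [hgε y hy])).2
  have hz : ∀ ω, jumpSum (fun t => L t ω) (fun y => Complex.exp (Complex.I * g y) - 1) 0 = 0 := by
    intro ω
    have h0 : jump L 0 ω = 0 := jump_zero L ω
    rw [jumpSum, show Set.Iic (0 : ℝ≥0) = {0} by ext; simp, finsum_mem_singleton]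
    change Complex.exp (Complex.I * g (jump L 0 ω)) - 1 = 0
    rw [h0, hgε 0 (by simpa using hε.le)]
    simp
  simp only [hz, sub_zero, zero_add] at h1
  -- With `z n` the `n`-fold mean of `exp (i g) - 1`, each factor of the product over the grid is `1
  -- + z n / n`.
  have h2 := Complex.tendsto_one_add_pow_exp_of_tendsto h1
  have hL1 : Tendsto (fun n => ∫ ω in B, Complex.exp (Complex.I * (gridSum L g s h n ω : ℝ)) ∂P) atTop
      (𝓝 (∫ ω in B, Complex.exp (Complex.I * ((jumpSum (fun t => L t ω) g (s + h) -
      jumpSum (fun t => L t ω) g s : ℝ) : ℂ)) ∂P)) := by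
    refine tendsto_integral_of_dominated_convergence (fun _ => 1) (fun n => ?_)
      (integrable_const _) (fun n => Eventually.of_forall fun ω => (hnorm _).le)
      (Eventually.of_forall fun ω => ?_)
    · have := (hL.measurable_gridSum ht hg.measurable n).mono (𝓕.le _) le_rfl
      exact (Measurable.aestronglyMeasurable (by fun_prop))
    · have hc : Continuous fun x : ℝ => Complex.exp (Complex.I * x) := by fun_prop
      exact (hc.tendsto _).comp (hL.tendsto_gridSum ht hg hε hgε ω)
  refine tendsto_nhds_unique hL1 (Tendsto.congr' ?_ (h2.const_mul (P.real B : ℂ)))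
  filter_upwards [eventually_ne_atTop 0] with n hn
  have hm := hL.measurable_small_increment (timeSet_mono le_add_self ht) n
  have := hL.setIntegral_prod_grid (𝕜 := ℂ) ht (G := fun y => Complex.exp (Complex.I * g y))
    (by fun_prop) hB hn
  simp only [gridSum, Complex.ofReal_sum, Finset.mul_sum, Complex.exp_sum]
  rw [this, integral_sub]
  · simp
  · refine Integrable.of_bound (C := 1) ?_ (Eventually.of_forall fun ω => (hnorm _).le)
    exact (Measurable.aestronglyMeasurable (by have := hg.measurable; fun_prop))
  · exact integrable_const _

end IsLevyProcess

/-! ### The jump measure away from zero and its measurability -/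

theorem jumpSum_zero {E : Type*} [AddCommMonoid E] (x : ℝ≥0 → ℝ) {g : ℝ → E} (hg : g 0 = 0) :
    jumpSum x g 0 = 0 := by
  have h : 𝓝[<] (0 : ℝ≥0) = ⊥ := by simp
  rw [jumpSum, show Set.Iic (0 : ℝ≥0) = {0} by ext; simp, finsum_mem_singleton,
    leftLim_eq_of_eq_bot _ h, sub_self, hg]

/-- All integrands vanish on `[-ε, ε]`, so all the sums run over one finite set of times, and
convergence at the actual jump sizes suffices. -/
theorem tendsto_jumpSum {E : Type*} [AddCommMonoid E] [TopologicalSpace E] [ContinuousAdd E]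
    {T : ℝ≥0∞} {x : ℝ≥0 → ℝ} (hx : IsCadlagOn T x) {t : ℝ≥0} (ht : t ∈ TimeSet T)
    {ε : ℝ} (hε : 0 < ε) {g : ℕ → ℝ → E} {g' : ℝ → E} (hg : ∀ n y, |y| ≤ ε → g n y = 0)
    (hg' : ∀ y, |y| ≤ ε → g' y = 0)
    (hlim : ∀ r ≤ t, Tendsto (fun n => g n (x r - Function.leftLim x r)) atTop
      (𝓝 (g' (x r - Function.leftLim x r)))) :
    Tendsto (fun n => jumpSum x (g n) t) atTop (𝓝 (jumpSum x g' t)) := by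
  have hfin := hx.finite_jumps ht hε
  have hS : ∀ f : ℝ → E, (∀ y, |y| ≤ ε → f y = 0) →
      jumpSum x f t = ∑ r ∈ hfin.toFinset with r ≤ t, f (x r - Function.leftLim x r) := by
    intro f hf
    refine jumpSum_eq_sum _ fun r hr h => ?_
    rw [Set.Finite.mem_toFinset]
    exact ⟨hr, not_le.1 fun h' => h (hf _ h')⟩
  simp only [hS _ hg', hS _ (hg _)]
  exact tendsto_finsetSum _ fun r hr => hlim r (Finset.mem_filter.1 hr).2

/-- Only finitely many jumps exceed `ε`. The same set `S` turns the jump measure into a sum of Dirac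
masses and, through `jumpSum_indicator_eq_sum`, the jump sums into finite sums. -/
theorem exists_restrict_jumpMeasure {Ω : Type*} {T : ℝ≥0∞} {L : ℝ≥0 → Ω → ℝ} {ω : Ω}
    (hx : IsCadlagOn T (fun t => L t ω)) {t : ℝ≥0} (ht : t ∈ TimeSet T) {A : Set ℝ}
    (hA : MeasurableSet A) {ε : ℝ} (hε : 0 < ε) (hAε : ∀ y ∈ A, ε < |y|) :
    ∃ S : Finset ℝ≥0, (∀ r, r ∈ S ↔ r ≤ t ∧ jump L r ω ∈ A) ∧
      (jumpMeasure L t ω).restrict A = ∑ r ∈ S, Measure.dirac (jump L r ω) := by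
  classical
  have hfin : {r : ℝ≥0 | r ≤ t ∧ jump L r ω ∈ A}.Finite :=
    (hx.finite_jumps ht hε).subset fun r hr => ⟨hr.1, hAε _ hr.2⟩
  refine ⟨hfin.toFinset, fun r => by simp, ?_⟩
  ext C hC
  have h0 : (0 : ℝ) ∉ C ∩ A := fun h => by
    have := hAε 0 h.2
    rw [abs_zero] at this
    exact absurd hε this.le.not_gt
  rw [Measure.restrict_apply hC, jumpMeasure_apply L t ω (hC.inter hA) h0,
    Measure.finsetSum_apply]
  simp only [Measure.dirac_apply' _ hC, Set.indicator_apply, Pi.one_apply]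
  rw [Finset.sum_boole, show {s : ℝ≥0 | s ≤ t ∧ jump L s ω ∈ C ∩ A} =
    ((hfin.toFinset.filter fun r => jump L r ω ∈ C : Finset ℝ≥0) : Set ℝ≥0) by
      ext r; simp [and_assoc, and_comm], Set.encard_coe_eq_coe_finsetCard]
  simp

theorem jumpSum_indicator_eq_sum {Ω : Type*} {L : ℝ≥0 → Ω → ℝ} {ω : Ω} {t : ℝ≥0} {A : Set ℝ}
    {E : Type*} [AddCommMonoid E] {S : Finset ℝ≥0}
    (hS : ∀ r, r ∈ S ↔ r ≤ t ∧ jump L r ω ∈ A) (φ : ℝ → E) :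
    jumpSum (fun t => L t ω) (A.indicator φ) t = ∑ r ∈ S, φ (jump L r ω) := by
  rw [jumpSum_eq_sum S]
  · rw [Finset.filter_true_of_mem fun r hr => ((hS r).1 hr).1]
    exact Finset.sum_congr rfl fun r hr => Set.indicator_of_mem ((hS r).1 hr).2 φ
  · intro r hr h
    exact (hS r).2 ⟨hr, Set.mem_of_indicator_ne_zero h⟩

theorem setIntegral_jumpMeasure {E : Type*} [NormedAddCommGroup E] [NormedSpace ℝ E]
    [CompleteSpace E] {Ω : Type*} {T : ℝ≥0∞} {L : ℝ≥0 → Ω → ℝ} {ω : Ω}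
    (hx : IsCadlagOn T (fun t => L t ω)) {t : ℝ≥0} (ht : t ∈ TimeSet T) {A : Set ℝ}
    (hA : MeasurableSet A) {ε : ℝ} (hε : 0 < ε) (hAε : ∀ y ∈ A, ε < |y|)
    (φ : ℝ → E) :
    ∫ y in A, φ y ∂jumpMeasure L t ω = jumpSum (fun t => L t ω) (A.indicator φ) t := by
  obtain ⟨S, hS, h⟩ := exists_restrict_jumpMeasure hx ht hA hε hAε
  rw [h, integral_finsetSum_measure fun r _ => integrable_dirac (by simp),
    jumpSum_indicator_eq_sum hS]
  simp

theorem integrableOn_jumpMeasure {E : Type*} [NormedAddCommGroup E] {Ω : Type*} {T : ℝ≥0∞} {L : ℝ≥0 → Ω → ℝ} {ω : Ω}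
    (hx : IsCadlagOn T (fun t => L t ω)) {t : ℝ≥0} (ht : t ∈ TimeSet T) {A : Set ℝ}
    (hA : MeasurableSet A) {ε : ℝ} (hε : 0 < ε) (hAε : ∀ y ∈ A, ε < |y|)
    (φ : ℝ → E) :
    IntegrableOn φ A (jumpMeasure L t ω) := by
  obtain ⟨S, hS, h⟩ := exists_restrict_jumpMeasure hx ht hA hε hAε
  rw [IntegrableOn, h, integrable_finsetSum_measure]
  exact fun r _ => integrable_dirac (by simp)

theorem jumpMeasure_apply_lt_top {Ω : Type*} {T : ℝ≥0∞} {L : ℝ≥0 → Ω → ℝ} {ω : Ω}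
    (hx : IsCadlagOn T (fun t => L t ω)) {t : ℝ≥0} (ht : t ∈ TimeSet T) {A : Set ℝ}
    (hA : MeasurableSet A) {ε : ℝ} (hε : 0 < ε) (hAε : ∀ y ∈ A, ε < |y|) :
    jumpMeasure L t ω A < ∞ := by
  obtain ⟨S, hS, h⟩ := exists_restrict_jumpMeasure hx ht hA hε hAε
  rw [← Measure.restrict_apply_univ, h, Measure.finsetSum_apply]
  simp

theorem jumpSum_indicator_one {Ω : Type*} {T : ℝ≥0∞} {L : ℝ≥0 → Ω → ℝ} {ω : Ω}
    (hx : IsCadlagOn T (fun t => L t ω)) {t : ℝ≥0} (ht : t ∈ TimeSet T) {A : Set ℝ}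
    (hA : MeasurableSet A) {ε : ℝ} (hε : 0 < ε) (hAε : ∀ y ∈ A, ε < |y|) :
    jumpSum (fun t => L t ω) (A.indicator fun _ => (1 : ℝ)) t = (jumpMeasure L t ω).real A := by
  rw [← setIntegral_jumpMeasure hx ht hA hε hAε]
  simp

/-- A sequence of continuous functions which increases to the indicator function of the open set
`V`. -/
noncomputable def openApprox (V : Set ℝ) (n : ℕ) (y : ℝ) : ℝ := min 1 (n * Metric.infDist y Vᶜ)

theorem continuous_openApprox (V : Set ℝ) (n : ℕ) : Continuous (openApprox V n) :=
  continuous_const.min (continuous_const.mul (Metric.continuous_infDist_pt _))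

theorem openApprox_nonneg (V : Set ℝ) (n : ℕ) (y : ℝ) : 0 ≤ openApprox V n y :=
  le_min zero_le_one (mul_nonneg n.cast_nonneg Metric.infDist_nonneg)

theorem openApprox_le_one (V : Set ℝ) (n : ℕ) (y : ℝ) : openApprox V n y ≤ 1 := min_le_left _ _

theorem openApprox_eq_zero {V : Set ℝ} (n : ℕ) {y : ℝ} (hy : y ∉ V) : openApprox V n y = 0 := by
  simp [openApprox, Metric.infDist_zero_of_mem (show y ∈ Vᶜ from hy)]

/-- Off the closed set `Vᶜ` the distance to it is positive, so the minimum is eventually `1`.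
Nonemptiness of `Vᶜ` matters because `Metric.infDist` to the empty set is `0`. -/
theorem tendsto_openApprox {V : Set ℝ} (hV : IsOpen V) (hne : Vᶜ.Nonempty) (y : ℝ) :
    Tendsto (fun n => openApprox V n y) atTop (𝓝 (V.indicator (fun _ => (1 : ℝ)) y)) := by
  by_cases hy : y ∈ V
  · rw [Set.indicator_of_mem hy]
    have hpos : 0 < Metric.infDist y Vᶜ :=
      (hV.isClosed_compl.notMem_iff_infDist_pos hne).1 (by simpa using hy)
    refine Tendsto.congr' ?_ tendsto_const_nhds
    have := (tendsto_natCast_atTop_atTop (R := ℝ)).atTop_mul_const hpos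
    filter_upwards [this.eventually_ge_atTop 1] with n hn
    exact (min_eq_left hn).symm
  · simp [openApprox_eq_zero _ hy, hy]

/-- The set `{y | ε < |y|}`. -/
def outside (ε : ℝ) : Set ℝ := {y | ε < |y|}

theorem isOpen_outside (ε : ℝ) : IsOpen (outside ε) := isOpen_lt continuous_const continuous_abs

theorem mem_outside {ε y : ℝ} : y ∈ outside ε ↔ ε < |y| := Iff.rfl

namespace IsLevyProcess

variable {Ω : Type*} {mΩ : MeasurableSpace Ω} {P : Measure Ω}
    {𝓕 : Filtration ℝ≥0 mΩ} {T : ℝ≥0∞} {L : ℝ≥0 → Ω → ℝ}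

/-- The jump sum is a pointwise limit of grid sums that use the path only up to time `t`. -/
theorem measurable_jumpSum_of_continuous (hL : IsLevyProcess P 𝓕 T L) {t : ℝ≥0}
    (ht : t ∈ TimeSet T) {g : ℝ → ℝ} (hg : Continuous g) {ε : ℝ} (hε : 0 < ε)
    (hgε : ∀ y, |y| ≤ ε → g y = 0) :
    Measurable[𝓕 t] fun ω => jumpSum (fun t => L t ω) g t := by
  have ht' : 0 + t ∈ TimeSet T := by rwa [zero_add]
  refine @measurable_of_tendsto_metrizable _ _ (𝓕 t) _ _ _ _ (fun n => gridSum L g 0 t n) _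
    (fun n => ?_) (tendsto_pi_nhds.2 fun ω => ?_)
  · have := hL.measurable_gridSum ht' hg.measurable n
    rwa [zero_add] at this
  · have := hL.tendsto_gridSum ht' hg hε hgε ω
    rwa [zero_add, jumpSum_zero _ (hgε 0 (by simpa using hε.le)), sub_zero] at this

theorem tendsto_jumpSum_openApprox (hL : IsLevyProcess P 𝓕 T L) {t : ℝ≥0}
    (ht : t ∈ TimeSet T) {ε : ℝ} (hε : 0 < ε) {V : Set ℝ} (hV : IsOpen V) (hVε : V ⊆ outside ε)
    (ω : Ω) :
    Tendsto (fun n => jumpSum (fun t => L t ω) (openApprox V n) t) atTop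
      (𝓝 ((jumpMeasure L t ω).real V)) := by
  rw [← jumpSum_indicator_one (hL.cadlag ω) ht hV.measurableSet hε hVε]
  have h0 : ∀ y, |y| ≤ ε → y ∉ V := fun y hy h => absurd (hVε h) (not_lt.2 hy)
  exact tendsto_jumpSum (hL.cadlag ω) ht hε (fun n y hy => openApprox_eq_zero n (h0 y hy))
    (fun y hy => Set.indicator_of_notMem (h0 y hy) _)
    fun r _ => tendsto_openApprox hV ⟨0, h0 0 (by simpa using hε.le)⟩ _

/-- The restricted measures are finite and open sets form a generating π-system, so open sets
suffice. Their masses are limits of jump sums of the continuous functions `openApprox`. -/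
theorem measurable_restrict_jumpMeasure_outside (hL : IsLevyProcess P 𝓕 T L) {t : ℝ≥0}
    (ht : t ∈ TimeSet T) {ε : ℝ} (hε : 0 < ε) :
    Measurable[𝓕 t] fun ω => (jumpMeasure L t ω).restrict (outside ε) := by
  have hO := (isOpen_outside ε).measurableSet
  have hfin : ∀ ω, IsFiniteMeasure ((jumpMeasure L t ω).restrict (outside ε)) := fun ω =>
    ⟨by
      rw [Measure.restrict_apply_univ]
      exact jumpMeasure_apply_lt_top (hL.cadlag ω) ht hO hε fun _ h => h⟩
  have key : ∀ U : Set ℝ, IsOpen U →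
      Measurable[𝓕 t] fun ω => (jumpMeasure L t ω).restrict (outside ε) U := by
    intro U hU
    have hV := hU.inter (isOpen_outside ε)
    have h0 : ∀ y, |y| ≤ ε → y ∉ U ∩ outside ε := fun y hy h => absurd h.2 (not_lt.2 hy)
    have h1 : Measurable[𝓕 t] fun ω => (jumpMeasure L t ω).real (U ∩ outside ε) := by
      refine @measurable_of_tendsto_metrizable _ _ (𝓕 t) _ _ _ _
        (fun n ω => jumpSum (fun t => L t ω) (openApprox (U ∩ outside ε) n) t) _
        (fun n => ?_) (tendsto_pi_nhds.2 fun ω => ?_)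
      · exact hL.measurable_jumpSum_of_continuous ht (continuous_openApprox _ n) hε
          fun y hy => openApprox_eq_zero n (h0 y hy)
      · exact hL.tendsto_jumpSum_openApprox ht hε hV Set.inter_subset_right ω
    have h2 : (fun ω => (jumpMeasure L t ω).restrict (outside ε) U) =
        fun ω => ENNReal.ofReal ((jumpMeasure L t ω).real (U ∩ outside ε)) := by
      ext ω
      rw [Measure.restrict_apply hU.measurableSet, ofReal_measureReal (h := ?_)]
      exact (jumpMeasure_apply_lt_top (hL.cadlag ω) ht hV.measurableSet hε
        fun _ h => h.2).ne
    rw [h2]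
    exact ENNReal.measurable_ofReal.comp h1
  exact @Measurable.measure_of_isPiSystem _ _ (𝓕 t) _ _ hfin _ BorelSpace.measurable_eq isPiSystem_isOpen key (key _ isOpen_univ)

theorem measurable_restrict_jumpMeasure (hL : IsLevyProcess P 𝓕 T L) {t : ℝ≥0}
    (ht : t ∈ TimeSet T) {A : Set ℝ} (hA : MeasurableSet A) {ε : ℝ} (hε : 0 < ε)
    (hAε : A ⊆ outside ε) : Measurable[𝓕 t] fun ω => (jumpMeasure L t ω).restrict A := by
  have h := hL.measurable_restrict_jumpMeasure_outside ht hε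
  have h2 : (fun ω => (jumpMeasure L t ω).restrict A) =
      fun ω => ((jumpMeasure L t ω).restrict (outside ε)).restrict A := by
    ext1 ω
    rw [Measure.restrict_restrict hA, Set.inter_eq_left.2 hAε]
  rw [h2]
  refine @Measure.measurable_of_measurable_coe _ _ _ (𝓕 t) _ fun C hC => ?_
  simp only [Measure.restrict_apply hC]
  exact (Measure.measurable_coe (hC.inter hA)).comp h

/-- Small jumps may have infinite total number, so the π-system argument is not available for the
full measure; it is the supremum of its restrictions to `outside (1 / (n + 1))`. -/
theorem measurable_jumpMeasure (hL : IsLevyProcess P 𝓕 T L) {t : ℝ≥0}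
    (ht : t ∈ TimeSet T) : Measurable (jumpMeasure L t) := by
  refine Measure.measurable_of_measurable_coe _ fun C hC => ?_
  have h1 : ∀ ω, jumpMeasure L t ω C =
      ⨆ n : ℕ, (jumpMeasure L t ω).restrict (outside (1 / ((n : ℝ) + 1))) C := by
    intro ω
    have hU : (⋃ n : ℕ, outside (1 / ((n : ℝ) + 1))) = {0}ᶜ := by
      ext y
      simp only [Set.mem_iUnion, mem_outside, Set.mem_compl_iff, Set.mem_singleton_iff]
      constructor
      · rintro ⟨n, hn⟩ rfl
        rw [abs_zero] at hn
        exact absurd hn (not_lt.2 (by positivity))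
      · intro hy
        exact exists_nat_one_div_lt (abs_pos.2 hy)
    have hmono : Monotone fun n : ℕ => outside (1 / ((n : ℝ) + 1)) := fun n m hnm y hy =>
      lt_of_le_of_lt
      (one_div_le_one_div_of_le (by positivity) (by simpa using hnm)) (mem_outside.1 hy)
    rw [← Measure.restrict_iUnion_apply_eq_iSup hmono.directed_le hC, hU]
    conv_lhs => rw [jumpMeasure]
    conv_rhs => rw [jumpMeasure, Measure.restrict_restrict (by simp), Set.inter_self]
  simp only [h1]
  refine Measurable.iSup fun n => ?_
  exact (Measure.measurable_coe hC).comp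
    ((hL.measurable_restrict_jumpMeasure_outside ht (by positivity)).mono (𝓕.le _) le_rfl)

theorem measurable_jumpSum_indicator (hL : IsLevyProcess P 𝓕 T L) {t : ℝ≥0}
    (ht : t ∈ TimeSet T) {A : Set ℝ} (hA : MeasurableSet A) {ε : ℝ} (hε : 0 < ε)
    (hAε : A ⊆ outside ε) {φ : ℝ → ℝ} (hφ : Measurable φ) :
    Measurable[𝓕 t] fun ω => jumpSum (fun t => L t ω) (A.indicator φ) t := by
  have h := hL.measurable_restrict_jumpMeasure ht hA hε hAε
  have h2 : (fun ω => jumpSum (fun t => L t ω) (A.indicator φ) t) = fun ω =>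
      (∫⁻ y, ENNReal.ofReal (φ y) ∂(jumpMeasure L t ω).restrict A).toReal -
      (∫⁻ y, ENNReal.ofReal (-φ y) ∂(jumpMeasure L t ω).restrict A).toReal := by
    ext ω
    rw [← setIntegral_jumpMeasure (hL.cadlag ω) ht hA hε hAε,
      integral_eq_lintegral_pos_part_sub_lintegral_neg_part]
    exact integrableOn_jumpMeasure (hL.cadlag ω) ht hA hε hAε _
  rw [h2]
  refine Measurable.sub (ENNReal.measurable_toReal.comp ?_) (ENNReal.measurable_toReal.comp ?_)
  · exact (Measure.measurable_lintegral (ENNReal.measurable_ofReal.comp hφ)).comp h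
  · exact (Measure.measurable_lintegral (ENNReal.measurable_ofReal.comp hφ.neg)).comp h

end IsLevyProcess

/-! ### The expected jump measure is linear in time -/

/-- A nonnegative additive function is monotone, hence linear. Comparing `t` with the largest
multiple of `τ / n` below it yields the inequality up to an error of order `1 / n`; exchanging `t`
and `τ` gives equality. All times used stay below `t` or `τ`, hence within the horizon. -/
theorem mul_le_mul_of_additive {T : ℝ≥0∞} {c : ℝ≥0 → ℝ} (h0 : ∀ t ∈ TimeSet T, 0 ≤ c t)
    (hadd : ∀ s h, s + h ∈ TimeSet T → c (s + h) = c s + c h) {t τ : ℝ≥0} (ht : t ∈ TimeSet T)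
    (hτ : τ ∈ TimeSet T) : t * c τ ≤ τ * c t := by
  have hz : c 0 = 0 := by
    have := hadd 0 0 (by simpa using timeSet_mono bot_le ht)
    rw [add_zero] at this
    linarith
  rcases eq_or_ne τ 0 with rfl | hτ0
  · simp [hz]
  have hmul : ∀ (d : ℝ≥0) (m : ℕ), m * d ∈ TimeSet T → c (m * d) = m * c d := by
    intro d m
    induction m with
    | zero => intro _; simp [hz]
    | succ m ih =>
      intro hm
      have e : ((m + 1 : ℕ) : ℝ≥0) * d = m * d + d := by push_cast; ring
      rw [e] at hm ⊢
      rw [hadd _ _ hm, ih (timeSet_mono le_self_add hm)]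
      push_cast; ring
  have hτ' : (0 : ℝ) < τ := by exact_mod_cast pos_iff_ne_zero.2 hτ0
  have key : ∀ n : ℕ, n ≠ 0 → (t - τ * (1 / n)) * c τ ≤ τ * c t := by
    intro n hn
    have hn' : (0 : ℝ) < n := by exact_mod_cast Nat.pos_of_ne_zero hn
    have hnn : (n : ℝ≥0) ≠ 0 := by exact_mod_cast hn
    -- `m * (τ / n) ≤ t` gives `c t ≥ m * c (τ / n) = (m / n) * c τ`, while `m / n` exceeds `t / τ -
    -- 1 / n`.
    set m := ⌊(n : ℝ) * t / τ⌋₊ with hm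
    have h1 : (m : ℝ) ≤ n * t / τ := Nat.floor_le (by positivity)
    have h2 : (n : ℝ) * t / τ < m + 1 := Nat.lt_floor_add_one _
    have hmt : m * (τ / n) ≤ t := by
      rw [← NNReal.coe_le_coe]
      push_cast
      rw [le_div_iff₀ hτ'] at h1
      rw [mul_div_assoc', div_le_iff₀ hn']
      linarith
    have e1 := hmul (τ / n) m (timeSet_mono hmt ht)
    have e2 := hmul (τ / n) n (by rwa [mul_div_cancel₀ _ hnn])
    rw [mul_div_cancel₀ _ hnn] at e2
    obtain ⟨r, hr⟩ := exists_add_of_le hmt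
    have e3 := hadd (m * (τ / n)) r (hr ▸ ht)
    rw [← hr, e1] at e3
    have hr0 := h0 r (timeSet_mono (by rw [hr]; exact le_add_self) ht)
    have hc0 : 0 ≤ c (τ / n) := h0 _ (timeSet_mono (div_le_self bot_le
      (by exact_mod_cast Nat.one_le_iff_ne_zero.2 hn)) hτ)
    rw [e2, e3]
    rw [div_lt_iff₀ hτ'] at h2
    have h3 : (t - τ * (1 / n)) * (n * c (τ / n)) = (n * t - τ) * c (τ / n) := by
      field_simp
    rw [h3]
    have h4 : (n * t - τ) * c (τ / n) ≤ (m * τ) * c (τ / n) :=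
      mul_le_mul_of_nonneg_right (by linarith) hc0
    nlinarith
  have hlim : Tendsto (fun n : ℕ => ((t : ℝ) - τ * (1 / n)) * c τ) atTop
      (𝓝 ((t - τ * 0) * c τ)) :=
    ((tendsto_const_nhds.sub (tendsto_one_div_atTop_nhds_zero_nat.const_mul _)).mul_const _)
  rw [mul_zero, sub_zero] at hlim
  refine le_of_tendsto hlim ?_
  filter_upwards [eventually_ne_atTop 0] with n hn using key n hn

theorem norm_jumpSum_le {E : Type*} [NormedAddCommGroup E] {T : ℝ≥0∞} {x : ℝ≥0 → ℝ}
    (hx : IsCadlagOn T x) {t : ℝ≥0} (ht : t ∈ TimeSet T) {ε : ℝ} (hε : 0 < ε) {g : ℝ → E}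
    {k : ℝ → ℝ} (hk : ∀ y, |y| ≤ ε → k y = 0) (hgk : ∀ y, ‖g y‖ ≤ k y) :
    ‖jumpSum x g t‖ ≤ jumpSum x k t := by
  have hfin := hx.finite_jumps ht hε
  have hmem : ∀ r ≤ t, k (x r - Function.leftLim x r) ≠ 0 → r ∈ hfin.toFinset := fun r hr h => by
    rw [Set.Finite.mem_toFinset]
    exact ⟨hr, not_le.1 fun h' => h (hk _ h')⟩
  rw [jumpSum_eq_sum hfin.toFinset hmem, jumpSum_eq_sum hfin.toFinset fun r hr h => hmem r hr
    fun h' => h (norm_le_zero_iff.1 ((hgk _).trans h'.le))]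
  exact (norm_sum_le _ _).trans (Finset.sum_le_sum fun _ _ => hgk _)

theorem min_one_toNNReal_mem_timeSet (T : ℝ≥0∞) : (min 1 T).toNNReal ∈ TimeSet T := by
  show ((min 1 T).toNNReal : ℝ≥0∞) ≤ T
  rw [ENNReal.coe_toNNReal (ne_top_of_le_ne_top ENNReal.one_ne_top (min_le_left _ _))]
  exact min_le_right _ _

theorem bind_jumpMeasure_zero {Ω : Type*} {mΩ : MeasurableSpace Ω} (P : Measure Ω)
    (L : ℝ≥0 → Ω → ℝ) :
    P.bind (jumpMeasure L 0) = 0 := by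
  have h : jumpMeasure L 0 = fun _ => 0 := by
    ext1 ω
    rw [jumpMeasure, Measure.restrict_eq_zero, Measure.sum_apply _ (by simp)]
    refine ENNReal.tsum_eq_zero.2 fun ⟨s, hs⟩ => ?_
    have : s = 0 := by simpa using hs
    subst this
    simp [jump_zero]
  rw [h, Measure.bind_zero_right']

namespace IsLevyProcess

variable {Ω : Type*} {mΩ : MeasurableSpace Ω} {P : Measure Ω} [IsProbabilityMeasure P]
    {𝓕 : Filtration ℝ≥0 mΩ} {T : ℝ≥0∞} {L : ℝ≥0 → Ω → ℝ}

theorem tendsto_integral_jumpSum {𝕜 : Type*} [RCLike 𝕜] (hL : IsLevyProcess P 𝓕 T L) {t : ℝ≥0}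
    (ht : t ∈ TimeSet T) {G : ℝ → 𝕜} (hG : Continuous G) {C : ℝ} (hC : ∀ y, ‖G y‖ ≤ C)
    {ε : ℝ} (hε : 0 < ε) (hGε : ∀ y, |y| ≤ ε → G y = 0) :
    Integrable (fun ω => jumpSum (fun t => L t ω) G t) P ∧
    Tendsto (fun n : ℕ => n * ∫ ω, G (L (t / n) ω - L 0 ω) ∂P) atTop
      (𝓝 (∫ ω, jumpSum (fun t => L t ω) G t ∂P)) := by
  have := hL.tendsto_integral_gridSum (s := 0) (by rwa [zero_add]) hG hC hε hGε
  simpa [jumpSum_zero _ (hGε 0 (by simpa using hε.le))] using this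

/-- The mean over the jumps in `(s, s + h]` and the mean over those up to `h` are limits of the same
sequence. -/
theorem integral_jumpSum_add {𝕜 : Type*} [RCLike 𝕜] (hL : IsLevyProcess P 𝓕 T L) {s h : ℝ≥0}
    (ht : s + h ∈ TimeSet T) {G : ℝ → 𝕜} (hG : Continuous G) {C : ℝ} (hC : ∀ y, ‖G y‖ ≤ C)
    {ε : ℝ} (hε : 0 < ε) (hGε : ∀ y, |y| ≤ ε → G y = 0) :
    ∫ ω, jumpSum (fun t => L t ω) G (s + h) ∂P =
      ∫ ω, jumpSum (fun t => L t ω) G s ∂P + ∫ ω, jumpSum (fun t => L t ω) G h ∂P := by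
  have h1 := hL.tendsto_integral_gridSum ht hG hC hε hGε
  have h2 := hL.tendsto_integral_jumpSum (timeSet_mono le_add_self ht) hG hC hε hGε
  have h3 := hL.tendsto_integral_jumpSum (timeSet_mono le_self_add ht) hG hC hε hGε
  have h4 := hL.tendsto_integral_jumpSum ht hG hC hε hGε
  have := tendsto_nhds_unique h1.2 h2.2
  rw [integral_sub h4.1 h3.1] at this
  rw [← this]; ring

/-- For each `openApprox V n` the mean jump sum is nonnegative and additive in time, hence linear.
Dominated convergence, with the integrable jump sum of the cutoff as a bound, carries this over to
`V`. -/
theorem measure_bind_jumpMeasure_of_isOpen (hL : IsLevyProcess P 𝓕 T L) {ε : ℝ} (hε : 0 < ε)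
    {V : Set ℝ} (hV : IsOpen V) (hVε : V ⊆ outside ε) {t τ : ℝ≥0} (ht : t ∈ TimeSet T)
    (hτ : τ ∈ TimeSet T) :
    P.bind (jumpMeasure L t) V < ∞ ∧
      τ * P.bind (jumpMeasure L t) V = t * P.bind (jumpMeasure L τ) V := by
  have h0 : ∀ y, |y| ≤ ε → y ∉ V := fun y hy h => absurd (hVε h) (not_lt.2 hy)
  have hle : ∀ n y, ‖openApprox V n y‖ ≤ cutoff ε y := by
    intro n y
    rw [Real.norm_eq_abs, abs_of_nonneg (openApprox_nonneg V n y)]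
    by_cases hy : |y| ≤ ε
    · rw [openApprox_eq_zero n (h0 y hy)]; exact cutoff_nonneg ε y
    · rw [cutoff_eq_one hε (not_le.1 hy).le]; exact openApprox_le_one V n y
  have hcut : ∀ y, |y| ≤ ε / 2 → cutoff ε y = 0 := fun y hy => cutoff_eq_zero hε hy
  have hn1 : ∀ n y, ‖openApprox V n y‖ ≤ 1 := fun n y => (hle n y).trans (cutoff_le_one ε y)
  have hlim : ∀ t ∈ TimeSet T, Integrable (fun ω => (jumpMeasure L t ω).real V) P ∧
      Tendsto (fun n => ∫ ω, jumpSum (fun t => L t ω) (openApprox V n) t ∂P) atTop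
        (𝓝 (∫ ω, (jumpMeasure L t ω).real V ∂P)) := by
    intro t ht
    have hcint := (hL.tendsto_integral_jumpSum ht (continuous_cutoff ε) (C := 1) (fun y => by
      rw [Real.norm_eq_abs, abs_of_nonneg (cutoff_nonneg ε y)]; exact cutoff_le_one ε y)
      (half_pos hε) hcut).1
    have hi : ∀ n, Integrable (fun ω => jumpSum (fun t => L t ω) (openApprox V n) t) P := fun n =>
      (hL.tendsto_integral_jumpSum ht (continuous_openApprox V n) (hn1 n) hε
        (fun y hy => openApprox_eq_zero n (h0 y hy))).1
    have hb : ∀ n ω, ‖jumpSum (fun t => L t ω) (openApprox V n) t‖ ≤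
        jumpSum (fun t => L t ω) (cutoff ε) t := fun n ω =>
      norm_jumpSum_le (hL.cadlag ω) ht (half_pos hε) hcut (hle n)
    have hp := hL.tendsto_jumpSum_openApprox ht hε hV hVε
    refine ⟨hcint.mono' (aestronglyMeasurable_of_tendsto_ae atTop (fun n => (hi n).1)
      (Eventually.of_forall hp)) (Eventually.of_forall fun ω => ?_), ?_⟩
    · exact le_of_tendsto (hp ω).norm (Eventually.of_forall fun n => hb n ω)
    · exact tendsto_integral_of_dominated_convergence _ (fun n => (hi n).1) hcint
        (fun n => Eventually.of_forall (hb n)) (Eventually.of_forall hp)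
  have hbind : ∀ t ∈ TimeSet T, P.bind (jumpMeasure L t) V =
      ENNReal.ofReal (∫ ω, (jumpMeasure L t ω).real V ∂P) := by
    intro t ht
    rw [Measure.bind_apply hV.measurableSet (hL.measurable_jumpMeasure ht).aemeasurable,
      ofReal_integral_eq_lintegral_ofReal (hlim t ht).1
        (Eventually.of_forall fun ω => measureReal_nonneg)]
    refine lintegral_congr fun ω => ?_
    rw [ofReal_measureReal (h := ?_)]
    exact (jumpMeasure_apply_lt_top (hL.cadlag ω) ht hV.measurableSet hε hVε).ne
  have hnn : ∀ n, ∀ t, 0 ≤ ∫ ω, jumpSum (fun t => L t ω) (openApprox V n) t ∂P := fun n t =>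
    integral_nonneg fun ω => finsum_nonneg fun _ => finsum_nonneg fun _ => openApprox_nonneg V n _
  have hadd : ∀ n, ∀ s h, s + h ∈ TimeSet T →
      ∫ ω, jumpSum (fun t => L t ω) (openApprox V n) (s + h) ∂P =
        ∫ ω, jumpSum (fun t => L t ω) (openApprox V n) s ∂P +
          ∫ ω, jumpSum (fun t => L t ω) (openApprox V n) h ∂P := fun n s h hsh =>
    hL.integral_jumpSum_add hsh (continuous_openApprox V n) (hn1 n) hε
        (fun y hy => openApprox_eq_zero n (h0 y hy))
  have heq : (τ : ℝ) * ∫ ω, (jumpMeasure L t ω).real V ∂P =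
      t * ∫ ω, (jumpMeasure L τ ω).real V ∂P := by
    refine tendsto_nhds_unique ((hlim t ht).2.const_mul (τ : ℝ))
      (((hlim τ hτ).2.const_mul (t : ℝ)).congr fun n => ?_)
    exact le_antisymm (mul_le_mul_of_additive (fun t _ => hnn n t) (hadd n) ht hτ)
      (mul_le_mul_of_additive (fun t _ => hnn n t) (hadd n) hτ ht)
  rw [hbind t ht, hbind τ hτ]
  refine ⟨ENNReal.ofReal_lt_top, ?_⟩
  rw [← ENNReal.ofReal_coe_nnreal (p := τ), ← ENNReal.ofReal_coe_nnreal (p := t),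
    ← ENNReal.ofReal_mul τ.coe_nonneg, ← ENNReal.ofReal_mul t.coe_nonneg, heq]

theorem restrict_bind_jumpMeasure_outside (hL : IsLevyProcess P 𝓕 T L) {ε : ℝ} (hε : 0 < ε)
    {t τ : ℝ≥0} (ht : t ∈ TimeSet T) (hτ : τ ∈ TimeSet T) :
    (τ : ℝ≥0∞) • (P.bind (jumpMeasure L t)).restrict (outside ε) =
      (t : ℝ≥0∞) • (P.bind (jumpMeasure L τ)).restrict (outside ε) := by
  have hO := isOpen_outside ε
  have key : ∀ U : Set ℝ, IsOpen U →
      ((τ : ℝ≥0∞) • (P.bind (jumpMeasure L t)).restrict (outside ε)) U =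
      ((t : ℝ≥0∞) • (P.bind (jumpMeasure L τ)).restrict (outside ε)) U := by
    intro U hU
    rw [Measure.smul_apply, Measure.smul_apply, Measure.restrict_apply hU.measurableSet,
      Measure.restrict_apply hU.measurableSet]
    exact (hL.measure_bind_jumpMeasure_of_isOpen hε (hU.inter hO) Set.inter_subset_right ht hτ).2
  have : IsFiniteMeasure ((τ : ℝ≥0∞) • (P.bind (jumpMeasure L t)).restrict (outside ε)) := by
    refine ⟨?_⟩
    rw [Measure.smul_apply, Measure.restrict_apply_univ]
    exact ENNReal.mul_lt_top ENNReal.coe_lt_top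
      (hL.measure_bind_jumpMeasure_of_isOpen hε hO le_rfl ht hτ).1
  exact ext_of_generate_finite _ BorelSpace.measurable_eq isPiSystem_isOpen key
    (key _ isOpen_univ)

theorem levyMeasure_outside_lt_top (hL : IsLevyProcess P 𝓕 T L) {ε : ℝ} (hε : 0 < ε) :
    levyMeasure P T L (outside ε) < ∞ := by
  have hτ := min_one_toNNReal_mem_timeSet T
  rw [levyMeasure, Measure.smul_apply]
  -- For `T = 0` the factor `(min 1 T)⁻¹` is `∞`, but it multiplies the zero measure.
  rcases eq_or_ne (min 1 T) 0 with h | h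
  · rw [h, ENNReal.toNNReal_zero, bind_jumpMeasure_zero]; simp
  · exact ENNReal.mul_lt_top (ENNReal.inv_lt_top.2 (pos_iff_ne_zero.2 h))
      (hL.measure_bind_jumpMeasure_of_isOpen hε (isOpen_outside ε) le_rfl hτ hτ).1

/-- The intensity of the jumps up to time `t` is `t` times the Lévy measure. -/
theorem restrict_bind_jumpMeasure (hL : IsLevyProcess P 𝓕 T L) {ε : ℝ} (hε : 0 < ε)
    {A : Set ℝ} (hA : MeasurableSet A) (hAε : A ⊆ outside ε) {t : ℝ≥0} (ht : t ∈ TimeSet T) :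
    (P.bind (jumpMeasure L t)).restrict A = (t : ℝ≥0∞) • (levyMeasure P T L).restrict A := by
  have hτ := min_one_toNNReal_mem_timeSet T
  suffices h : (P.bind (jumpMeasure L t)).restrict (outside ε) =
      (t : ℝ≥0∞) • (levyMeasure P T L).restrict (outside ε) by
    have := congrArg (fun m => Measure.restrict m A) h
    simpa [Measure.restrict_smul, Measure.restrict_restrict hA, Set.inter_eq_left.2 hAε] using this
  have hfin : min 1 T ≠ ∞ := ne_top_of_le_ne_top ENNReal.one_ne_top (min_le_left _ _)
  rw [levyMeasure, Measure.restrict_smul, smul_comm,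
    ← hL.restrict_bind_jumpMeasure_outside hε ht hτ, smul_smul, ENNReal.coe_toNNReal hfin]
  -- For `T = 0` the factors do not cancel, but then `t = 0` and both sides vanish.
  rcases eq_or_ne (min 1 T) 0 with h | h
  · have hT : T = 0 := by
      rcases min_choice 1 T with h' | h' <;> rw [h'] at h <;> simp_all
    have : t = 0 := by
      have : (t : ℝ≥0∞) ≤ T := ht
      rw [hT] at this
      simpa using this
    rw [this, bind_jumpMeasure_zero]
    simp
  · rw [ENNReal.inv_mul_cancel h hfin, one_smul]

theorem isFiniteMeasure_restrict_levyMeasure (hL : IsLevyProcess P 𝓕 T L) {ε : ℝ} (hε : 0 < ε)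
    {A : Set ℝ} (hAε : A ⊆ outside ε) : IsFiniteMeasure ((levyMeasure P T L).restrict A) :=
  ⟨by
    rw [Measure.restrict_apply_univ]
    exact (measure_mono hAε).trans_lt (hL.levyMeasure_outside_lt_top hε)⟩

theorem lintegral_lintegral_jumpMeasure (hL : IsLevyProcess P 𝓕 T L) {ε : ℝ} (hε : 0 < ε)
    {A : Set ℝ} (hA : MeasurableSet A) (hAε : A ⊆ outside ε) {t : ℝ≥0} (ht : t ∈ TimeSet T)
    {φ : ℝ → ℝ≥0∞} (hφ : Measurable φ) :
    ∫⁻ ω, ∫⁻ y in A, φ y ∂jumpMeasure L t ω ∂P = t * ∫⁻ y in A, φ y ∂levyMeasure P T L := by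
  have h := congrArg (fun m => ∫⁻ y, φ y ∂m) (hL.restrict_bind_jumpMeasure hε hA hAε ht)
  simp only [lintegral_smul_measure] at h
  rw [← smul_eq_mul, ← h, ← lintegral_indicator hA, Measure.lintegral_bind
    (hL.measurable_jumpMeasure ht).aemeasurable (hφ.indicator hA).aemeasurable]
  simp only [lintegral_indicator hA]

/-- The mean of an integral against the jump measure. -/
theorem integral_jumpSum_indicator (hL : IsLevyProcess P 𝓕 T L) {ε : ℝ} (hε : 0 < ε)
    {A : Set ℝ} (hA : MeasurableSet A) (hAε : A ⊆ outside ε) {t : ℝ≥0} (ht : t ∈ TimeSet T)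
    {φ : ℝ → ℝ} (hφ : Measurable φ) (hi : IntegrableOn φ A (levyMeasure P T L)) :
    Integrable (fun ω => jumpSum (fun t => L t ω) (A.indicator φ) t) P ∧
      ∫ ω, jumpSum (fun t => L t ω) (A.indicator φ) t ∂P =
        t * ∫ y in A, φ y ∂levyMeasure P T L := by
  have hm := (hL.measurable_restrict_jumpMeasure ht hA hε hAε).mono (𝓕.le _) le_rfl
  have hparts : ∀ ψ : ℝ → ℝ, Measurable ψ → IntegrableOn ψ A (levyMeasure P T L) →
      Integrable (fun ω => (∫⁻ y in A, ENNReal.ofReal (ψ y) ∂jumpMeasure L t ω).toReal) P ∧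
      ∫ ω, (∫⁻ y in A, ENNReal.ofReal (ψ y) ∂jumpMeasure L t ω).toReal ∂P =
        t * (∫⁻ y in A, ENNReal.ofReal (ψ y) ∂levyMeasure P T L).toReal := by
    intro ψ hψ hψi
    have h1 := hL.lintegral_lintegral_jumpMeasure hε hA hAε ht (ENNReal.measurable_ofReal.comp hψ)
    have hmeas : Measurable fun ω => ∫⁻ y in A, ENNReal.ofReal (ψ y) ∂jumpMeasure L t ω :=
      (Measure.measurable_lintegral (ENNReal.measurable_ofReal.comp hψ)).comp hm
    have hlt : ∫⁻ y in A, ENNReal.ofReal (ψ y) ∂levyMeasure P T L < ∞ :=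
      lt_of_le_of_lt (lintegral_mono fun y => Real.ofReal_le_enorm _) hψi.2
    simp only [Function.comp_def] at h1
    have hne : ∫⁻ ω, ∫⁻ y in A, ENNReal.ofReal (ψ y) ∂jumpMeasure L t ω ∂P ≠ ∞ := by
      rw [h1]; exact (ENNReal.mul_lt_top ENNReal.coe_lt_top hlt).ne
    refine ⟨integrable_toReal_of_lintegral_ne_top hmeas.aemeasurable hne, ?_⟩
    rw [integral_toReal hmeas.aemeasurable (ae_lt_top hmeas hne), h1]
    simp
  have h1 := hparts φ hφ hi
  have h2 := hparts (fun y => -φ y) hφ.neg hi.neg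
  have heq : (fun ω => jumpSum (fun t => L t ω) (A.indicator φ) t) = fun ω =>
      (∫⁻ y in A, ENNReal.ofReal (φ y) ∂jumpMeasure L t ω).toReal -
      (∫⁻ y in A, ENNReal.ofReal (-φ y) ∂jumpMeasure L t ω).toReal := by
    ext ω
    rw [← setIntegral_jumpMeasure (hL.cadlag ω) ht hA hε hAε,
      integral_eq_lintegral_pos_part_sub_lintegral_neg_part]
    exact integrableOn_jumpMeasure (hL.cadlag ω) ht hA hε hAε _
  rw [heq]
  refine ⟨h1.1.sub h2.1, ?_⟩
  rw [integral_sub h1.1 h2.1, h1.2, h2.2, integral_eq_lintegral_pos_part_sub_lintegral_neg_part hi,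
    mul_sub]

theorem integral_jumpSum_indicator_complex (hL : IsLevyProcess P 𝓕 T L) {ε : ℝ} (hε : 0 < ε)
    {A : Set ℝ} (hA : MeasurableSet A) (hAε : A ⊆ outside ε) {t : ℝ≥0} (ht : t ∈ TimeSet T)
    {φ : ℝ → ℂ} (hφ : Measurable φ) (hi : IntegrableOn φ A (levyMeasure P T L)) :
    ∫ ω, jumpSum (fun t => L t ω) (A.indicator φ) t ∂P =
        t * ∫ y in A, φ y ∂levyMeasure P T L := by
  have hre := hL.integral_jumpSum_indicator hε hA hAε ht (Complex.measurable_re.comp hφ) hi.re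
  have him := hL.integral_jumpSum_indicator hε hA hAε ht (Complex.measurable_im.comp hφ) hi.im
  have hsplit : ∀ ω, jumpSum (fun t => L t ω) (A.indicator φ) t =
      ((jumpSum (fun t => L t ω) (A.indicator (Complex.re ∘ φ)) t : ℝ) : ℂ) +
      ((jumpSum (fun t => L t ω) (A.indicator (Complex.im ∘ φ)) t : ℝ) : ℂ) * Complex.I := by
    intro ω
    have hx := hL.cadlag ω
    rw [← setIntegral_jumpMeasure hx ht hA hε hAε, ← setIntegral_jumpMeasure hx ht hA hε hAε,
      ← setIntegral_jumpMeasure hx ht hA hε hAε]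
    exact (integral_re_add_im (integrableOn_jumpMeasure hx ht hA hε hAε φ)).symm
  simp only [hsplit]
  rw [integral_add hre.1.ofReal (him.1.ofReal.mul_const _), integral_mul_const,
    integral_complex_ofReal, integral_complex_ofReal, hre.2, him.2]
  have := integral_re_add_im hi
  rw [← this]
  simp only [Function.comp_def]
  push_cast
  simp only [RCLike.re_eq_complex_re, RCLike.im_eq_complex_im, Complex.coe_algebraMap,
    RCLike.I_to_complex]
  ring

end IsLevyProcess

/-! ### The characteristic function formula for measurable integrands -/

theorem norm_exp_I_mul_ofReal (x : ℝ) : ‖Complex.exp (Complex.I * x)‖ = 1 := by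
  rw [mul_comm]; exact Complex.norm_exp_ofReal_mul_I x

theorem norm_exp_I_mul_ofReal_sub_one_le (x : ℝ) : ‖Complex.exp (Complex.I * x) - 1‖ ≤ 2 := by
  refine (norm_sub_le _ _).trans ?_
  rw [norm_exp_I_mul_ofReal, norm_one]; norm_num

theorem integrable_exp_I_mul_sub_one {α : Type*} {mα : MeasurableSpace α} {μ : Measure α}
    [IsFiniteMeasure μ] {g : α → ℝ} (hg : Measurable g) :
    Integrable (fun y => Complex.exp (Complex.I * g y) - 1) μ :=
  Integrable.of_bound (C := 2) (Measurable.aestronglyMeasurable (by fun_prop))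
    (Eventually.of_forall fun _ => norm_exp_I_mul_ofReal_sub_one_le _)

namespace IsLevyProcess

variable {Ω : Type*} {mΩ : MeasurableSpace Ω} {P : Measure Ω} [IsProbabilityMeasure P]
    {𝓕 : Filtration ℝ≥0 mΩ} {T : ℝ≥0∞} {L : ℝ≥0 → Ω → ℝ}

/-- The expected number of jumps into a `ν`-null subset of `outside ε` is `0`, so almost surely no
jump falls there. This turns `ν`-almost everywhere convergence of integrands into almost sure
convergence of jump sums. -/
theorem ae_forall_jump (hL : IsLevyProcess P 𝓕 T L) {ε : ℝ} (hε : 0 < ε) {t : ℝ≥0}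
    (ht : t ∈ TimeSet T) {p : ℝ → Prop}
    (hp : ∀ᵐ y ∂(levyMeasure P T L).restrict (outside ε), p y) :
    ∀ᵐ ω ∂P, ∀ r ≤ t, ε < |jump L r ω| → p (jump L r ω) := by
  have hO := (isOpen_outside ε).measurableSet
  have h1 : ∀ᵐ y ∂(P.bind (jumpMeasure L t)).restrict (outside ε), p y := by
    rw [hL.restrict_bind_jumpMeasure hε hO le_rfl ht]
    exact Measure.ae_smul_measure hp _
  rw [ae_restrict_iff' hO] at h1
  filter_upwards [Measure.ae_ae_of_ae_bind (hL.measurable_jumpMeasure ht).aemeasurable h1]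
    with ω hω r hr hrε
  by_contra hpr
  have h2 : jumpMeasure L t ω {jump L r ω} = 0 := by
    refine measure_mono_null ?_ hω
    rintro _ rfl h
    exact hpr (h hrε)
  rw [jumpMeasure_apply L t ω (measurableSet_singleton _) (fun h => by
    rw [← Set.mem_singleton_iff.1 h, abs_zero] at hrε
    exact absurd hε hrε.not_gt)] at h2
  simp only [ENat.toENNReal_eq_zero, Set.encard_eq_zero] at h2
  have : r ∈ ({s : ℝ≥0 | s ≤ t ∧ jump L s ω ∈ ({jump L r ω} : Set ℝ)}) := ⟨hr, rfl⟩
  rw [h2] at this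
  exact this

/-- The formula for the conditional characteristic function of the sum of `g` over the jumps in
`(s, s + h]`. -/
def HasJumpCharFun (P : Measure Ω) (𝓕 : Filtration ℝ≥0 mΩ) (T : ℝ≥0∞) (L : ℝ≥0 → Ω → ℝ) (ε : ℝ)
    (g : ℝ → ℝ) : Prop :=
  ∀ s h : ℝ≥0, s + h ∈ TimeSet T → ∀ B : Set Ω, MeasurableSet[𝓕 s] B →
    ∫ ω in B, Complex.exp (Complex.I * ((jumpSum (fun t => L t ω) g (s + h) -
      jumpSum (fun t => L t ω) g s : ℝ) : ℂ)) ∂P =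
      P.real B * Complex.exp (h * ∫ y in outside ε, (Complex.exp (Complex.I * g y) - 1)
        ∂levyMeasure P T L)

theorem hasJumpCharFun_of_continuous (hL : IsLevyProcess P 𝓕 T L) {ε : ℝ} (hε : 0 < ε)
    {g : ℝ → ℝ} (hg : Continuous g) (hgε : ∀ y, |y| ≤ ε → g y = 0) :
    HasJumpCharFun P 𝓕 T L ε g := by
  intro s h ht B hB
  have := hL.isFiniteMeasure_restrict_levyMeasure hε (A := outside ε) le_rfl
  rw [hL.setIntegral_exp_jumpSum_of_continuous ht hg hε hgε hB,
    ← hL.integral_jumpSum_indicator_complex hε (isOpen_outside ε).measurableSet le_rfl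
      (timeSet_mono le_add_self ht) (by have := hg.measurable; fun_prop)
      (integrable_exp_I_mul_sub_one hg.measurable)]
  congr 4
  ext ω
  congr 1
  ext y
  by_cases hy : y ∈ outside ε
  · rw [Set.indicator_of_mem hy]
  · rw [Set.indicator_of_notMem hy, hgε y (not_lt.1 hy)]; simp

/-- Dominated convergence on both sides: the exponentials have modulus `1`, and on the right the
integrands are bounded by `2` for a measure that is finite on `outside ε`. -/
theorem HasJumpCharFun.of_tendsto (hL : IsLevyProcess P 𝓕 T L) {ε : ℝ} (hε : 0 < ε)
    {g : ℕ → ℝ → ℝ} {g' : ℝ → ℝ} (hg : ∀ n, HasJumpCharFun P 𝓕 T L ε (g n))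
    (hm : ∀ n, Measurable (g n))
    (hgε : ∀ n y, |y| ≤ ε → g n y = 0) (hgε' : ∀ y, |y| ≤ ε → g' y = 0)
    (hlim : ∀ᵐ y ∂(levyMeasure P T L).restrict (outside ε),
      Tendsto (fun n => g n y) atTop (𝓝 (g' y))) :
    HasJumpCharFun P 𝓕 T L ε g' := by
  intro s h ht B hB
  have hfin := hL.isFiniteMeasure_restrict_levyMeasure hε (A := outside ε) le_rfl
  have hO := (isOpen_outside ε).measurableSet
  have hJ : ∀ t ∈ TimeSet T, ∀ᵐ ω ∂P, Tendsto (fun n => jumpSum (fun t => L t ω) (g n) t) atTop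
      (𝓝 (jumpSum (fun t => L t ω) g' t)) := by
    intro t ht
    filter_upwards [hL.ae_forall_jump hε ht hlim] with ω hω
    refine tendsto_jumpSum (hL.cadlag ω) ht hε hgε hgε' fun r hr => ?_
    by_cases hrε : ε < |jump L r ω|
    · exact hω r hr hrε
    · have hr' : |L r ω - Function.leftLim (fun t => L t ω) r| ≤ ε := not_lt.1 hrε
      simp only [hgε _ _ hr', hgε' _ hr']
      exact tendsto_const_nhds
  have hmeas : ∀ t ∈ TimeSet T, ∀ n, Measurable fun ω => jumpSum (fun t => L t ω) (g n) t := by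
    intro t ht n
    have := hL.measurable_jumpSum_indicator ht hO hε le_rfl (hm n)
    have hself : (outside ε).indicator (g n) = g n :=
      Set.indicator_eq_self.2 fun y hy => mem_outside.2 (not_le.1 fun h' => hy (hgε n y h'))
    rw [hself] at this
    exact this.mono (𝓕.le _) le_rfl
  have hc : Continuous fun x : ℝ => Complex.exp (Complex.I * x) := by fun_prop
  have h1 : Tendsto (fun n => ∫ ω in B, Complex.exp (Complex.I *
      ((jumpSum (fun t => L t ω) (g n) (s + h) - jumpSum (fun t => L t ω) (g n) s : ℝ) : ℂ)) ∂P)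
      atTop (𝓝 (∫ ω in B, Complex.exp (Complex.I *
      ((jumpSum (fun t => L t ω) g' (s + h) - jumpSum (fun t => L t ω) g' s : ℝ) : ℂ)) ∂P)) := by
    refine tendsto_integral_of_dominated_convergence (fun _ => 1) (fun n => ?_)
      (integrable_const _)
      (fun n => Eventually.of_forall fun ω => (norm_exp_I_mul_ofReal _).le) (ae_restrict_of_ae ?_)
    · exact (hc.measurable.comp ((hmeas _ ht n).sub
        (hmeas _ (timeSet_mono le_self_add ht) n))).aestronglyMeasurable
    · filter_upwards [hJ _ ht, hJ _ (timeSet_mono le_self_add ht)] with ω e1 e2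
      exact (hc.tendsto _).comp (e1.sub e2)
  have h2 : Tendsto (fun n => ∫ y in outside ε, (Complex.exp (Complex.I * g n y) - 1)
      ∂levyMeasure P T L) atTop (𝓝 (∫ y in outside ε, (Complex.exp (Complex.I * g' y) - 1)
      ∂levyMeasure P T L)) := by
    refine tendsto_integral_of_dominated_convergence (fun _ => 2)
      (fun n => (integrable_exp_I_mul_sub_one (hm n)).1) (integrable_const _)
      (fun n => Eventually.of_forall fun y => norm_exp_I_mul_ofReal_sub_one_le _) ?_
    filter_upwards [hlim] with y hy
    exact ((hc.tendsto _).comp hy).sub_const 1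
  refine tendsto_nhds_unique h1 ?_
  simp only [hg _ s h ht B hB]
  exact ((Complex.continuous_exp.tendsto _).comp (h2.const_mul (h : ℂ))).const_mul _

theorem hasJumpCharFun_of_integrableOn (hL : IsLevyProcess P 𝓕 T L) {ε : ℝ} (hε : 0 < ε)
    {g : ℝ → ℝ} (hg : Measurable g) (hgε : ∀ y, |y| ≤ ε → g y = 0)
    (hgi : IntegrableOn g (outside ε) (levyMeasure P T L)) :
    HasJumpCharFun P 𝓕 T L ε g := by
  have hfin := hL.isFiniteMeasure_restrict_levyMeasure hε (A := outside ε) le_rfl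
  have hO := isOpen_outside ε
  have hmem : MemLp g 1 ((levyMeasure P T L).restrict (outside ε)) :=
    memLp_one_iff_integrable.2 hgi
  choose c hc _ using fun n : ℕ => hmem.exists_boundedContinuous_eLpNorm_sub_le (by simp)
    (ε := ((n : ℝ≥0∞) + 1)⁻¹) (by simp)
  have hconv : Tendsto (fun n => eLpNorm ((fun n => (c n : ℝ → ℝ)) n - g) 1
      ((levyMeasure P T L).restrict (outside ε))) atTop (𝓝 0) := by
    have h0 : Tendsto (fun n : ℕ => ((n : ℝ≥0∞) + 1)⁻¹) atTop (𝓝 0) := by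
      have := ENNReal.tendsto_inv_nat_nhds_zero.comp (tendsto_add_atTop_nat 1)
      simpa [Function.comp_def] using this
    refine tendsto_of_tendsto_of_tendsto_of_le_of_le tendsto_const_nhds h0
      (fun _ => bot_le) fun n => ?_
    show eLpNorm ((c n : ℝ → ℝ) - g) 1 _ ≤ _
    rw [eLpNorm_sub_comm]
    exact hc n
  obtain ⟨ns, -, hns⟩ := (tendstoInMeasure_of_tendsto_eLpNorm one_ne_zero
    (fun n => (c n).continuous.aestronglyMeasurable) hg.aestronglyMeasurable
    hconv).exists_seq_tendsto_ae
  have h0 : ∀ y, |y| ≤ ε → y ∉ outside ε := fun y hy h => absurd h (not_lt.2 hy)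
  -- Bounded continuous functions are dense in `L¹`, and a subsequence converges almost everywhere.
  -- The factor `openApprox` makes the approximants vanish on `[-ε, ε]` and tends to `1` outside.
  refine HasJumpCharFun.of_tendsto hL hε
    (g := fun n y => c (ns n) y * openApprox (outside ε) n y) (fun n => ?_) (fun n => ?_)
    (fun n y hy => ?_) hgε ?_
  · refine hL.hasJumpCharFun_of_continuous hε
      ((c (ns n)).continuous.mul (continuous_openApprox _ n)) fun y hy => ?_
    rw [openApprox_eq_zero n (h0 y hy), mul_zero]
  · exact ((c (ns n)).continuous.mul (continuous_openApprox _ n)).measurable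
  · show _ * _ = _
    rw [openApprox_eq_zero n (h0 y hy), mul_zero]
  · filter_upwards [hns, ae_restrict_mem hO.measurableSet] with y hy hyO
    have := hy.mul (tendsto_openApprox hO ⟨0, h0 0 (by simpa using hε.le)⟩ y)
    rwa [Set.indicator_of_mem hyO, mul_one] at this

theorem hasJumpCharFun (hL : IsLevyProcess P 𝓕 T L) {ε : ℝ} (hε : 0 < ε)
    {g : ℝ → ℝ} (hg : Measurable g) (hgε : ∀ y, |y| ≤ ε → g y = 0) :
    HasJumpCharFun P 𝓕 T L ε g := by
  have hfin := hL.isFiniteMeasure_restrict_levyMeasure hε (A := outside ε) le_rfl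
  have hset : ∀ n : ℕ, MeasurableSet {y | |g y| ≤ n} := fun n =>
    measurableSet_le hg.abs measurable_const
  have h0 : ∀ (n : ℕ) y, |y| ≤ ε → {y | |g y| ≤ n}.indicator g y = 0 := fun n y hy => by
    rw [Set.indicator_apply_eq_zero]; exact fun _ => hgε y hy
  -- Truncation at level `n` makes the integrand bounded, hence integrable on `outside ε`.
  refine HasJumpCharFun.of_tendsto hL hε (g := fun n : ℕ => {y | |g y| ≤ n}.indicator g)
    (fun n => hL.hasJumpCharFun_of_integrableOn hε (hg.indicator (hset n)) (h0 n) ?_)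
    (fun n => hg.indicator (hset n)) h0 hgε (Eventually.of_forall fun y => ?_)
  · refine Integrable.of_bound (C := n) (hg.indicator (hset n)).aestronglyMeasurable
      (Eventually.of_forall fun y => ?_)
    by_cases hy : |g y| ≤ n
    · rw [Set.indicator_of_mem (by exact hy)]; exact hy
    · rw [Set.indicator_of_notMem (by exact hy)]; simp
  · refine Tendsto.congr' ?_ tendsto_const_nhds
    filter_upwards [tendsto_natCast_atTop_atTop.eventually_ge_atTop |g y|] with n hn
    exact (Set.indicator_of_mem (show y ∈ {y | |g y| ≤ n} from hn) g).symm

theorem setIntegral_exp_jumpIntegral (hL : IsLevyProcess P 𝓕 T L) {ε : ℝ} (hε : 0 < ε)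
    {A : Set ℝ} (hA : MeasurableSet A) (hAε : A ⊆ outside ε) {f : ℝ → ℝ} (hf : Measurable f)
    {s h : ℝ≥0} (ht : s + h ∈ TimeSet T) (v : ℝ) {B : Set Ω} (hB : MeasurableSet[𝓕 s] B) :
    ∫ ω in B, Complex.exp (Complex.I * v * ((jumpIntegral L A f (s + h) ω -
      jumpIntegral L A f s ω : ℝ) : ℂ)) ∂P =
      P.real B * Complex.exp (h * ∫ y in A, (Complex.exp (Complex.I * v * f y) - 1)
        ∂levyMeasure P T L) := by
  have hO := (isOpen_outside ε).measurableSet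
  have h1 := hL.hasJumpCharFun hε (g := A.indicator fun y => v * f y)
    ((hf.const_mul v).indicator hA) (fun y hy => Set.indicator_of_notMem
      (fun h => absurd (hAε h) (not_lt.2 hy)) _) s h ht B hB
  have h2 : ∀ t ∈ TimeSet T, ∀ ω, jumpSum (fun t => L t ω) (A.indicator fun y => v * f y) t =
      v * jumpIntegral L A f t ω := by
    intro t ht ω
    obtain ⟨S, hS, -⟩ := exists_restrict_jumpMeasure (hL.cadlag ω) ht hA hε hAε
    rw [jumpSum_indicator_eq_sum hS, show jumpIntegral L A f t ω =
      jumpSum (fun t => L t ω) (A.indicator f) t from rfl, jumpSum_indicator_eq_sum hS,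
      Finset.mul_sum]
  simp only [h2 _ ht, h2 _ (timeSet_mono le_self_add ht), ← mul_sub] at h1
  have h3 : (fun y => Complex.exp (Complex.I * ((A.indicator (fun y => v * f y) y : ℝ) : ℂ)) - 1) =
      A.indicator fun y => Complex.exp (Complex.I * v * f y) - 1 := by
    ext y
    by_cases hy : y ∈ A
    · simp [hy, mul_assoc]
    · simp [hy]
  rw [h3, setIntegral_indicator hA, Set.inter_eq_right.2 hAε] at h1
  rw [← h1]
  simp only [Complex.ofReal_mul, mul_assoc]

end IsLevyProcess

/-! ### The jump integral is a Lévy process and the jump count a Poisson process -/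

/-- Only finitely many terms are nonzero up to any admissible time, so just after and just before
`t` no new term enters. Eventual constancy needs no topology on `E`, so one statement serves real
sums and counts. -/
theorem jumpSum_eventually_const {E : Type*} [AddCommMonoid E] {T : ℝ≥0∞} {x : ℝ≥0 → ℝ}
    (hx : IsCadlagOn T x) {ε : ℝ} (hε : 0 < ε) {g : ℝ → E} (hg : ∀ y, |y| ≤ ε → g y = 0) :
    (∀ t : ℝ≥0, (t : ℝ≥0∞) < T → ∀ᶠ s in 𝓝[>] t, jumpSum x g s = jumpSum x g t) ∧
      ∀ t ∈ TimeSet T, ∃ l, ∀ᶠ s in 𝓝[<] t, jumpSum x g s = l := by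
  have key : ∀ u (hu : u ∈ TimeSet T), ∀ s ≤ u, jumpSum x g s =
      ∑ r ∈ (hx.finite_jumps hu hε).toFinset with r ≤ s, g (x r - Function.leftLim x r) := by
    intro u hu s hs
    refine jumpSum_eq_sum _ fun r hr h => ?_
    rw [Set.Finite.mem_toFinset]
    exact ⟨hr.trans hs, not_le.1 fun h' => h (hg _ h')⟩
  constructor
  · intro t ht
    obtain ⟨u, htu, huT⟩ := ENNReal.lt_iff_exists_nnreal_btwn.1 ht
    have hu : u ∈ TimeSet T := huT.le
    have htu' : t < u := by exact_mod_cast htu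
    have h1 : ∀ᶠ s in 𝓝[>] t, ∀ r ∈ (hx.finite_jumps hu hε).toFinset, r ≤ s → r ≤ t := by
      refine (Filter.eventually_all_finset _).2 fun r _ => ?_
      by_cases hr : r ≤ t
      · exact Eventually.of_forall fun _ _ => hr
      · filter_upwards [nhdsWithin_le_nhds (Iio_mem_nhds (not_le.1 hr))] with s hs h
        exact absurd h (not_le.2 hs)
    filter_upwards [h1, self_mem_nhdsWithin, nhdsWithin_le_nhds (Iio_mem_nhds htu')] with s h hs hsu
    rw [key u hu s (le_of_lt hsu), key u hu t htu'.le]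
    refine Finset.sum_congr (Finset.filter_congr fun r hr => ?_) fun _ _ => rfl
    exact ⟨h r hr, fun h' => h'.trans (le_of_lt hs)⟩
  · intro t ht
    refine ⟨∑ r ∈ (hx.finite_jumps ht hε).toFinset with r < t, g (x r - Function.leftLim x r), ?_⟩
    have h1 : ∀ᶠ s in 𝓝[<] t, ∀ r ∈ (hx.finite_jumps ht hε).toFinset, r < t → r ≤ s := by
      refine (Filter.eventually_all_finset _).2 fun r _ => ?_
      by_cases hr : r < t
      · filter_upwards [nhdsWithin_le_nhds (Ioi_mem_nhds hr)] with s hs _ using le_of_lt hs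
      · exact Eventually.of_forall fun _ h => absurd h hr
    filter_upwards [h1, self_mem_nhdsWithin] with s h hs
    rw [key t ht s (le_of_lt hs)]
    refine Finset.sum_congr (Finset.filter_congr fun r hr => ?_) fun _ _ => rfl
    exact ⟨fun h' => lt_of_le_of_lt h' hs, h r hr⟩

theorem isCadlagOn_comp_jumpSum {E : Type*} [AddCommMonoid E] {T : ℝ≥0∞} {x : ℝ≥0 → ℝ}
    (hx : IsCadlagOn T x) {ε : ℝ} (hε : 0 < ε) {g : ℝ → E} (hg : ∀ y, |y| ≤ ε → g y = 0)
    (F : E → ℝ) : IsCadlagOn T fun t => F (jumpSum x g t) := by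
  obtain ⟨h1, h2⟩ := jumpSum_eventually_const hx hε hg
  refine ⟨fun t ht => ?_, fun t ht => ?_⟩
  · refine Tendsto.congr' ?_ tendsto_const_nhds
    filter_upwards [h1 t ht] with s hs
    rw [hs]
  · obtain ⟨l, hl⟩ := h2 t ht
    refine ⟨F l, Tendsto.congr' ?_ tendsto_const_nhds⟩
    filter_upwards [hl] with s hs
    rw [hs]

/-- Taking `B = Ω` identifies `c` as the characteristic function of `D`. The law of `D` under
`P.restrict B` and `P B` times its law under `P` thus have equal characteristic functions and
coincide, which is independence. -/
theorem indep_of_setIntegral_exp {Ω : Type*} {m mΩ : MeasurableSpace Ω} {P : Measure Ω}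
    [IsProbabilityMeasure P] {D : Ω → ℝ} (hD : Measurable D) {c : ℝ → ℂ}
    (h : ∀ B, MeasurableSet[m] B → ∀ v : ℝ,
      ∫ ω in B, Complex.exp (Complex.I * v * D ω) ∂P = P.real B * c v) :
    Indep (MeasurableSpace.comap D inferInstance) m P := by
  have hc : ∀ v, c v = charFun (P.map D) v := by
    intro v
    have := h Set.univ MeasurableSet.univ v
    rw [setIntegral_univ, probReal_univ, Complex.ofReal_one, one_mul] at this
    rw [← this, charFun_apply_real, integral_map hD.aemeasurable
      (Measurable.aestronglyMeasurable (by fun_prop))]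
    congr 1
    ext ω
    ring_nf
  have hmap : ∀ B, MeasurableSet[m] B → (P.restrict B).map D = P B • P.map D := by
    intro B hB
    have : IsFiniteMeasure (P B • P.map D) := by
      have := Measure.isProbabilityMeasure_map (μ := P) hD.aemeasurable
      exact ⟨by simp⟩
    refine Measure.ext_of_charFun ?_
    ext v
    have h1 := h B hB v
    rw [hc] at h1
    have h2 : charFun (P B • P.map D) v = P.real B * charFun (P.map D) v := by
      rw [charFun_apply_real, charFun_apply_real, integral_smul_measure, Complex.real_smul,
        measureReal_def]
    rw [h2, ← h1, charFun_apply_real, integral_map hD.aemeasurable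
      (Measurable.aestronglyMeasurable (by fun_prop))]
    congr 1
    ext ω
    ring_nf
  rw [Indep_iff]
  rintro _ B ⟨C, hC, rfl⟩ hB
  have h1 := congrArg (fun μ => μ C) (hmap B hB)
  simp only [Measure.smul_apply, Measure.map_apply hD hC, Measure.restrict_apply (hD hC),
    smul_eq_mul] at h1
  rw [h1, mul_comm]

namespace IsLevyProcess

variable {Ω : Type*} {mΩ : MeasurableSpace Ω} {P : Measure Ω}
    {𝓕 : Filtration ℝ≥0 mΩ} {T : ℝ≥0∞} {L : ℝ≥0 → Ω → ℝ}

theorem adapted_jumpIntegral (hL : IsLevyProcess P 𝓕 T L) {ε : ℝ} (hε : 0 < ε)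
    {A : Set ℝ} (hA : MeasurableSet A) (hAε : A ⊆ outside ε) {f : ℝ → ℝ} (hf : Measurable f)
    {t : ℝ≥0} (ht : t ∈ TimeSet T) : Measurable[𝓕 t] (jumpIntegral L A f t) :=
  hL.measurable_jumpSum_indicator ht hA hε hAε hf

theorem measurable_jumpIntegral (hL : IsLevyProcess P 𝓕 T L) {ε : ℝ} (hε : 0 < ε)
    {A : Set ℝ} (hA : MeasurableSet A) (hAε : A ⊆ outside ε) {f : ℝ → ℝ} (hf : Measurable f)
    {t : ℝ≥0} (ht : t ∈ TimeSet T) : Measurable (jumpIntegral L A f t) :=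
  (hL.adapted_jumpIntegral hε hA hAε hf ht).mono (𝓕.le _) le_rfl

/-- The number of jumps with values in `A` up to time `t`. -/
noncomputable def _root_.jumpCount (L : ℝ≥0 → Ω → ℝ) (A : Set ℝ) (t : ℝ≥0) (ω : Ω) : ℕ :=
  jumpSum (fun t => L t ω) (A.indicator fun _ => 1) t

theorem natCast_jumpCount (hL : IsLevyProcess P 𝓕 T L) {ε : ℝ} (hε : 0 < ε)
    {A : Set ℝ} (hA : MeasurableSet A) (hAε : A ⊆ outside ε) {t : ℝ≥0} (ht : t ∈ TimeSet T)
    (ω : Ω) : (jumpCount L A t ω : ℝ) = jumpIntegral L A (fun _ => 1) t ω := by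
  obtain ⟨S, hS, -⟩ := exists_restrict_jumpMeasure (hL.cadlag ω) ht hA hε hAε
  rw [jumpCount, jumpSum_indicator_eq_sum hS]
  refine Eq.trans ?_ (jumpSum_indicator_eq_sum hS _).symm
  push_cast
  rfl

theorem monotone_jumpCount (hL : IsLevyProcess P 𝓕 T L) {ε : ℝ} (hε : 0 < ε)
    {A : Set ℝ} (hA : MeasurableSet A) (hAε : A ⊆ outside ε) {s t : ℝ≥0} (hst : s ≤ t)
    (ht : t ∈ TimeSet T) (ω : Ω) : jumpCount L A s ω ≤ jumpCount L A t ω := by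
  obtain ⟨S, hS, -⟩ := exists_restrict_jumpMeasure (hL.cadlag ω) ht hA hε hAε
  obtain ⟨S', hS', -⟩ :=
    exists_restrict_jumpMeasure (hL.cadlag ω) (timeSet_mono hst ht) hA hε hAε
  rw [jumpCount, jumpCount, jumpSum_indicator_eq_sum hS, jumpSum_indicator_eq_sum hS']
  refine Finset.sum_le_sum_of_subset fun r hr => (hS r).2
    ⟨((hS' r).1 hr).1.trans hst, ((hS' r).1 hr).2⟩

variable [IsProbabilityMeasure P]

theorem indep_jumpIntegral (hL : IsLevyProcess P 𝓕 T L) {ε : ℝ} (hε : 0 < ε)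
    {A : Set ℝ} (hA : MeasurableSet A) (hAε : A ⊆ outside ε) {f : ℝ → ℝ} (hf : Measurable f)
    {s t : ℝ≥0} (hst : s ≤ t) (ht : t ∈ TimeSet T) :
    Indep (MeasurableSpace.comap (fun ω => jumpIntegral L A f t ω - jumpIntegral L A f s ω)
      inferInstance) (𝓕 s) P := by
  obtain ⟨h, rfl⟩ := exists_add_of_le hst
  exact indep_of_setIntegral_exp ((hL.measurable_jumpIntegral hε hA hAε hf ht).sub
    (hL.measurable_jumpIntegral hε hA hAε hf (timeSet_mono hst ht)))
    fun B hB v => hL.setIntegral_exp_jumpIntegral hε hA hAε hf ht v hB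

theorem charFun_jumpIntegral (hL : IsLevyProcess P 𝓕 T L) {ε : ℝ} (hε : 0 < ε)
    {A : Set ℝ} (hA : MeasurableSet A) (hAε : A ⊆ outside ε) {f : ℝ → ℝ} (hf : Measurable f)
    {s h : ℝ≥0} (ht : s + h ∈ TimeSet T) (v : ℝ) :
    charFun (P.map fun ω => jumpIntegral L A f (s + h) ω - jumpIntegral L A f s ω) v =
      Complex.exp (h * ∫ y in A, (Complex.exp (Complex.I * v * f y) - 1)
        ∂levyMeasure P T L) := by
  have h1 := hL.setIntegral_exp_jumpIntegral hε hA hAε hf ht v MeasurableSet.univ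
  rw [setIntegral_univ, probReal_univ, Complex.ofReal_one, one_mul] at h1
  rw [charFun_apply_real, integral_map, ← h1]
  · congr 1
    ext ω
    ring_nf
  · exact ((hL.measurable_jumpIntegral hε hA hAε hf ht).sub
      (hL.measurable_jumpIntegral hε hA hAε hf (timeSet_mono le_self_add ht))).aemeasurable
  · exact Measurable.aestronglyMeasurable (by fun_prop)

theorem jumpIntegral_zero (L : ℝ≥0 → Ω → ℝ) {A : Set ℝ} (hA0 : (0 : ℝ) ∉ A) (f : ℝ → ℝ) (ω : Ω) :
    jumpIntegral L A f 0 ω = 0 :=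
  jumpSum_zero _ (Set.indicator_of_notMem hA0 _)

/-- The integral can only change if a jump in `A` occurs in `(s, s + h]`; the number of these has
mean `h * ν(A)`, and Markov's inequality applies. Stochastic continuity follows. -/
theorem measure_jumpIntegral_ne_le (hL : IsLevyProcess P 𝓕 T L) {ε : ℝ} (hε : 0 < ε)
    {A : Set ℝ} (hA : MeasurableSet A) (hAε : A ⊆ outside ε) (f : ℝ → ℝ)
    {s h : ℝ≥0} (ht : s + h ∈ TimeSet T) :
    P {ω | jumpIntegral L A f (s + h) ω ≠ jumpIntegral L A f s ω} ≤
      ENNReal.ofReal (h * (levyMeasure P T L).real A) := by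
  have hs := timeSet_mono le_self_add ht
  have hfin := hL.isFiniteMeasure_restrict_levyMeasure hε hAε
  have hi : IntegrableOn (fun _ => (1 : ℝ)) A (levyMeasure P T L) := integrable_const _
  have h1 := hL.integral_jumpSum_indicator hε hA hAε ht measurable_const hi
  have h2 := hL.integral_jumpSum_indicator hε hA hAε hs measurable_const hi
  set D : Ω → ℝ := fun ω => jumpSum (fun t => L t ω) (A.indicator fun _ => (1 : ℝ)) (s + h) -
    jumpSum (fun t => L t ω) (A.indicator fun _ => (1 : ℝ)) s with hD
  have hDint : Integrable D P := h1.1.sub h2.1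
  have hDval : ∫ ω, D ω ∂P = h * (levyMeasure P T L).real A := by
    rw [hD, integral_sub h1.1 h2.1, h1.2, h2.2]
    simp
    ring
  have hsub : ∀ ω, 0 ≤ D ω ∧
      (jumpIntegral L A f (s + h) ω ≠ jumpIntegral L A f s ω → 1 ≤ D ω) := by
    intro ω
    obtain ⟨S, hS, -⟩ := exists_restrict_jumpMeasure (hL.cadlag ω) ht hA hε hAε
    obtain ⟨S', hS', -⟩ := exists_restrict_jumpMeasure (hL.cadlag ω) hs hA hε hAε
    have hss : S' ⊆ S := fun r hr => (hS r).2
      ⟨((hS' r).1 hr).1.trans le_self_add, ((hS' r).1 hr).2⟩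
    have e1 : D ω = S.card - S'.card := by
      simp only [hD, jumpSum_indicator_eq_sum hS, jumpSum_indicator_eq_sum hS']
      simp
    have hcard := Finset.card_le_card hss
    refine ⟨by rw [e1, sub_nonneg]; exact_mod_cast hcard, fun hne => ?_⟩
    have hlt : S'.card < S.card := by
      refine lt_of_le_of_ne hcard fun h' => hne ?_
      have := Finset.eq_of_subset_of_card_le hss h'.ge
      subst this
      exact (jumpSum_indicator_eq_sum hS f).trans (jumpSum_indicator_eq_sum hS' f).symm
    rw [e1, le_sub_iff_add_le]
    exact_mod_cast (by omega : 1 + S'.card ≤ S.card)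
  have hmk := mul_meas_ge_le_integral_of_nonneg (Eventually.of_forall fun ω => (hsub ω).1) hDint 1
  rw [one_mul, hDval] at hmk
  refine (measure_mono (t := {ω | 1 ≤ D ω}) fun ω hω => (hsub ω).2 hω).trans ?_
  rw [← ofReal_measureReal (μ := P)]
  exact ENNReal.ofReal_le_ofReal hmk

theorem isLevyProcess_jumpIntegral (hL : IsLevyProcess P 𝓕 T L) {ε : ℝ} (hε : 0 < ε)
    {A : Set ℝ} (hA : MeasurableSet A) (hAε : A ⊆ outside ε) {f : ℝ → ℝ} (hf : Measurable f) :
    IsLevyProcess P 𝓕 T (jumpIntegral L A f) where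
  cadlag ω := isCadlagOn_comp_jumpSum (hL.cadlag ω) hε (g := A.indicator f)
    (fun _ hy => Set.indicator_of_notMem (fun h => absurd (hAε h) (not_lt.2 hy)) _) id
  adapted t ht := hL.adapted_jumpIntegral hε hA hAε hf ht
  zero := Eventually.of_forall fun ω => jumpIntegral_zero L
    (fun h => absurd (mem_outside.1 (hAε h)) (by simpa using hε.le)) f ω
  indep_increments s t hst ht := hL.indep_jumpIntegral hε hA hAε hf hst.le ht
  stationary_increments s t r ht hr := by
    refine @Measure.ext_of_charFun _ _ _ _ _ _ _ _ _ (Measure.isFiniteMeasure_map _ _)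
      (Measure.isFiniteMeasure_map _ _) ?_
    ext v
    rw [hL.charFun_jumpIntegral hε hA hAε hf ht, hL.charFun_jumpIntegral hε hA hAε hf hr]
  stochastically_continuous t ht δ hδ := by
    have hle : ∀ s ∈ TimeSet T, P {ω | δ < |jumpIntegral L A f t ω - jumpIntegral L A f s ω|} ≤
        ENNReal.ofReal (dist t s * (levyMeasure P T L).real A) := by
      intro s hs
      rcases le_total s t with hst | hst
      · obtain ⟨h, rfl⟩ := exists_add_of_le hst
        have hd : dist (s + h) s = h := by simp [NNReal.dist_eq]
        rw [hd]
        refine (measure_mono fun ω hω h' => ?_).trans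
          (hL.measure_jumpIntegral_ne_le hε hA hAε f ht)
        have hω' : δ < |_| := hω
        rw [h', sub_self, abs_zero] at hω'
        exact absurd hδ hω'.not_gt
      · obtain ⟨h, rfl⟩ := exists_add_of_le hst
        have hd : dist t (t + h) = h := by simp [NNReal.dist_eq]
        rw [hd]
        refine (measure_mono fun ω hω h' => ?_).trans
          (hL.measure_jumpIntegral_ne_le hε hA hAε f hs)
        have hω' : δ < |_| := hω
        rw [h', sub_self, abs_zero] at hω'
        exact absurd hδ hω'.not_gt
    have hlim : Tendsto (fun s => ENNReal.ofReal (dist t s * (levyMeasure P T L).real A))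
        (𝓝[TimeSet T] t) (𝓝 0) := by
      have : Continuous fun s => ENNReal.ofReal (dist t s * (levyMeasure P T L).real A) :=
        ENNReal.continuous_ofReal.comp (by fun_prop)
      have h' := this.tendsto t
      rw [dist_self, zero_mul, ENNReal.ofReal_zero] at h'
      exact h'.mono_left nhdsWithin_le_nhds
    refine tendsto_of_tendsto_of_tendsto_of_le_of_le' tendsto_const_nhds hlim
      (Eventually.of_forall fun _ => bot_le) ?_
    filter_upwards [self_mem_nhdsWithin] with s hs using hle s hs

theorem isPoissonProcess_jumpCount (hL : IsLevyProcess P 𝓕 T L) {ε : ℝ} (hε : 0 < ε)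
    {A : Set ℝ} (hA : MeasurableSet A) (hAε : A ⊆ outside ε) :
    IsPoissonProcess P 𝓕 T (levyMeasure P T L A).toNNReal (jumpCount L A) where
  cadlag ω := isCadlagOn_comp_jumpSum (hL.cadlag ω) hε
    (fun _ hy => Set.indicator_of_notMem (fun h => absurd (hAε h) (not_lt.2 hy)) _)
    (fun n : ℕ => (n : ℝ))
  adapted t ht := by
    have h1 := hL.adapted_jumpIntegral hε hA hAε (f := fun _ => 1) measurable_const ht
    have h2 : jumpCount L A t = fun ω => ⌊jumpIntegral L A (fun _ => 1) t ω⌋₊ := by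
      ext ω
      rw [← hL.natCast_jumpCount hε hA hAε ht, Nat.floor_natCast]
    rw [h2]
    exact Nat.measurable_floor.comp h1
  zero ω := jumpSum_zero _ (Set.indicator_of_notMem
    (fun h => absurd (mem_outside.1 (hAε h)) (by simpa using hε.le)) _)
  indep_increments s t hst ht := by
    simp only [hL.natCast_jumpCount hε hA hAε ht,
      hL.natCast_jumpCount hε hA hAε (timeSet_mono hst.le ht)]
    exact hL.indep_jumpIntegral hε hA hAε measurable_const hst.le ht
  poisson_increments s t hst ht := by
    obtain ⟨h, rfl⟩ := exists_add_of_le hst.le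
    simp only [hL.natCast_jumpCount hε hA hAε ht,
      hL.natCast_jumpCount hε hA hAε (timeSet_mono hst.le ht)]
    refine @Measure.ext_of_charFun _ _ _ _ _ _ _ _ _ (Measure.isFiniteMeasure_map _ _)
      (Measure.isFiniteMeasure_map _ _) ?_
    ext v
    rw [hL.charFun_jumpIntegral hε hA hAε measurable_const ht, charFun_map_cast_poissonMeasure,
      add_tsub_cancel_left]
    congr 1
    simp only [Complex.ofReal_one, mul_one, setIntegral_const, Complex.real_smul]
    simp only [measureReal_def]
    push_cast
    rw [mul_comm Complex.I]
    simp [ENNReal.toReal]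
    ring

end IsLevyProcess

/-! ### Equality in law through increments -/

/-- Summation by parts, inserting the times in increasing order. The clause on `t n` keeps the final
time among the given ones, hence within the horizon. -/
theorem exists_sum_eq_sum_increments {ι : Type*} (τ : ι → ℝ≥0) (u : ι → ℝ) (I : Finset ι) :
    ∃ (n : ℕ) (t : ℕ → ℝ≥0) (w : ℕ → ℝ), Monotone t ∧ t 0 = 0 ∧ (t n = 0 ∨ ∃ i ∈ I, t n = τ i) ∧
      ∀ z : ℝ≥0 → ℝ, z 0 = 0 →
        ∑ i ∈ I, u i * z (τ i) = ∑ k ∈ Finset.range n, w k * (z (t (k + 1)) - z (t k)) := by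
  classical
  induction I using Finset.induction_on_max_value τ with
  | empty => exact ⟨0, fun _ => 0, fun _ => 0, monotone_const, rfl, Or.inl rfl, by simp⟩
  | insert a I ha hmax ih =>
    obtain ⟨n, t, w, ht, ht0, htn, hsum⟩ := ih
    have hle : t n ≤ τ a := by
      rcases htn with h | ⟨i, hi, h⟩
      · rw [h]; exact bot_le
      · rw [h]; exact hmax i hi
    -- Since `z 0 = 0`, the value at the new, largest time is the sum of all increments, so `u a` is
    -- added to every weight.
    refine ⟨n + 1, fun k => if k ≤ n then t k else τ a, fun k => (if k < n then w k else 0) + u a,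
      monotone_nat_of_le_succ fun k => ?_, by simp [ht0],
      Or.inr ⟨a, Finset.mem_insert_self _ _, by simp⟩, fun z hz => ?_⟩
    · rcases lt_trichotomy k n with h | rfl | h
      · simp only [h.le, Nat.succ_le_of_lt h, if_true]
        exact ht k.le_succ
      · simpa using hle
      · have h1 : ¬ k ≤ n := by omega
        have h2 : ¬ k + 1 ≤ n := by omega
        simp [h1, h2]
    · rw [Finset.sum_insert ha, hsum z hz, Finset.sum_range_succ]
      have e1 : ∀ k ∈ Finset.range n, ((if k < n then w k else 0) + u a) *
          (z (if k + 1 ≤ n then t (k + 1) else τ a) - z (if k ≤ n then t k else τ a)) =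
          w k * (z (t (k + 1)) - z (t k)) + u a * (z (t (k + 1)) - z (t k)) := by
        intro k hk
        have hk := Finset.mem_range.1 hk
        rw [if_pos hk, if_pos (show k + 1 ≤ n by omega), if_pos hk.le, add_mul]
      rw [Finset.sum_congr rfl e1, Finset.sum_add_distrib, ← Finset.mul_sum,
        Finset.sum_range_sub (fun k => z (t k)), ht0, hz]
      simp
      ring

/-- Two processes starting in `0` have the same law if the joint characteristic functions of their
successive increments agree. -/
theorem identDistrib_of_increments {Ω Ω' : Type*} {mΩ : MeasurableSpace Ω}
    {mΩ' : MeasurableSpace Ω'} {P : Measure Ω} {P' : Measure Ω'} [IsProbabilityMeasure P]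
    [IsProbabilityMeasure P'] {T : ℝ≥0∞} {Z : ℝ≥0 → Ω → ℝ} {Z' : ℝ≥0 → Ω' → ℝ}
    (hZ : ∀ t ∈ TimeSet T, Measurable (Z t)) (hZ' : ∀ t ∈ TimeSet T, Measurable (Z' t))
    (h0 : ∀ ω, Z 0 ω = 0) (h0' : ∀ ω, Z' 0 ω = 0)
    (h : ∀ (n : ℕ) (t : ℕ → ℝ≥0) (w : ℕ → ℝ), Monotone t → t 0 = 0 → t n ∈ TimeSet T →
      ∫ ω, Complex.exp (Complex.I * ((∑ k ∈ Finset.range n,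
        w k * (Z (t (k + 1)) ω - Z (t k) ω) : ℝ) : ℂ)) ∂P =
      ∫ ω, Complex.exp (Complex.I * ((∑ k ∈ Finset.range n,
        w k * (Z' (t (k + 1)) ω - Z' (t k) ω) : ℝ) : ℂ)) ∂P') :
    IdentDistrib (fun ω (t : TimeSet T) => Z t ω) (fun ω (t : TimeSet T) => Z' t ω) P P' := by
  have hm : Measurable fun ω (t : TimeSet T) => Z t ω := measurable_pi_lambda _ fun t => hZ t t.2
  have hm' : Measurable fun ω (t : TimeSet T) => Z' t ω :=
    measurable_pi_lambda _ fun t => hZ' t t.2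
  refine ⟨hm.aemeasurable, hm'.aemeasurable, ?_⟩
  have hp := isProjectiveLimit_map (P := P) (X := fun (t : TimeSet T) ω => Z t ω) hm.aemeasurable
  have hp' := isProjectiveLimit_map (P := P') (X := fun (t : TimeSet T) ω => Z' t ω)
    hm'.aemeasurable
  have hI : ∀ I : Finset (TimeSet T), Measurable fun ω => I.restrict fun t : TimeSet T => Z t ω :=
    fun I => (Finset.measurable_restrict I).comp hm
  have hI' : ∀ I : Finset (TimeSet T), Measurable fun ω => I.restrict fun t : TimeSet T => Z' t ω :=
    fun I => (Finset.measurable_restrict I).comp hm'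
  -- A linear functional of finitely many values is a weighted sum of successive increments, so the
  -- hypothesis determines the finite-dimensional laws, and these determine the law of the process.
  have heq : (fun I : Finset (TimeSet T) => P.map fun ω => I.restrict fun t : TimeSet T => Z t ω) =
      fun I => P'.map fun ω => I.restrict fun t : TimeSet T => Z' t ω := by
    ext1 I
    refine @Measure.ext_of_charFunDual _ _ _ _ _ _ _ _ _ (Measure.isFiniteMeasure_map _ _)
      (Measure.isFiniteMeasure_map _ _) ?_
    ext ℓ
    obtain ⟨a, hℓ⟩ : ∃ a : I → ℝ, ∀ x, ℓ x = ∑ i, a i * x i := by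
      refine ⟨fun i => ℓ fun j => if i = j then 1 else 0, fun x => ?_⟩
      have := LinearMap.pi_apply_eq_sum_univ (ℓ : (I → ℝ) →ₗ[ℝ] ℝ) x
      simp only [ContinuousLinearMap.coe_coe, smul_eq_mul] at this
      rw [this]
      exact Finset.sum_congr rfl fun i _ => mul_comm _ _
    obtain ⟨n, t, w, ht, ht0, htn, hsum⟩ := exists_sum_eq_sum_increments
      (fun i : I => (i.1.1 : ℝ≥0)) a Finset.univ
    have htT : t n ∈ TimeSet T := by
      rcases htn with h | ⟨i, -, h⟩
      · rw [h]; exact timeSet_mono bot_le (min_one_toNNReal_mem_timeSet T)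
      · rw [h]; exact i.1.2
    rw [charFunDual_apply, charFunDual_apply, integral_map (hI I).aemeasurable
      (Measurable.aestronglyMeasurable (by fun_prop)), integral_map (hI' I).aemeasurable
      (Measurable.aestronglyMeasurable (by fun_prop))]
    have e1 : ∀ ω, ℓ (I.restrict fun t : TimeSet T => Z t ω) = ∑ i, a i * Z i.1.1 ω := fun ω => hℓ _
    have e2 : ∀ ω, ℓ (I.restrict fun t : TimeSet T => Z' t ω) = ∑ i, a i * Z' i.1.1 ω := fun ω =>
      hℓ _
    have e := h n t w ht ht0 htT
    have s1 : ∀ ω, ∑ k ∈ Finset.range n, w k * (Z (t (k + 1)) ω - Z (t k) ω) =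
      ∑ i, a i * Z i.1.1 ω := fun ω => (hsum (fun s => Z s ω) (h0 ω)).symm
    have s2 : ∀ ω, ∑ k ∈ Finset.range n, w k * (Z' (t (k + 1)) ω - Z' (t k) ω) =
      ∑ i, a i * Z' i.1.1 ω := fun ω => (hsum (fun s => Z' s ω) (h0' ω)).symm
    simp only [s1, s2] at e
    refine (integral_congr_ae (Eventually.of_forall fun ω => ?_)).trans (e.trans
      (integral_congr_ae (Eventually.of_forall fun ω => ?_)))
    · show Complex.exp (((ℓ (I.restrict fun t : TimeSet T => Z t ω) : ℝ) : ℂ) * _) = _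
      rw [e1, mul_comm]
    · show _ = Complex.exp (((ℓ (I.restrict fun t : TimeSet T => Z' t ω) : ℝ) : ℂ) * _)
      rw [e2, mul_comm]
  have hfin : ∀ I : Finset (TimeSet T), IsFiniteMeasure
      (P.map fun ω => I.restrict fun t : TimeSet T => Z t ω) := fun I =>
    Measure.isFiniteMeasure_map _ _
  have hp2 : IsProjectiveLimit (P'.map fun ω (t : TimeSet T) => Z' t ω)
      (fun I : Finset (TimeSet T) => P.map fun ω => I.restrict fun t : TimeSet T => Z t ω) := by
    rw [heq]; exact hp'
  exact hp.unique hp2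

/-- A sum over consecutive blocks with weights constant on each block, as a single weighted sum. -/
theorem exists_weights_of_blocks {N : ℕ → ℕ} (hN : Monotone N) (h0 : N 0 = 0) (w : ℕ → ℝ)
    (φ : ℝ → ℂ) (m : ℕ) :
    ∃ c : ℕ → ℝ, (∀ j : ℕ → ℝ, ∑ k ∈ Finset.range m,
        w k * (∑ l ∈ Finset.range (N (k + 1)), j l - ∑ l ∈ Finset.range (N k), j l) =
        ∑ l ∈ Finset.range (N m), c l * j l) ∧
      ∏ l ∈ Finset.range (N m), φ (c l) =
        ∏ k ∈ Finset.range m, φ (w k) ^ (N (k + 1) - N k) := by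
  induction m with
  | zero => exact ⟨fun _ => 0, by simp [h0], by simp [h0]⟩
  | succ m ih =>
    obtain ⟨c, hc1, hc2⟩ := ih
    have hle : N m ≤ N (m + 1) := hN m.le_succ
    have hlow : ∀ l ∈ Finset.range (N m), (if l < N m then c l else w m) = c l := fun l hl =>
      if_pos (Finset.mem_range.1 hl)
    have hhigh : ∀ l ∈ Finset.Ico (N m) (N (m + 1)), (if l < N m then c l else w m) = w m :=
      fun l hl => if_neg (not_lt.2 (Finset.mem_Ico.1 hl).1)
    refine ⟨fun l => if l < N m then c l else w m, fun j => ?_, ?_⟩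
    · rw [Finset.sum_range_succ, hc1, ← Finset.sum_range_add_sum_Ico (fun l => j l) hle,
        ← Finset.sum_range_add_sum_Ico (fun l => (if l < N m then c l else w m) * j l) hle, add_sub_cancel_left, Finset.mul_sum]
      exact congrArg₂ _ (Finset.sum_congr rfl fun l hl => by simp only [hlow l hl])
        (Finset.sum_congr rfl fun l hl => by simp only [hhigh l hl])
    · rw [Finset.prod_range_succ, ← hc2, ← Finset.prod_range_mul_prod_Ico _ hle]
      refine congrArg₂ _ (Finset.prod_congr rfl fun l hl => by simp only [hlow l hl]) ?_
      rw [Finset.prod_congr rfl (g := fun _ => φ (w m)) fun l hl => by simp only [hhigh l hl]]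
      simp

theorem integral_exp_sum_infinitePi (F : Measure ℝ) [IsProbabilityMeasure F] (c : ℕ → ℝ) (n : ℕ) :
    ∫ j, Complex.exp (Complex.I * ((∑ l ∈ Finset.range n, c l * j l : ℝ) : ℂ))
      ∂(Measure.infinitePi fun _ : ℕ => F) =
    ∏ l ∈ Finset.range n, ∫ x, Complex.exp (Complex.I * c l * x) ∂F := by
  have hind : iIndepFun (fun (l : ℕ) (j : ℕ → ℝ) => j l) (Measure.infinitePi fun _ : ℕ => F) :=
    iIndepFun_infinitePi (X := fun _ x => x) fun _ => measurable_id
  have hfin : iIndepFun (fun (l : Fin n) (j : ℕ → ℝ) => j l) (Measure.infinitePi fun _ : ℕ => F) :=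
    hind.precomp Fin.val_injective
  have h1 := iIndepFun.integral_fun_prod_comp (𝓧 := fun _ : Fin n => ℝ)
    (X := fun (l : Fin n) (j : ℕ → ℝ) => j l) hfin
    (𝕜 := ℂ) (f := fun (l : Fin n) x => Complex.exp (Complex.I * c l * x))
    (fun l : Fin n => (measurable_pi_apply (l : ℕ)).aemeasurable)
    (fun l => (Measurable.aestronglyMeasurable (by fun_prop)))
  have h2 : ∀ l : ℕ, ∫ j : ℕ → ℝ, Complex.exp (Complex.I * c l * j l)
      ∂(Measure.infinitePi fun _ : ℕ => F) = ∫ x, Complex.exp (Complex.I * c l * x) ∂F := by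
    intro l
    have := (measurePreserving_eval_infinitePi (fun _ : ℕ => F) l).map_eq
    conv_rhs => rw [← this]
    rw [integral_map (measurable_pi_apply l).aemeasurable
      (Measurable.aestronglyMeasurable (by fun_prop))]
  simp only [h2] at h1
  rw [Finset.prod_range, ← h1]
  congr 1
  ext j
  rw [Finset.sum_range, ← Complex.exp_sum]
  congr 1
  push_cast
  rw [Finset.mul_sum]
  exact Finset.sum_congr rfl fun l _ => by ring

theorem integral_pow_poissonMeasure (r : ℝ≥0) (z : ℂ) :
    ∫ n, z ^ n ∂poissonMeasure r = Complex.exp (r * (z - 1)) := by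
  rw [integral_poissonMeasure]
  have h : ∀ n : ℕ, ((Real.exp (-r) * r ^ n / (n.factorial : ℝ) : ℝ)) • z ^ n =
      Complex.exp (-r) * ((r * z) ^ n / (n.factorial : ℂ)) := by
    intro n
    rw [Complex.real_smul]
    push_cast
    rw [mul_pow]
    ring
  simp only [h]
  rw [tsum_mul_left, ← congrFun (NormedSpace.exp_eq_tsum_div (𝔸 := ℂ)) (r * z),
    ← Complex.exp_eq_exp_ℂ, ← Complex.exp_add]
  congr 1
  ring

namespace IsPoissonProcess

variable {Ω : Type*} {mΩ : MeasurableSpace Ω} {P : Measure Ω}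
    {𝓕 : Filtration ℝ≥0 mΩ} {T : ℝ≥0∞} {r : ℝ≥0} {N : ℝ≥0 → Ω → ℕ}

theorem measurable (hN : IsPoissonProcess P 𝓕 T r N) {t : ℝ≥0} (ht : t ∈ TimeSet T) :
    Measurable (N t) := (hN.adapted t ht).mono (𝓕.le _) le_rfl

/-- A Poisson process remains one after an independent enlargement of the probability space. -/
theorem comp_fst {Ω' : Type*} {mΩ' : MeasurableSpace Ω'} (hN : IsPoissonProcess P 𝓕 T r N)
    (Q : Measure Ω') [IsProbabilityMeasure Q] :
    ∃ 𝓖 : Filtration ℝ≥0 (mΩ.prod mΩ'),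
      IsPoissonProcess (P.prod Q) 𝓖 T r fun t p => N t p.1 := by
  have hfst := measurePreserving_fst (μ := P) (ν := Q)
  refine ⟨{ seq := fun t => (𝓕 t).comap Prod.fst
            mono' := fun s t hst => MeasurableSpace.comap_mono (𝓕.mono hst)
            le' := fun t => (MeasurableSpace.comap_mono (𝓕.le t)).trans
              measurable_fst.comap_le }, ?_⟩
  have hm : ∀ s t, s < t → t ∈ TimeSet T → Measurable fun ω => (N t ω : ℝ) - N s ω :=
    fun s t hst ht =>
      ((measurable_from_nat (f := fun m : ℕ => (m : ℝ))).comp (hN.measurable ht)).sub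
      ((measurable_from_nat (f := fun m : ℕ => (m : ℝ))).comp
        (hN.measurable (timeSet_mono hst.le ht)))
  refine ⟨fun p => hN.cadlag p.1, fun t ht => ?_, fun p => hN.zero p.1, fun s t hst ht => ?_,
    fun s t hst ht => ?_⟩
  · exact (hN.adapted t ht).comp (comap_measurable Prod.fst)
  · rw [Indep_iff]
    rintro _ _ ⟨C, hC, rfl⟩ ⟨B, hB, rfl⟩
    have h1 := (Indep_iff _ _ _).1 (hN.indep_increments s t hst ht) _ B ⟨C, hC, rfl⟩ hB
    have hC' : MeasurableSet ((fun ω => (N t ω : ℝ) - N s ω) ⁻¹' C) := hm s t hst ht hC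
    have hB' : MeasurableSet B := 𝓕.le s B hB
    change (P.prod Q) (Prod.fst ⁻¹' (((fun ω => (N t ω : ℝ) - N s ω) ⁻¹' C) ∩ B)) =
      (P.prod Q) (Prod.fst ⁻¹' ((fun ω => (N t ω : ℝ) - N s ω) ⁻¹' C)) *
        (P.prod Q) (Prod.fst ⁻¹' B)
    rw [hfst.measure_preimage (hC'.inter hB').nullMeasurableSet,
      hfst.measure_preimage hC'.nullMeasurableSet, hfst.measure_preimage hB'.nullMeasurableSet, h1]
  · rw [← hN.poisson_increments s t hst ht]
    conv_rhs => rw [← hfst.map_eq]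
    rw [Measure.map_map (hm s t hst ht) measurable_fst]
    rfl

variable [IsProbabilityMeasure P]

theorem map_eq (hN : IsPoissonProcess P 𝓕 T r N) {s t : ℝ≥0} (hst : s ≤ t) (ht : t ∈ TimeSet T) :
    P.map (fun ω => (N t ω : ℝ) - N s ω) =
      (poissonMeasure (r * (t - s))).map (Nat.cast : ℕ → ℝ) := by
  rcases hst.lt_or_eq with h | rfl
  · exact hN.poisson_increments s t h ht
  · refine @Measure.ext_of_charFun _ _ _ _ _ _ _ _ _ (Measure.isFiniteMeasure_map _ _)
      (Measure.isFiniteMeasure_map _ _) ?_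
    ext v
    rw [charFun_map_cast_poissonMeasure, charFun_apply_real]
    simp

/-- Monotone paths make the truncated subtraction in the exponent a true increment, recovered from
the real one by the floor. Each factor is then the generating function of a Poisson law. -/
theorem setIntegral_prod_pow (hN : IsPoissonProcess P 𝓕 T r N)
    (hmono : ∀ ω, ∀ s t, s ≤ t → t ∈ TimeSet T → N s ω ≤ N t ω) {t : ℕ → ℝ≥0} (ht : Monotone t)
    {n : ℕ} (hn : t n ∈ TimeSet T) (z : ℕ → ℂ) :
    ∫ ω, ∏ k ∈ Finset.range n, z k ^ (N (t (k + 1)) ω - N (t k) ω) ∂P =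
      ∏ k ∈ Finset.range n, Complex.exp (r * (t (k + 1) - t k) * (z k - 1)) := by
  have hG : ∀ k, Measurable fun x : ℝ => z k ^ ⌊x⌋₊ := fun k =>
    (measurable_from_nat (f := fun m => z k ^ m)).comp Nat.measurable_floor
  have h1 := setIntegral_prod_increments (P := P) (𝓕 := 𝓕) (T := T) (𝕜 := ℂ)
    (Z := fun t ω => (N t ω : ℝ)) (G := fun k x => z k ^ ⌊x⌋₊)
    (fun t ht => (measurable_from_nat (f := fun m : ℕ => (m : ℝ))).comp (hN.adapted t ht))
    hN.indep_increments ht hn hG MeasurableSet.univ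
  have hfloor : ∀ k < n, ∀ ω, ⌊(N (t (k + 1)) ω : ℝ) - N (t k) ω⌋₊ =
      N (t (k + 1)) ω - N (t k) ω := by
    intro k hk ω
    rw [← Nat.cast_sub (hmono ω _ _ (ht k.le_succ) (timeSet_mono (ht (Nat.succ_le_of_lt hk)) hn)),
      Nat.floor_natCast]
  rw [setIntegral_univ, probReal_univ] at h1
  have e1 : ∀ ω, ∏ k ∈ Finset.range n, z k ^ ⌊(N (t (k + 1)) ω : ℝ) - N (t k) ω⌋₊ =
      ∏ k ∈ Finset.range n, z k ^ (N (t (k + 1)) ω - N (t k) ω) := fun ω =>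
    Finset.prod_congr rfl fun k hk => by rw [hfloor k (Finset.mem_range.1 hk) ω]
  simp only [e1] at h1
  rw [h1]
  simp only [RCLike.ofReal_one, one_mul]
  refine Finset.prod_congr rfl fun k hk => ?_
  have hk := Finset.mem_range.1 hk
  have hk1 : t (k + 1) ∈ TimeSet T := timeSet_mono (ht (Nat.succ_le_of_lt hk)) hn
  have hm : Measurable fun ω => (N (t (k + 1)) ω : ℝ) - N (t k) ω :=
    ((measurable_from_nat (f := fun m : ℕ => (m : ℝ))).comp (hN.measurable hk1)).sub
      ((measurable_from_nat (f := fun m : ℕ => (m : ℝ))).comp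
        (hN.measurable (timeSet_mono (ht k.le_succ) hk1)))
  rw [← integral_map (f := fun x : ℝ => z k ^ ⌊x⌋₊) hm.aemeasurable (hG k).aestronglyMeasurable,
    hN.map_eq (ht k.le_succ) hk1,
    integral_map measurable_from_nat.aemeasurable (hG k).aestronglyMeasurable]
  simp only [Nat.floor_natCast]
  rw [integral_pow_poissonMeasure]
  congr 2
  rw [← Complex.ofReal_sub, ← NNReal.coe_sub (ht k.le_succ)]
  push_cast
  rfl

end IsPoissonProcess

/-- Normalization; for `μ = 0` the intensity is `0` and the jump law is arbitrary, so a Dirac mass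
at `0` is taken. -/
theorem exists_isProbabilityMeasure_eq_smul (μ : Measure ℝ) [IsFiniteMeasure μ] :
    ∃ F : Measure ℝ, IsProbabilityMeasure F ∧ μ = (μ Set.univ).toNNReal • F ∧
      (MemLp id 2 μ → MemLp id 2 F) := by
  by_cases h : μ Set.univ = 0
  · exact ⟨Measure.dirac 0, inferInstance, by simp [Measure.measure_univ_eq_zero.1 h],
      fun _ => (MemLp.zero (p := 2)).ae_eq (ae_eq_dirac (f := id)).symm⟩
  · have hne : (μ Set.univ).toNNReal ≠ 0 := by
      simp [ENNReal.toNNReal_eq_zero_iff, h, measure_ne_top]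
    refine ⟨(μ Set.univ).toNNReal⁻¹ • μ, ⟨?_⟩, ?_, fun h2 => h2.smul_measure (c := ((μ Set.univ).toNNReal⁻¹ : ℝ≥0)) (by simp)⟩
    · rw [Measure.smul_apply, ENNReal.smul_def, ENNReal.coe_inv hne,
        ENNReal.coe_toNNReal (measure_ne_top _ _), smul_eq_mul,
        ENNReal.inv_mul_cancel h (measure_ne_top _ _)]
    · rw [smul_smul, mul_inv_cancel₀ hne, one_smul]

/-! ### Moments and characteristic functions of random sums -/

/-- This is `E[N g(N)] = r E[g(N + 1)]` for `N` Poisson, an index shift using `n / n! = 1 / (n -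
1)!`. The choices `g = 1` and `g(n) = n` yield the first two moments. -/
theorem hasSum_poisson_mul {r s : ℝ} {g : ℕ → ℝ}
    (h : HasSum (fun n : ℕ => Real.exp (-r) * r ^ n / n.factorial * g (n + 1)) s) :
    HasSum (fun n : ℕ => Real.exp (-r) * r ^ n / n.factorial * (n * g n)) (r * s) := by
  rw [← hasSum_nat_add_iff' 1]
  simp only [Finset.range_one, Finset.sum_singleton, Nat.cast_zero, zero_mul, mul_zero, sub_zero]
  have he : ∀ n : ℕ, Real.exp (-r) * r ^ (n + 1) / (n + 1).factorial *
      ((n + 1 : ℕ) * g (n + 1)) = r * (Real.exp (-r) * r ^ n / n.factorial * g (n + 1)) := by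
    intro n
    rw [Nat.factorial_succ]
    push_cast
    field_simp
    ring
  simpa only [he] using h.mul_left r

theorem integral_poissonMeasure_of_hasSum {r : ℝ≥0} {g : ℕ → ℝ} {s : ℝ} (hg : ∀ n, 0 ≤ g n)
    (h : HasSum (fun n : ℕ => Real.exp (-r) * r ^ n / n.factorial * g n) s) :
    Integrable g (poissonMeasure r) ∧ ∫ n, g n ∂poissonMeasure r = s := by
  refine ⟨integrable_poissonMeasure_iff.2 ?_, ?_⟩
  · simpa only [Real.norm_of_nonneg (hg _)] using h.summable
  · rw [integral_poissonMeasure]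
    simpa only [smul_eq_mul] using h.tsum_eq

theorem integral_natCast_poissonMeasure (r : ℝ≥0) :
    Integrable (fun n : ℕ => (n : ℝ)) (poissonMeasure r) ∧
      ∫ n, (n : ℝ) ∂poissonMeasure r = r := by
  refine integral_poissonMeasure_of_hasSum (fun n => n.cast_nonneg) ?_
  have h := hasSum_poisson_mul (r := r) (g := fun _ => 1) (s := 1)
    (by simpa only [mul_one] using hasSum_one_poissonMeasure r)
  simpa only [mul_one] using h

theorem integral_natCast_sq_poissonMeasure (r : ℝ≥0) :
    Integrable (fun n : ℕ => (n : ℝ) ^ 2) (poissonMeasure r) ∧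
      ∫ n, (n : ℝ) ^ 2 ∂poissonMeasure r = r + r ^ 2 := by
  refine integral_poissonMeasure_of_hasSum (fun n => sq_nonneg _) ?_
  have h0 := hasSum_one_poissonMeasure r
  have h1 := hasSum_poisson_mul (r := r) (g := fun _ => 1) (s := 1) (by simpa only [mul_one] using h0)
  have h2 := hasSum_poisson_mul (r := r) (g := fun n => (n : ℝ)) (s := r + 1) (by
    convert (h1.add h0) using 1
    · ext n; push_cast; ring
    · ring)
  convert h2 using 1
  · ext n; ring
  · ring

section RandomSum

variable {Ω : Type*} {mΩ : MeasurableSpace Ω} {P : Measure Ω} [IsProbabilityMeasure P]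
  (F : Measure ℝ) [IsProbabilityMeasure F]

theorem measurable_randomSum {N : Ω → ℕ} (hN : Measurable N) :
    Measurable fun p : Ω × (ℕ → ℝ) => ∑ k ∈ Finset.range (N p.1), p.2 k := by
  have h : Measurable fun q : ℕ × (ℕ → ℝ) => ∑ k ∈ Finset.range q.1, q.2 k :=
    measurable_from_prod_countable_right fun n => by
      show Measurable fun j : ℕ → ℝ => ∑ k ∈ Finset.range n, j k
      fun_prop
  exact h.comp ((hN.comp measurable_fst).prodMk measurable_snd)

theorem moments_sum_infinitePi (hF : MemLp id 2 F) (n : ℕ) :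
    MemLp (fun j : ℕ → ℝ => ∑ k ∈ Finset.range n, j k) 2 (Measure.infinitePi fun _ : ℕ => F) ∧
    ∫ j, ∑ k ∈ Finset.range n, j k ∂(Measure.infinitePi fun _ : ℕ => F) = n * ∫ x, x ∂F ∧
    ∫ j, (∑ k ∈ Finset.range n, j k) ^ 2 ∂(Measure.infinitePi fun _ : ℕ => F) =
      n * (∫ x, x ^ 2 ∂F - (∫ x, x ∂F) ^ 2) + n ^ 2 * (∫ x, x ∂F) ^ 2 := by
  have hmp := fun k : ℕ => measurePreserving_eval_infinitePi (fun _ : ℕ => F) k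
  have hk : ∀ k : ℕ, MemLp (fun j : ℕ → ℝ => j k) 2 (Measure.infinitePi fun _ : ℕ => F) :=
    fun k => hF.comp_measurePreserving (hmp k)
  have hmem : MemLp (fun j : ℕ → ℝ => ∑ k ∈ Finset.range n, j k) 2
      (Measure.infinitePi fun _ : ℕ => F) := memLp_finsetSum _ fun k _ => hk k
  have hmean : ∫ j, ∑ k ∈ Finset.range n, j k ∂(Measure.infinitePi fun _ : ℕ => F) =
      n * ∫ x, x ∂F := by
    rw [integral_finsetSum _ fun k _ => (hk k).integrable one_le_two]
    have : ∀ k, ∫ j : ℕ → ℝ, j k ∂(Measure.infinitePi fun _ : ℕ => F) = ∫ x, x ∂F := fun k => by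
      conv_rhs => rw [← (hmp k).map_eq]
      exact (integral_map (hmp k).measurable.aemeasurable
        measurable_id.aestronglyMeasurable).symm
    simp [this]
  refine ⟨hmem, hmean, ?_⟩
  have hind : iIndepFun (fun (l : ℕ) (j : ℕ → ℝ) => j l) (Measure.infinitePi fun _ : ℕ => F) :=
    iIndepFun_infinitePi (X := fun _ x => x) fun _ => measurable_id
  have hvar := IndepFun.variance_sum (s := Finset.range n) (fun k _ => hk k)
    (fun i _ j _ hij => hind.indepFun hij)
  have hvk : ∀ k, variance (fun j : ℕ → ℝ => j k) (Measure.infinitePi fun _ : ℕ => F) =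
      ∫ x, x ^ 2 ∂F - (∫ x, x ∂F) ^ 2 := fun k => by
    have := (hmp k).variance_fun_comp (f := id) aemeasurable_id
    rw [variance_eq_sub hF] at this
    exact this
  simp only [hvk, Finset.sum_const, Finset.card_range, nsmul_eq_mul] at hvar
  have he : (∑ k ∈ Finset.range n, fun j : ℕ → ℝ => j k) =
      fun j : ℕ → ℝ => ∑ k ∈ Finset.range n, j k := by ext j; simp
  rw [he, variance_eq_sub hmem, hmean] at hvar
  simp only [Pi.pow_apply] at hvar
  linear_combination hvar

/-- Fubini conditions on `N`. With `m₁, m₂` the moments of `F`, the second moment is `r (m₂ - m₁²) +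
(r + r²) m₁²`, and subtracting `(r m₁)²` leaves `r m₂`. -/
theorem variance_randomSum {N : Ω → ℕ} (hN : Measurable N) {r : ℝ≥0}
    (hlaw : P.map N = poissonMeasure r) (hF : MemLp id 2 F) :
    MemLp (fun p : Ω × (ℕ → ℝ) => ∑ k ∈ Finset.range (N p.1), p.2 k) 2
      (P.prod (Measure.infinitePi fun _ : ℕ => F)) ∧
    variance (fun p : Ω × (ℕ → ℝ) => ∑ k ∈ Finset.range (N p.1), p.2 k)
      (P.prod (Measure.infinitePi fun _ : ℕ => F)) = r * ∫ x, x ^ 2 ∂F := by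
  have hY := measurable_randomSum hN
  have hmom := fun g : ℕ → ℝ => integral_map (μ := P) hN.aemeasurable (f := g)
    measurable_from_nat.aestronglyMeasurable
  have hint := fun g : ℕ → ℝ => integrable_map_measure (μ := P) (g := g) (f := N)
    measurable_from_nat.aestronglyMeasurable hN.aemeasurable
  rw [hlaw] at hmom hint
  obtain ⟨i1, m1⟩ := integral_natCast_poissonMeasure r
  obtain ⟨i2, m2⟩ := integral_natCast_sq_poissonMeasure r
  rw [hmom] at m1 m2
  rw [hint] at i1 i2
  have hS := moments_sum_infinitePi F hF
  have hmem : MemLp (fun p : Ω × (ℕ → ℝ) => ∑ k ∈ Finset.range (N p.1), p.2 k) 2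
      (P.prod (Measure.infinitePi fun _ : ℕ => F)) := by
    rw [memLp_two_iff_integrable_sq hY.aestronglyMeasurable,
      integrable_prod_iff (hY.pow_const 2).aestronglyMeasurable]
    refine ⟨Eventually.of_forall fun ω => (hS (N ω)).1.integrable_sq, ?_⟩
    simp only [Real.norm_of_nonneg (sq_nonneg _), (hS _).2.2]
    exact (i1.mul_const _).add (i2.mul_const _)
  refine ⟨hmem, ?_⟩
  rw [variance_eq_sub hmem, integral_prod _ (hmem.integrable one_le_two)]
  simp only [Pi.pow_apply]
  rw [integral_prod _ hmem.integrable_sq]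
  simp only [(hS _).2.2, (hS _).2.1]
  rw [Function.comp_def] at i1 i2
  rw [integral_add (i1.mul_const _) (i2.mul_const _), integral_mul_const, integral_mul_const,
    integral_mul_const, m1, m2]
  ring

end RandomSum

namespace IsPoissonProcess

variable {Ω : Type*} {mΩ : MeasurableSpace Ω} {P : Measure Ω} [IsProbabilityMeasure P]
    {𝓕 : Filtration ℝ≥0 mΩ} {T : ℝ≥0∞} {r : ℝ≥0} {N : ℝ≥0 → Ω → ℕ}

theorem map_eq_poissonMeasure (hN : IsPoissonProcess P 𝓕 T r N) {t : ℝ≥0} (ht : t ∈ TimeSet T) :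
    P.map (N t) = poissonMeasure (r * t) := by
  have h := hN.map_eq (s := 0) bot_le ht
  simp only [hN.zero, Nat.cast_zero, sub_zero, tsub_zero] at h
  have hm := hN.measurable ht
  have hcast : Measurable fun m : ℕ => (m : ℝ) := measurable_from_nat
  have h1 := Measure.map_map (μ := P) (f := fun ω => (N t ω : ℝ)) (g := Nat.floor)
    Nat.measurable_floor (hcast.comp hm)
  have h2 := Measure.map_map (μ := poissonMeasure (r * t)) (g := (Nat.floor : ℝ → ℕ))
    Nat.measurable_floor hcast
  rw [h, h2] at h1
  simpa [Function.comp_def] using h1.symm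

/-- The joint characteristic function of the increments of a compound Poisson process. -/
theorem integral_exp_randomSum (hN : IsPoissonProcess P 𝓕 T r N)
    (hmono : ∀ ω, ∀ s t, s ≤ t → t ∈ TimeSet T → N s ω ≤ N t ω) (F : Measure ℝ)
    [IsProbabilityMeasure F] {t : ℕ → ℝ≥0} (ht : Monotone t) (ht0 : t 0 = 0)
    {n : ℕ} (hn : t n ∈ TimeSet T) (w : ℕ → ℝ) :
    ∫ p, Complex.exp (Complex.I * ((∑ k ∈ Finset.range n,
        w k * (∑ l ∈ Finset.range (N (t (k + 1)) p.1), p.2 l -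
          ∑ l ∈ Finset.range (N (t k) p.1), p.2 l) : ℝ) : ℂ))
        ∂P.prod (Measure.infinitePi fun _ : ℕ => F) =
      ∏ k ∈ Finset.range n, Complex.exp (r * (t (k + 1) - t k) *
        (∫ x, Complex.exp (Complex.I * w k * x) ∂F - 1)) := by
  have hY : ∀ k ≤ n, Measurable fun p : Ω × (ℕ → ℝ) =>
      ∑ l ∈ Finset.range (N (t k) p.1), p.2 l := fun k hk =>
    measurable_randomSum (hN.measurable (timeSet_mono (ht hk) hn))
  have hsum : Measurable fun p : Ω × (ℕ → ℝ) => ∑ k ∈ Finset.range n,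
        w k * (∑ l ∈ Finset.range (N (t (k + 1)) p.1), p.2 l -
          ∑ l ∈ Finset.range (N (t k) p.1), p.2 l) := by
    refine Finset.measurable_fun_sum _ fun k hk => ?_
    have hk := Finset.mem_range.1 hk
    exact ((hY _ hk).sub (hY _ hk.le)).const_mul _
  rw [integral_prod _ (Integrable.of_bound (C := 1)
    (Measurable.aestronglyMeasurable (by fun_prop))
    (Eventually.of_forall fun _ => (norm_exp_I_mul_ofReal _).le)),
    ← hN.setIntegral_prod_pow hmono ht hn]
  refine integral_congr_ae (Eventually.of_forall fun ω => ?_)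
  -- Monotonicity of the counts is known only within the horizon, so the index is frozen at `n`.
  have hM : Monotone fun k => N (t (min k n)) ω := fun i j hij =>
    hmono ω _ _ (ht (min_le_min_right n hij)) (timeSet_mono (ht (min_le_right _ _)) hn)
  obtain ⟨c, hc1, hc2⟩ := exists_weights_of_blocks hM (by simp [ht0, hN.zero ω]) w
    (fun u => ∫ x, Complex.exp (Complex.I * u * x) ∂F) n
  have hmin : ∀ k ∈ Finset.range n, min k n = k ∧ min (k + 1) n = k + 1 := fun k hk => by
    have := Finset.mem_range.1 hk
    omega
  have hprod : ∏ k ∈ Finset.range n, (∫ x, Complex.exp (Complex.I * w k * x) ∂F) ^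
      (N (t (k + 1)) ω - N (t k) ω) =
      ∏ l ∈ Finset.range (N (t (min n n)) ω), ∫ x, Complex.exp (Complex.I * c l * x) ∂F := by
    rw [hc2]
    exact Finset.prod_congr rfl fun k hk => by rw [(hmin k hk).1, (hmin k hk).2]
  beta_reduce
  rw [hprod, ← integral_exp_sum_infinitePi]
  refine integral_congr_ae (Eventually.of_forall fun j => ?_)
  beta_reduce
  rw [← hc1 j]
  congr 3
  exact Finset.sum_congr rfl fun k hk => by rw [(hmin k hk).1, (hmin k hk).2]

end IsPoissonProcess

/-! ### The compound Poisson representation and the moments -/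

theorem exists_subset_outside {A : Set ℝ} (hA : (0 : ℝ) ∉ closure A) :
    ∃ ε > 0, A ⊆ outside ε := by
  rw [Metric.mem_closure_iff] at hA
  push Not at hA
  obtain ⟨δ, hδ, h⟩ := hA
  refine ⟨δ / 2, half_pos hδ, fun y hy => mem_outside.2 ?_⟩
  have := h y hy
  rw [dist_comm, Real.dist_eq, sub_zero] at this
  linarith

namespace IsLevyProcess

variable {Ω : Type u} {mΩ : MeasurableSpace Ω} {P : Measure Ω} [IsProbabilityMeasure P]
    {𝓕 : Filtration ℝ≥0 mΩ} {T : ℝ≥0∞} {L : ℝ≥0 → Ω → ℝ}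

/-- The process of partial sums of an independent i.i.d. sequence with law `F` at the times of the
jump count has the law of the jump integral. -/
theorem identDistrib_jumpIntegral (hL : IsLevyProcess P 𝓕 T L) {ε : ℝ} (hε : 0 < ε)
    {A : Set ℝ} (hA : MeasurableSet A) (hAε : A ⊆ outside ε) {f : ℝ → ℝ} (hf : Measurable f)
    {F : Measure ℝ} [IsProbabilityMeasure F]
    (hF : ((levyMeasure P T L).restrict A).map f = (levyMeasure P T L A).toNNReal • F) :
    IdentDistrib (fun ω (t : TimeSet T) => jumpIntegral L A f t ω)
      (fun p (t : TimeSet T) => ∑ k ∈ Finset.range (jumpCount L A t p.1), p.2 k) P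
      (P.prod (Measure.infinitePi fun _ : ℕ => F)) := by
  have := hL.isFiniteMeasure_restrict_levyMeasure hε hAε
  have hN := hL.isPoissonProcess_jumpCount hε hA hAε
  have hA0 : (0 : ℝ) ∉ A := fun h => absurd (mem_outside.1 (hAε h)) (by simpa using hε.le)
  have hlevy := hL.isLevyProcess_jumpIntegral hε hA hAε hf
  -- Transport by `f` turns the exponent for `ν` into the compound Poisson exponent with jump law
  -- `F`.
  have hφ : ∀ u : ℝ, ∫ y in A, (Complex.exp (Complex.I * u * f y) - 1) ∂levyMeasure P T L =
      (levyMeasure P T L A).toNNReal * (∫ x, Complex.exp (Complex.I * u * x) ∂F - 1) := by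
    intro u
    have hi : Integrable (fun x : ℝ => Complex.exp (Complex.I * u * x)) F :=
      Integrable.of_bound (C := 1) (Measurable.aestronglyMeasurable (by fun_prop))
        (Eventually.of_forall fun x => by
          have := norm_exp_I_mul_ofReal (u * x)
          push_cast at this
          rw [mul_assoc, this])
    rw [← integral_map (f := fun x : ℝ => Complex.exp (Complex.I * u * x) - 1) hf.aemeasurable
      (Measurable.aestronglyMeasurable (by fun_prop)), hF, integral_smul_nnreal_measure,
      integral_sub hi (integrable_const _)]
    simp [NNReal.smul_def]
  refine identDistrib_of_increments (fun t ht => hL.measurable_jumpIntegral hε hA hAε hf ht)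
    (Z' := fun t (p : Ω × (ℕ → ℝ)) => ∑ k ∈ Finset.range (jumpCount L A t p.1), p.2 k)
    (fun t ht => measurable_randomSum (hN.measurable ht)) (jumpIntegral_zero L hA0 f)
    (fun p => by simp [hN.zero]) fun n t w ht ht0 hn => ?_
  rw [hN.integral_exp_randomSum (fun ω s t hst ht => hL.monotone_jumpCount hε hA hAε hst ht ω) F ht
    ht0 hn w]
  have h1 := setIntegral_prod_increments (P := P) (𝓕 := 𝓕) (T := T) (𝕜 := ℂ)
    (Z := jumpIntegral L A f) (G := fun k x => Complex.exp (Complex.I * w k * x))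
    hlevy.adapted hlevy.indep_increments ht hn (fun k => by fun_prop) MeasurableSet.univ
  rw [setIntegral_univ, probReal_univ, RCLike.ofReal_one, one_mul] at h1
  have h2 : ∀ ω, Complex.exp (Complex.I * ((∑ k ∈ Finset.range n, w k *
      (jumpIntegral L A f (t (k + 1)) ω - jumpIntegral L A f (t k) ω) : ℝ) : ℂ)) =
      ∏ k ∈ Finset.range n, Complex.exp (Complex.I * w k *
        ((jumpIntegral L A f (t (k + 1)) ω - jumpIntegral L A f (t k) ω : ℝ) : ℂ)) := by
    intro ω
    rw [← Complex.exp_sum]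
    congr 1
    push_cast
    rw [Finset.mul_sum]
    exact Finset.sum_congr rfl fun k _ => by ring
  simp only [h2]
  rw [h1]
  refine Finset.prod_congr rfl fun k hk => ?_
  obtain ⟨h, hh⟩ := exists_add_of_le (ht k.le_succ)
  have hk1 : t k + h ∈ TimeSet T := by
    rw [← hh]
    exact timeSet_mono (ht (Nat.succ_le_of_lt (Finset.mem_range.1 hk))) hn
  have h3 := hL.setIntegral_exp_jumpIntegral hε hA hAε hf hk1 (w k) MeasurableSet.univ
  rw [setIntegral_univ, probReal_univ, Complex.ofReal_one, one_mul, hφ] at h3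
  rw [← Nat.succ_eq_add_one, hh, h3]
  congr 1
  push_cast
  ring

/-- The representation lives on `Ω × (ℕ → ℝ)`: the jump count on the first factor, an i.i.d.
sequence on the second, independent by construction. The `J k` are fresh variables, not the actual
jump sizes, since only equality in law is claimed. -/
theorem isCompoundPoissonProcess_jumpIntegral (hL : IsLevyProcess P 𝓕 T L) {ε : ℝ} (hε : 0 < ε)
    {A : Set ℝ} (hA : MeasurableSet A) (hAε : A ⊆ outside ε) {f : ℝ → ℝ} (hf : Measurable f)
    {F : Measure ℝ} [IsProbabilityMeasure F]
    (hF : ((levyMeasure P T L).restrict A).map f = (levyMeasure P T L A).toNNReal • F) :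
    IsCompoundPoissonProcess P 𝓕 T (levyMeasure P T L A).toNNReal F (jumpIntegral L A f) := by
  have hN := hL.isPoissonProcess_jumpCount hε hA hAε
  obtain ⟨𝓖, h𝓖⟩ := hN.comp_fst (Measure.infinitePi fun _ : ℕ => F)
  have hsnd : (P.prod (Measure.infinitePi fun _ : ℕ => F)).map (fun p => p.2) =
      Measure.infinitePi fun _ : ℕ => F := measurePreserving_snd.map_eq
  have hlaw : ∀ k : ℕ, (P.prod (Measure.infinitePi fun _ : ℕ => F)).map (fun p => p.2 k) = F :=
    fun k => ((measurePreserving_eval_infinitePi (fun _ : ℕ => F) k).comp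
      (measurePreserving_snd (μ := P))).map_eq
  refine ⟨hL.isLevyProcess_jumpIntegral hε hA hAε hf, Ω × (ℕ → ℝ), inferInstance,
    P.prod (Measure.infinitePi fun _ : ℕ => F), 𝓖, fun t p => jumpCount L A t p.1,
    fun k p => p.2 k, inferInstance, h𝓖, fun k => by fun_prop, hlaw, ?_, ?_,
    hL.identDistrib_jumpIntegral hε hA hAε hf hF⟩
  · rw [iIndepFun_iff_map_fun_eq_infinitePi_map fun k => by fun_prop]
    simp only [hlaw]
    exact hsnd
  · exact indepFun_prod (X := fun ω (t : TimeSet T) => jumpCount L A t ω)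
      (Y := fun (j : ℕ → ℝ) => j) (measurable_pi_lambda _ fun t => hN.measurable t.2) measurable_id

/-- Square integrability and variance depend only on the law at time `t`, so they are computed for
the random sum, where `ν(A)` times the second moment of `F` is the integral of `f ^ 2` over `A`. -/
theorem variance_jumpIntegral (hL : IsLevyProcess P 𝓕 T L) {ε : ℝ} (hε : 0 < ε)
    {A : Set ℝ} (hA : MeasurableSet A) (hAε : A ⊆ outside ε) {f : ℝ → ℝ} (hf : Measurable f)
    (hf2 : MemLp f 2 ((levyMeasure P T L).restrict A)) {t : ℝ≥0} (ht : t ∈ TimeSet T) :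
    MemLp (jumpIntegral L A f t) 2 P ∧
      variance (jumpIntegral L A f t) P = t * ∫ x in A, f x ^ 2 ∂(levyMeasure P T L) := by
  have := hL.isFiniteMeasure_restrict_levyMeasure hε hAε
  have hN := hL.isPoissonProcess_jumpCount hε hA hAε
  obtain ⟨F, hFp, hF, hFmem⟩ := exists_isProbabilityMeasure_eq_smul
    (((levyMeasure P T L).restrict A).map f)
  rw [Measure.map_apply hf MeasurableSet.univ, Set.preimage_univ, Measure.restrict_apply_univ] at hF
  have hid := (hL.identDistrib_jumpIntegral hε hA hAε hf hF).comp
    (u := fun z : TimeSet T → ℝ => z ⟨t, ht⟩) (measurable_pi_apply _)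
  have hmom := variance_randomSum F (hN.measurable ht) (hN.map_eq_poissonMeasure ht)
    (hFmem ((memLp_map_measure_iff measurable_id.aestronglyMeasurable hf.aemeasurable).2 hf2))
  refine ⟨hid.memLp_iff.2 hmom.1, (hid.variance_eq.trans hmom.2).trans ?_⟩
  rw [← integral_map (f := fun x : ℝ => x ^ 2) hf.aemeasurable
    (Measurable.aestronglyMeasurable (by fun_prop)), hF, integral_smul_nnreal_measure]
  simp only [NNReal.smul_def, smul_eq_mul]
  push_cast
  ring

end IsLevyProcess

theorem theorem5p3 {Ω : Type u} {mΩ : MeasurableSpace Ω} (P : Measure Ω) [IsProbabilityMeasure P]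
    (𝓕 : Filtration ℝ≥0 mΩ) (T : ℝ≥0∞) (L : ℝ≥0 → Ω → ℝ) (hL : IsLevyProcess P 𝓕 T L)
    (A : Set ℝ) (hA : MeasurableSet A) (hA0 : (0 : ℝ) ∉ closure A)
    (f : ℝ → ℝ) (hf : Measurable f) :
    ((∃ (r : ℝ≥0) (F : Measure ℝ),
        IsCompoundPoissonProcess P 𝓕 T r F (jumpIntegral L A f)) ∧
      ∀ t ∈ TimeSet T, ∀ v : ℝ,
        IntegrableOn (fun x => Complex.exp (Complex.I * v * f x) - 1) A (levyMeasure P T L) ∧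
        ∫ ω, Complex.exp (Complex.I * v * jumpIntegral L A f t ω) ∂P =
          Complex.exp (t * ∫ x in A, (Complex.exp (Complex.I * v * f x) - 1)
            ∂(levyMeasure P T L))) ∧
    (IntegrableOn f A (levyMeasure P T L) → ∀ t ∈ TimeSet T,
      Integrable (jumpIntegral L A f t) P ∧
      ∫ ω, jumpIntegral L A f t ω ∂P = t * ∫ x in A, f x ∂(levyMeasure P T L)) ∧
    (MemLp f 2 ((levyMeasure P T L).restrict A) → ∀ t ∈ TimeSet T,
      MemLp (jumpIntegral L A f t) 2 P ∧
      variance (jumpIntegral L A f t) P = t * ∫ x in A, |f x| ^ 2 ∂(levyMeasure P T L)) := by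
  obtain ⟨ε, hε, hAε⟩ := exists_subset_outside hA0
  have := hL.isFiniteMeasure_restrict_levyMeasure hε hAε
  have hA0' : (0 : ℝ) ∉ A := fun h => hA0 (subset_closure h)
  refine ⟨⟨?_, fun t ht v => ⟨?_, ?_⟩⟩,
    fun hi t ht => hL.integral_jumpSum_indicator hε hA hAε ht hf hi, fun hf2 t ht => ?_⟩
  · obtain ⟨F, hFp, hF, -⟩ := exists_isProbabilityMeasure_eq_smul
      (((levyMeasure P T L).restrict A).map f)
    rw [Measure.map_apply hf MeasurableSet.univ, Set.preimage_univ,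
      Measure.restrict_apply_univ] at hF
    exact ⟨_, F, hL.isCompoundPoissonProcess_jumpIntegral hε hA hAε hf hF⟩
  · have h := integrable_exp_I_mul_sub_one (μ := (levyMeasure P T L).restrict A)
      (hf.const_mul v)
    push_cast at h
    simpa only [IntegrableOn, mul_assoc] using h
  · have h := hL.setIntegral_exp_jumpIntegral hε hA hAε hf (s := 0) (h := t) (by rwa [zero_add]) v
      MeasurableSet.univ
    simpa only [setIntegral_univ, probReal_univ, Complex.ofReal_one, one_mul, zero_add,
      IsLevyProcess.jumpIntegral_zero L hA0' f, sub_zero] using h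
  · simpa only [sq_abs] using hL.variance_jumpIntegral hε hA hAε hf hf2 ht
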